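/- Let $1\le r\le\infty$ or $r=\omega$ (real-analytic). A subset of the plane is called piecewise $C^r$ if it is a union of finitely many simple regular $C^r$ arcs (end points included), any two of which meet at most at common end points. For a bounded open set $M\subset\mathbb{R}^2$ let $\mathcal{A}(M)$ be the family of all non-empty open sets $\Omega\subset M$ whose boundary $\partial\Omega$ is piecewise $C^r$. For $\Omega\in\mathcal{A}(M)$ let $$\eta^\partial(\Omega)=\frac{|\partial\Omega\cap M|}{|\partial\Omega\cap\partial M|}\in[0,\infty],$$ where $|\cdot|$ denotes length (one-dimensional Hausdorff measure) and $\eta^\partial(\Omega)=\infty$ if $|\partial\Omega\cap\partial M|=0$. For $k\in\mathbb{N}$, $k\ge 1$, the $k$-th Escobar constant of $M$ is $$I_k(M)=\inf_{(\Omega_1,\dots,\Omega_k)}\ \max_{1\le j\le k}\eta^\partial(\Omega_j),$$ the infimum being over all $k$-tuples of pairwise disjoint sets $\Omega_1,\dots,\Omega_k\in\mathcal{A}(M)$. Let $\mathbb{D}$ be the open unit disk in $\mathbb{R}^2$, let $n\ge 3$, and let $D_n\subset\mathbb{R}^2$ be an (open) regular $n$-gon, of arbitrary position and size. Theorem (Regular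 polygons). (i) For every $k\ge n$, $$I_k(D_n)=\cos(\pi/n)\le I_k(\mathbb{D}).$$ (ii) If $n=\ell k$ with $\ell,k\in\mathbb{N}$, then $$I_k(D_n)=\sin(\pi/k)\,\cot(\pi/n)\,\frac{k}{n}\le I_k(\mathbb{D}).$$ -/

import Mathlib

noncomputable section

namespace Escobar

open MeasureTheory

/-- The curve `γ`, parametrized by `[0, 1]`, is a simple regular arc of class `C ^ r`
(up to and including its end points). -/
structure IsRegularArc (r : WithTop ℕ∞) (γ : ℝ → ℂ) : Prop where
  contDiffOn : ContDiffOn ℝ r γ (Set.Icc 0 1)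
  deriv_ne_zero : ∀ t ∈ Set.Icc (0 : ℝ) 1, derivWithin γ (Set.Icc 0 1) t ≠ 0
  injOn : Set.InjOn γ (Set.Icc 0 1)

/-- A subset of the plane is piecewise `C ^ r` if it is the union of finitely many simple regular
arcs of class `C ^ r`, two distinct ones of which meet at most at common end points.
(Closed curves are covered by cutting them into several arcs.) -/
def IsPiecewiseSmooth (r : WithTop ℕ∞) (S : Set ℂ) : Prop :=
  ∃ (m : ℕ) (γ : Fin m → ℝ → ℂ),
    (∀ i, IsRegularArc r (γ i)) ∧
    (∀ i j, i ≠ j → Disjoint (γ i '' Set.Ioo 0 1) (γ j '' Set.Icc 0 1)) ∧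
    S = ⋃ i, γ i '' Set.Icc 0 1

/-- The family `𝒜(M)`: the non-empty open subsets of `M` with piecewise `C ^ r` boundary. -/
structure IsAdmissible (r : WithTop ℕ∞) (M Ω : Set ℂ) : Prop where
  nonempty : Ω.Nonempty
  isOpen : IsOpen Ω
  subset : Ω ⊆ M
  boundary : IsPiecewiseSmooth r (frontier Ω)

/-- The length of the interior boundary `∂Ω ∩ M` (here `M` is an open set). -/
def interiorLength (M Ω : Set ℂ) : ENNReal :=
  Measure.hausdorffMeasure 1 (frontier Ω ∩ M)

/-- The length of the exterior boundary `∂Ω ∩ ∂M`. -/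
def exteriorLength (M Ω : Set ℂ) : ENNReal :=
  Measure.hausdorffMeasure 1 (frontier Ω ∩ frontier M)

open Classical in
/-- The isoperimetric ratio of `Ω` in `M`, equal to `∞` if the exterior boundary is empty or,
more generally, has length zero. -/
def ratio (M Ω : Set ℂ) : ENNReal :=
  if exteriorLength M Ω = 0 then ⊤ else interiorLength M Ω / exteriorLength M Ω

/-- The `k`-th Escobar constant of the open set `M`, the infimum over all mutually disjoint
`k`-tuples of admissible sets of the largest isoperimetric ratio in the tuple. -/
def escobarConstant (r : WithTop ℕ∞) (k : ℕ) (M : Set ℂ) : ENNReal :=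
  ⨅ Ω ∈ {Ω : Fin k → Set ℂ |
      (∀ j, IsAdmissible r M (Ω j)) ∧ Pairwise fun i j => Disjoint (Ω i) (Ω j)},
    ⨆ j, ratio M (Ω j)

/-- The open regular `n`-gon with centre `c` and vertices `c + w * exp (2 * π * I * j / n)`.
For `n ≥ 3`, letting `c` and `w ≠ 0` vary gives all regular `n`-gons of the plane. -/
def regularPolygon (n : ℕ) (c w : ℂ) : Set ℂ :=
  interior (convexHull ℝ (Set.range fun j : Fin n =>
    c + w * Complex.exp (2 * Real.pi * Complex.I * (j : ℕ) / n)))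

/-- The open unit disk. -/
def unitDisk : Set ℂ := Metric.ball 0 1

end Escobar

end

noncomputable section

namespace Escobar

open MeasureTheory Set Filter Topology
open scoped NNReal ENNReal

/-! Lower bounds come from a calibration, upper bounds from explicit convex pieces of the polygon.

Lower bound. Give each boundary arc of `Ω` the multiplicity `1`, `-1` or `0`, according to the sides
of the arc on which `Ω` lies. With these weights the boundary is a cycle: the weighted increments of
any function `ψ` over the arcs sum up to zero (`IsArcSystem.sum_mult_mul_eq_zero`). The local reason
is that the indicator of `Ω` along a small circle around a vertex returns to its initial value after
one turn (`sum_mult_eq_zero`). Now let `ψ` be 1-Lipschitz and grow at rate `lam` with respect to arc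
length of `∂M` on the exterior boundary of `Ω`. There `Ω` lies only on the inner side of the arc, so
the exterior part contributes exactly `lam` times its length, while the interior part contributes at
least minus its length. Hence `lam` times the exterior length is at most the interior length
(`mul_exteriorLength_le`).

Existence of `ψ`. The exterior boundaries of `k` disjoint sets overlap in finite sets only, so one
of them occupies a parameter set `E` of measure at most `P / k`, where `P` is the parameter length
of `∂M`. Integrate a density that has mean zero, is `1` on `E` and a negative constant or zero
elsewhere (`exists_density`). Its integral over a boundary interval of length `d` is at most `min
(min d (P - d)) (P / k)` in absolute value. If each chord of `∂M` is at least `lam * σ` times this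
minimum, `σ` being the speed, then the primitive is 1-Lipschitz on `∂M` and extends to the plane
(`exists_calibration`). So `le_escobarConstant` reduces the lower bound to a chord inequality. For
the disk this follows from concavity of the sine. For the polygon, both sides of the inequality are
compared at integers and interpolated affinely (`chord_stdPolygon`).

Upper bound. For `n = l * k` with `k ≥ 2` the polygon contains `k` disjoint caps, each cut off by a
line through the midpoints of two sides and containing `l` sides' worth of boundary (`ratio_cap_le`,
`disjoint_cap`). For `cos (π / n)` and any `k`, take thin-ended trapezoids at a single vertex in
geometric progression; their common ratio tends to `cos (π / n)` as the factor of the progression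
tends to `0` (`escobarConstant_stdPolygon_le_cos`).

The case `k ≥ n` then follows from `k = n` by monotonicity in `k`, and the comparison with the disk
from `x ≤ tan x`. -/

/-- The velocity of a curve parametrized by `[0, 1]`. -/
def vel (γ : ℝ → ℂ) (t : ℝ) : ℂ := derivWithin γ (Icc 0 1) t

/-! ### Regular arcs and their approximation by tangent lines -/

theorem IsRegularArc.of_le {r s : WithTop ℕ∞} {γ : ℝ → ℂ} (h : IsRegularArc r γ) (hs : s ≤ r) :
    IsRegularArc s γ :=
  ⟨h.contDiffOn.of_le hs, h.deriv_ne_zero, h.injOn⟩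

theorem IsPiecewiseSmooth.of_le {r s : WithTop ℕ∞} {S : Set ℂ} (h : IsPiecewiseSmooth r S)
    (hs : s ≤ r) : IsPiecewiseSmooth s S := by
  obtain ⟨m, γ, h1, h2, h3⟩ := h
  exact ⟨m, γ, fun i => (h1 i).of_le hs, h2, h3⟩

theorem IsAdmissible.of_le {r s : WithTop ℕ∞} {M Ω : Set ℂ} (h : IsAdmissible r M Ω)
    (hs : s ≤ r) : IsAdmissible s M Ω :=
  ⟨h.nonempty, h.isOpen, h.subset, h.boundary.of_le hs⟩

namespace IsRegularArc

variable {γ : ℝ → ℂ}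

theorem continuousOn (h : IsRegularArc 1 γ) : ContinuousOn γ (Icc 0 1) := h.contDiffOn.continuousOn

theorem continuousOn_vel (h : IsRegularArc 1 γ) : ContinuousOn (vel γ) (Icc 0 1) :=
  h.contDiffOn.continuousOn_derivWithin (uniqueDiffOn_Icc one_pos) le_rfl

theorem hasDerivWithinAt (h : IsRegularArc 1 γ) {t : ℝ} (ht : t ∈ Icc (0 : ℝ) 1) :
    HasDerivWithinAt γ (vel γ t) (Icc 0 1) t :=
  ((h.contDiffOn.differentiableOn (by simp)) t ht).hasDerivWithinAt

theorem hasDerivAt (h : IsRegularArc 1 γ) {t : ℝ} (ht : t ∈ Ioo (0 : ℝ) 1) :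
    HasDerivAt γ (vel γ t) t :=
  (h.hasDerivWithinAt (Ioo_subset_Icc_self ht)).hasDerivAt (Icc_mem_nhds ht.1 ht.2)

theorem vel_ne_zero (h : IsRegularArc 1 γ) {t : ℝ} (ht : t ∈ Icc (0 : ℝ) 1) : vel γ t ≠ 0 :=
  h.deriv_ne_zero t ht

/-- Near a parameter, the increments of a regular arc are uniformly close to those of its tangent
line. -/
theorem exists_approx (h : IsRegularArc 1 γ) {ε : ℝ} (hε : 0 < ε) :
    ∃ δ > 0, ∀ u ∈ Icc (0 : ℝ) 1, ∀ s ∈ Icc (0 : ℝ) 1, ∀ t ∈ Icc (0 : ℝ) 1,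
      |s - u| < δ → |t - u| < δ →
        ‖γ t - γ s - (t - s : ℝ) * vel γ u‖ ≤ ε * |t - s| ∧ ‖vel γ t - vel γ u‖ < ε := by
  have huc := isCompact_Icc.uniformContinuousOn_of_continuous h.continuousOn_vel
  obtain ⟨δ, hδ, H⟩ := Metric.uniformContinuousOn_iff.1 huc ε hε
  refine ⟨δ, hδ, fun u hu s hs t ht hsu htu => ⟨?_, ?_⟩⟩
  -- The mean value inequality is applied to `γ` minus its linear part at `u`; the derivative of
  -- this difference is small by uniform continuity of the velocity.
  · have hconv : Convex ℝ (Icc (0 : ℝ) 1 ∩ Metric.ball u δ) :=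
      (convex_Icc 0 1).inter (convex_ball u δ)
    have := hconv.norm_image_sub_le_of_norm_hasDerivWithin_le
      (f := fun x => γ x - (x : ℝ) * vel γ u) (f' := fun x => vel γ x - vel γ u) (C := ε)
      (x := s) (y := t) ?_ ?_ ⟨hs, by simpa [Real.dist_eq] using hsu⟩
      ⟨ht, by simpa [Real.dist_eq] using htu⟩
    · rw [Real.norm_eq_abs] at this
      have e : γ t - γ s - (t - s : ℝ) * vel γ u = γ t - t * vel γ u - (γ s - s * vel γ u) := by
        push_cast; ring
      rw [e]
      exact this
    · intro x hx
      have h1 := (h.hasDerivWithinAt hx.1).mono (inter_subset_left (t := Metric.ball u δ))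
      have h2 : HasDerivWithinAt (fun x : ℝ => (x : ℂ) * vel γ u) (1 * vel γ u)
          (Icc (0 : ℝ) 1 ∩ Metric.ball u δ) x :=
        ((Complex.ofRealCLM.hasDerivAt (x := x)).mul_const (vel γ u)).hasDerivWithinAt
      rw [one_mul] at h2
      exact h1.sub h2
    · intro x hx
      rw [← dist_eq_norm]
      exact (H x hx.1 u hu hx.2).le
  · rw [← dist_eq_norm]
    exact H t ht u hu (by simpa [Real.dist_eq] using htu)

theorem reverse (h : IsRegularArc 1 γ) :
    IsRegularArc 1 (fun t => γ (1 - t)) ∧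
      ∀ t ∈ Icc (0 : ℝ) 1, vel (fun t => γ (1 - t)) t = -vel γ (1 - t) := by
  have hmaps : MapsTo (fun t : ℝ => 1 - t) (Icc 0 1) (Icc 0 1) := fun t ht =>
    ⟨by linarith [ht.2], by linarith [ht.1]⟩
  have hv : ∀ t ∈ Icc (0 : ℝ) 1, vel (fun t => γ (1 - t)) t = -vel γ (1 - t) := by
    intro t ht
    have h1 : HasDerivWithinAt (fun t : ℝ => 1 - t) (-1) (Icc 0 1) t := by
      simpa using ((hasDerivAt_id t).const_sub 1).hasDerivWithinAt
    have := (h.hasDerivWithinAt (hmaps ht)).scomp t h1 hmaps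
    have e := this.derivWithin ((uniqueDiffOn_Icc one_pos) t ht)
    rw [neg_one_smul] at e
    exact e
  refine ⟨⟨h.contDiffOn.comp (by fun_prop) hmaps, ?_, ?_⟩, hv⟩
  · intro t ht
    have := hv t ht
    rw [vel] at this
    rw [this]
    exact neg_ne_zero.2 (h.vel_ne_zero (hmaps ht))
  · intro s hs t ht hst
    have := h.injOn (hmaps hs) (hmaps ht) hst
    linarith

end IsRegularArc

/-! ### The two sides of a boundary arc -/

/-- A preconnected set that avoids the frontier of `Ω` is inside or outside `Ω`. -/
theorem subset_or_disjoint_of_preconnected {R Ω : Set ℂ} (hR : IsPreconnected R) (hΩ : IsOpen Ω)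
    (hd : ∀ z ∈ R, z ∉ frontier Ω) : R ⊆ Ω ∨ ∀ z ∈ R, z ∉ Ω := by
  by_cases hne : (R ∩ Ω).Nonempty
  · left
    refine hR.subset_left_of_subset_union hΩ (isClosed_closure (s := Ω)).isOpen_compl
      (disjoint_compl_right.mono_left subset_closure) (fun z hz => ?_) hne
    by_contra hcon
    simp only [mem_union, mem_compl_iff, not_or, not_not] at hcon
    exact hd z hz ⟨hcon.2, fun hi => hcon.1 (interior_subset hi)⟩
  · right
    intro z hz hzΩ
    exact hne ⟨z, hz, hzΩ⟩

/-- A regular arc in `F` that makes up all of `F` near each of its inner points. -/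
structure IsFreeArc (F : Set ℂ) (γ : ℝ → ℂ) : Prop where
  arc : IsRegularArc 1 γ
  mem : ∀ t ∈ Icc (0 : ℝ) 1, γ t ∈ F
  isolated : ∀ t₀ ∈ Ioo (0 : ℝ) 1, ∀ δ > 0, ∃ ρ > 0, ∀ z ∈ F, ‖z - γ t₀‖ < ρ →
    ∃ t ∈ Ioo (0 : ℝ) 1, |t - t₀| < δ ∧ γ t = z

/-- The open set `Ω` lies on the left (`e = 1`) or on the right (`e = -1`) of `γ` at `t`. -/
def OnSide (Ω : Set ℂ) (γ : ℝ → ℂ) (e t : ℝ) : Prop :=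
  ∀ᶠ h in 𝓝[>] (0 : ℝ), γ t + (e * h : ℝ) * (Complex.I * vel γ t) ∈ Ω

namespace IsFreeArc

variable {F Ω : Set ℂ} {γ : ℝ → ℂ} {t₀ : ℝ}

/-- Near an inner point, `F` consists of points `γ s`, and `γ s - γ t` is almost parallel to the
tangent. So a double cone around the normal, however wide, meets `F` only at its apex, uniformly for
apices `γ t` near `γ t₀`. -/
theorem exists_cone_notMem (h : IsFreeArc F γ) (ht₀ : t₀ ∈ Ioo (0 : ℝ) 1) {K : ℝ} (hK : 1 ≤ K) :
    ∃ δ > 0, ∃ η > 0, ∀ t, |t - t₀| < δ → t ∈ Ioo (0 : ℝ) 1 ∧ ‖vel γ t / vel γ t₀ - 1‖ < 1 / 4 ∧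
      ∀ ζ : ℂ, ζ ≠ 0 → ‖ζ‖ < η → |ζ.re| ≤ K * |ζ.im| → γ t + ζ * vel γ t₀ ∉ F := by
  have ht₀' := Ioo_subset_Icc_self ht₀
  set T := vel γ t₀ with hT
  have hT0 : T ≠ 0 := h.arc.vel_ne_zero ht₀'
  have hTn : 0 < ‖T‖ := norm_pos_iff.2 hT0
  -- This choice gives `K * ε + ε = 1 / 2`, so that a point of `F` in the cone forces `|s - t| ≤ |s
  -- - t| / 2`.
  set ε : ℝ := 1 / (2 * (K + 1)) with hε
  have hε0 : 0 < ε := by positivity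
  have hεK : K * ε + ε = 1 / 2 := by rw [hε]; field_simp
  have hε4 : ε ≤ 1 / 4 := by nlinarith
  obtain ⟨δ₁, hδ₁, H⟩ := h.arc.exists_approx (mul_pos hε0 hTn)
  obtain ⟨δ₂, hδ₂, hball⟩ := Metric.isOpen_iff.1 isOpen_Ioo t₀ ht₀
  obtain ⟨ρ, hρ, hiso⟩ := h.isolated t₀ ht₀ (min δ₁ δ₂) (lt_min hδ₁ hδ₂)
  have hcont : ContinuousAt γ t₀ := (h.arc.hasDerivAt ht₀).continuousAt
  obtain ⟨δ₃, hδ₃, hcl⟩ := Metric.continuousAt_iff.1 hcont (ρ / 2) (half_pos hρ)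
  refine ⟨min (min δ₁ δ₂) δ₃, lt_min (lt_min hδ₁ hδ₂) hδ₃, ρ / (2 * ‖T‖), by positivity, ?_⟩
  intro t ht
  have ht1 : |t - t₀| < δ₁ := ht.trans_le ((min_le_left _ _).trans (min_le_left _ _))
  have ht2 : |t - t₀| < δ₂ := ht.trans_le ((min_le_left _ _).trans (min_le_right _ _))
  have ht3 : |t - t₀| < δ₃ := ht.trans_le (min_le_right _ _)
  have htI : t ∈ Ioo (0 : ℝ) 1 := hball (by simpa [Real.dist_eq] using ht2)
  have htI' := Ioo_subset_Icc_self htI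
  refine ⟨htI, ?_, ?_⟩
  · have := (H t₀ ht₀' t htI' t htI' ht1 ht1).2
    have e : vel γ t / T - 1 = (vel γ t - T) / T := by field_simp
    rw [e, norm_div, div_lt_iff₀ hTn]
    nlinarith
  · intro ζ hζ hζη hcone hmem
    have hd : ‖γ t + ζ * T - γ t₀‖ < ρ := by
      have h1 : ‖γ t - γ t₀‖ < ρ / 2 := by
        rw [← dist_eq_norm]; exact hcl (by simpa [Real.dist_eq] using ht3)
      have h2 : ‖ζ * T‖ < ρ / 2 := by
        rw [norm_mul]
        calc ‖ζ‖ * ‖T‖ < ρ / (2 * ‖T‖) * ‖T‖ := by gcongr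
          _ = ρ / 2 := by field_simp
      calc ‖γ t + ζ * T - γ t₀‖ = ‖(γ t - γ t₀) + ζ * T‖ := by ring_nf
        _ ≤ _ := norm_add_le _ _
        _ < ρ := by linarith
    obtain ⟨s, hs, hst, hse⟩ := hiso _ hmem hd
    have hs' := Ioo_subset_Icc_self hs
    have := (H t₀ ht₀' t htI' s hs' ht1 (hst.trans_le (min_le_left _ _))).1
    have e : γ s - γ t - (s - t : ℝ) * T = (ζ - (s - t : ℝ)) * T := by rw [hse]; ring
    rw [e, norm_mul] at this
    have key : ‖ζ - (s - t : ℝ)‖ ≤ ε * |s - t| := by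
      by_contra hcon
      push Not at hcon
      nlinarith [mul_lt_mul_of_pos_right hcon hTn]
    have him : |ζ.im| ≤ ε * |s - t| := by
      refine le_trans ?_ key
      simpa using Complex.abs_im_le_norm (ζ - (s - t : ℝ))
    have hre : |ζ.re - (s - t)| ≤ ε * |s - t| := by
      refine le_trans ?_ key
      simpa using Complex.abs_re_le_norm (ζ - (s - t : ℝ))
    have h3 : |s - t| ≤ |ζ.re| + |ζ.re - (s - t)| := by
      have := abs_sub_abs_le_abs_sub (s - t) ζ.re
      rw [abs_sub_comm (s - t)] at this
      linarith
    have h4 : |s - t| = 0 := by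
      have := abs_nonneg (s - t)
      nlinarith [mul_le_mul_of_nonneg_left him (by linarith : (0 : ℝ) ≤ K)]
    have h5 : s - t = 0 := abs_eq_zero.1 h4
    rw [h4, mul_zero, h5] at key
    simp at key
    exact hζ key

/-- Every point near the arc is reached from the arc along the fixed direction normal to `vel γ t₀`.
Existence is all that is needed, so the intermediate value theorem replaces the inverse function
theorem. -/
theorem exists_normal_coordinates (h : IsFreeArc F γ) (ht₀ : t₀ ∈ Ioo (0 : ℝ) 1) {δ η : ℝ}
    (hδ : 0 < δ) (hη : 0 < η) :
    ∀ᶠ z in 𝓝 (γ t₀), ∃ t y : ℝ, |t - t₀| < δ ∧ |y| < η ∧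
      z = γ t + y * Complex.I * vel γ t₀ := by
  have ht₀' := Ioo_subset_Icc_self ht₀
  set T := vel γ t₀ with hT
  have hT0 : T ≠ 0 := h.arc.vel_ne_zero ht₀'
  have hTn : 0 < ‖T‖ := norm_pos_iff.2 hT0
  obtain ⟨δ₁, hδ₁, H⟩ := h.arc.exists_approx (mul_pos (show (0 : ℝ) < 1 / 4 by norm_num) hTn)
  obtain ⟨δ₂, hδ₂, hball⟩ := Metric.isOpen_iff.1 isOpen_Ioo t₀ ht₀
  set d := min (min δ (η / 4)) (min δ₁ δ₂) / 2 with hd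
  have hd0 : 0 < d := by positivity
  have hmin : d < min (min δ (η / 4)) (min δ₁ δ₂) := half_lt_self (by positivity)
  have hdδ : d < δ := hmin.trans_le ((min_le_left _ _).trans (min_le_left _ _))
  have hdη : d < η / 4 := hmin.trans_le ((min_le_left _ _).trans (min_le_right _ _))
  have hd1 : d < δ₁ := hmin.trans_le ((min_le_right _ _).trans (min_le_left _ _))
  have hd2 : d < δ₂ := hmin.trans_le ((min_le_right _ _).trans (min_le_right _ _))
  have hmemI : ∀ t, |t - t₀| ≤ d → t ∈ Ioo (0 : ℝ) 1 := fun t ht =>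
    hball (by simpa [Real.dist_eq] using ht.trans_lt hd2)
  have happ : ∀ t, |t - t₀| ≤ d → ‖(γ t - γ t₀) / T - (t - t₀ : ℝ)‖ ≤ 1 / 4 * |t - t₀| := by
    intro t ht
    have := (H t₀ ht₀' t₀ ht₀' t (Ioo_subset_Icc_self (hmemI t ht)) (by simpa using hδ₁)
      (ht.trans_lt hd1)).1
    have e : (γ t - γ t₀) / T - (t - t₀ : ℝ) = (γ t - γ t₀ - (t - t₀ : ℝ) * T) / T := by
      field_simp
    rw [e, norm_div, div_le_iff₀ hTn]
    linarith
  have hnear : ∀ᶠ z in 𝓝 (γ t₀), ‖(z - γ t₀) / T‖ < d / 2 := by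
    have hc : ContinuousAt (fun z => ‖(z - γ t₀) / T‖) (γ t₀) := by fun_prop
    exact hc.eventually_lt continuousAt_const (by simpa using half_pos hd0)
  filter_upwards [hnear] with z hz
  have hq : ContinuousOn (fun t => ((z - γ t) / T).re) (Icc (t₀ - d) (t₀ + d)) := by
    have : ContinuousOn γ (Icc (t₀ - d) (t₀ + d)) := fun t ht =>
      (h.arc.hasDerivAt (hmemI t (abs_le.2 ⟨by linarith [ht.1], by linarith [ht.2]⟩))
        ).continuousAt.continuousWithinAt
    fun_prop
  have hdec : ∀ t, (z - γ t) / T = (z - γ t₀) / T - (γ t - γ t₀) / T := by intro t; ring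
  have hz1 : |((z - γ t₀) / T).re| < d / 2 := (Complex.abs_re_le_norm _).trans_lt hz
  have hqs : ∀ t, |t - t₀| = d →
      |((γ t - γ t₀) / T).re - (t - t₀)| ≤ 1 / 4 * d := by
    intro t ht
    have h1 := Complex.abs_re_le_norm ((γ t - γ t₀) / T - (t - t₀ : ℝ))
    have h2 := happ t ht.le
    rw [ht] at h2
    simpa using h1.trans h2
  -- The tangential coordinate of `z - γ t` has opposite signs at `t₀ - d` and `t₀ + d`; at a zero
  -- in between, `z - γ t` is purely normal.
  have hl : 0 ≤ ((z - γ (t₀ - d)) / T).re := by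
    have := hqs (t₀ - d) (by simp [abs_of_pos hd0])
    rw [hdec, Complex.sub_re]
    rw [abs_le] at this
    rw [abs_lt] at hz1
    linarith [this.2]
  have hr : ((z - γ (t₀ + d)) / T).re ≤ 0 := by
    have := hqs (t₀ + d) (by simp [abs_of_pos hd0])
    rw [hdec, Complex.sub_re]
    rw [abs_le] at this
    rw [abs_lt] at hz1
    linarith [this.1]
  obtain ⟨t, ht, hqt⟩ := intermediate_value_Icc' (by linarith) hq ⟨hr, hl⟩
  have htd : |t - t₀| ≤ d := abs_le.2 ⟨by linarith [ht.1], by linarith [ht.2]⟩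
  refine ⟨t, ((z - γ t) / T).im, htd.trans_lt hdδ, ?_, ?_⟩
  · refine (Complex.abs_im_le_norm _).trans_lt ?_
    rw [hdec]
    have h2 : ‖(γ t - γ t₀) / T‖ ≤ 2 * d := by
      have h3 := happ t htd
      have h4 : ‖(γ t - γ t₀) / T‖ ≤
          ‖(γ t - γ t₀) / T - (t - t₀ : ℝ)‖ + ‖((t - t₀ : ℝ) : ℂ)‖ := by
        simpa using norm_add_le ((γ t - γ t₀) / T - (t - t₀ : ℝ)) ((t - t₀ : ℝ) : ℂ)
      rw [Complex.norm_real, Real.norm_eq_abs] at h4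
      linarith
    calc _ ≤ ‖(z - γ t₀) / T‖ + ‖(γ t - γ t₀) / T‖ := norm_sub_le _ _
      _ < η := by linarith
  · have h1 : (z - γ t) / T = ((z - γ t) / T).im * Complex.I := by
      apply Complex.ext <;> simp
      exact hqt
    rw [← h1]
    field_simp
    ring

/-- Near an inner point of a free boundary arc, the cones on one side of the arc are all inside or
all outside `Ω`. -/
theorem exists_side (h : IsFreeArc (frontier Ω) γ) (hΩ : IsOpen Ω) (ht₀ : t₀ ∈ Ioo (0 : ℝ) 1)
    {K e : ℝ} (hK : 1 ≤ K) (he : e = 1 ∨ e = -1) :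
    ∃ δ > 0, ∃ η > 0, ∃ b : Prop, ∀ t, |t - t₀| < δ →
      t ∈ Ioo (0 : ℝ) 1 ∧ ‖vel γ t / vel γ t₀ - 1‖ < 1 / 4 ∧
      (∀ ζ : ℂ, ‖ζ‖ < η → |ζ.re| < K * (e * ζ.im) → (γ t + ζ * vel γ t₀ ∈ Ω ↔ b)) ∧
      ∀ (c : ℝ → ℂ) (d : ℂ), HasDerivWithinAt c d (Ioi 0) 0 → c 0 = γ t →
        |(d / vel γ t₀).re| < K * (e * (d / vel γ t₀).im) →
        ∀ᶠ x in 𝓝[>] (0 : ℝ), (c x ∈ Ω ↔ b) := by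
  obtain ⟨δ, hδ, η, hη, H⟩ := h.exists_cone_notMem ht₀ hK
  set T := vel γ t₀ with hT
  have hT0 : T ≠ 0 := h.arc.vel_ne_zero (Ioo_subset_Icc_self ht₀)
  set C : Set ℂ := {ζ | |ζ.re| < K * (e * ζ.im)} ∩ Metric.ball 0 η with hC
  have hCconv : Convex ℝ C := by
    refine Convex.inter ?_ (convex_ball _ _)
    have e1 : {ζ : ℂ | |ζ.re| < K * (e * ζ.im)} =
        {ζ | (Complex.reLm - (K * e) • Complex.imLm) ζ < 0} ∩
        {ζ | (-Complex.reLm - (K * e) • Complex.imLm) ζ < 0} := by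
      ext ζ
      simp only [mem_ofPred_eq, abs_lt, mem_inter_iff, LinearMap.sub_apply, LinearMap.smul_apply,
        LinearMap.neg_apply, Complex.reLm_coe, Complex.imLm_coe, smul_eq_mul]
      constructor
      · rintro ⟨h1, h2⟩; constructor <;> linarith
      · rintro ⟨h1, h2⟩; constructor <;> linarith
    rw [e1]
    exact (convex_halfSpace_lt (LinearMap.isLinear _) 0).inter
      (convex_halfSpace_lt (LinearMap.isLinear _) 0)
  have hCim : ∀ ζ ∈ C, ζ ≠ 0 ∧ ‖ζ‖ < η ∧ |ζ.re| ≤ K * |ζ.im| := by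
    rintro ζ ⟨h1, h2⟩
    have h1' : |ζ.re| < K * (e * ζ.im) := h1
    refine ⟨?_, by simpa using h2, ?_⟩
    · rintro rfl
      simp at h1'
    · refine h1'.le.trans (mul_le_mul_of_nonneg_left ?_ (by linarith))
      rcases he with rfl | rfl
      · rw [one_mul]; exact le_abs_self _
      · rw [neg_one_mul]; exact neg_le_abs _
  -- The truncated cones over all nearby points of the arc together form one connected set that
  -- avoids the frontier. Therefore a single proposition `b` serves for all `t`.
  set R : Set ℂ := (fun q : ℝ × ℂ => γ q.1 + q.2 * T) '' (Ioo (t₀ - δ) (t₀ + δ) ×ˢ C) with hR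
  have hIoo : ∀ {t}, t ∈ Ioo (t₀ - δ) (t₀ + δ) ↔ |t - t₀| < δ := by
    intro t
    rw [abs_lt]
    constructor
    · rintro ⟨h1, h2⟩; constructor <;> linarith
    · rintro ⟨h1, h2⟩; constructor <;> linarith
  have hRpre : IsPreconnected R := by
    refine IsPreconnected.image (isPreconnected_Ioo.prod hCconv.isPreconnected) _ ?_
    have h1 : ContinuousOn γ (Ioo (t₀ - δ) (t₀ + δ)) := fun t ht =>
      (h.arc.hasDerivAt (H t (hIoo.1 ht)).1).continuousAt.continuousWithinAt
    have h2 : ContinuousOn (fun q : ℝ × ℂ => γ q.1) (Ioo (t₀ - δ) (t₀ + δ) ×ˢ C) :=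
      h1.comp continuousOn_fst fun q hq => hq.1
    exact h2.add (by fun_prop)
  have hRd : ∀ z ∈ R, z ∉ frontier Ω := by
    rintro z ⟨⟨t, ζ⟩, ⟨ht, hζ⟩, rfl⟩
    obtain ⟨h1, h2, h3⟩ := hCim ζ hζ
    exact (H t (hIoo.1 ht)).2.2 ζ h1 h2 h3
  have hdich : ∃ b : Prop, ∀ z ∈ R, (z ∈ Ω ↔ b) := by
    rcases subset_or_disjoint_of_preconnected hRpre hΩ hRd with h1 | h1
    · exact ⟨True, fun z hz => ⟨fun _ => trivial, fun _ => h1 hz⟩⟩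
    · exact ⟨False, fun z hz => ⟨fun h2 => h1 z hz h2, False.elim⟩⟩
  obtain ⟨b, hb⟩ := hdich
  refine ⟨δ, hδ, η, hη, b, fun t ht => ⟨(H t ht).1, (H t ht).2.1, fun ζ h1 h2 =>
    hb _ ⟨(t, ζ), ⟨hIoo.2 ht, h2, by simpa using h1⟩, rfl⟩, fun c d hc hc0 hcone => ?_⟩⟩
  have hq : Tendsto (fun x : ℝ => (c x - γ t) / T) (𝓝[>] 0) (𝓝 0) := by
    have h1 : Tendsto c (𝓝[>] 0) (𝓝 (c 0)) := hc.continuousWithinAt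
    have h2 := (h1.sub_const (γ t)).div_const T
    simpa [hc0] using h2
  have hslope : Tendsto (fun x : ℝ => (x⁻¹ : ℝ) * ((c x - γ t) / T)) (𝓝[>] 0) (𝓝 (d / T)) := by
    have h1 := (hasDerivWithinAt_iff_tendsto_slope' (by simp)).1 hc
    have h2 := h1.div_const T
    refine h2.congr fun x => ?_
    simp only [slope, sub_zero, vsub_eq_sub, hc0, Complex.real_smul]
    ring
  have hopen : IsOpen {ζ : ℂ | |ζ.re| < K * (e * ζ.im)} :=
    isOpen_lt (by fun_prop) (by fun_prop)
  filter_upwards [hslope.eventually (hopen.mem_nhds hcone),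
    hq.eventually (Metric.ball_mem_nhds 0 hη), self_mem_nhdsWithin] with x hx1 hx2 hx3
  have hx3' : 0 < x := hx3
  -- The cone inequality is invariant under positive scaling, so it passes from the difference
  -- quotient to the increment itself.
  refine hb _ ⟨(t, (c x - γ t) / T), ⟨hIoo.2 ht, ?_, hx2⟩, ?_⟩
  · have hx1' : |((x⁻¹ : ℝ) * ((c x - γ t) / T)).re| < K * (e * ((x⁻¹ : ℝ) * ((c x - γ t) / T)).im) :=
      hx1
    rw [Complex.re_ofReal_mul, Complex.im_ofReal_mul, abs_mul, abs_of_pos (inv_pos.2 hx3')] at hx1'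
    have : x⁻¹ * |((c x - γ t) / T).re| < x⁻¹ * (K * (e * ((c x - γ t) / T).im)) := by linarith
    exact lt_of_mul_lt_mul_left this (inv_pos.2 hx3').le
  · simp only
    field_simp
    ring

theorem hasDerivWithinAt_normal (γ : ℝ → ℂ) (e t : ℝ) :
    HasDerivWithinAt (fun h : ℝ => γ t + (e * h : ℝ) * (Complex.I * vel γ t))
      (e * (Complex.I * vel γ t)) (Ioi 0) 0 := by
  have h1 : HasDerivAt (fun h : ℝ => ((e * h : ℝ) : ℂ)) ((e * 1 : ℝ) : ℂ) 0 :=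
    ((hasDerivAt_id (0 : ℝ)).const_mul e).ofReal_comp
  have := (h1.mul_const (Complex.I * vel γ t)).const_add (γ t)
  simpa using this.hasDerivWithinAt

/-- The cones are built on the normal at `t₀`, whereas `OnSide` at `t` uses the normal at `t`. The
velocities differ by less than a quarter in relative terms, so the normal at `t` stays in the cone,
even for `K = 1`. -/
theorem exists_onSide (h : IsFreeArc (frontier Ω) γ) (hΩ : IsOpen Ω) (ht₀ : t₀ ∈ Ioo (0 : ℝ) 1)
    {K e : ℝ} (hK : 1 ≤ K) (he : e = 1 ∨ e = -1) :
    ∃ δ > 0, ∃ η > 0, ∃ b : Prop, ∀ t, |t - t₀| < δ → (OnSide Ω γ e t ↔ b) ∧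
      (∀ ζ : ℂ, ‖ζ‖ < η → |ζ.re| < K * (e * ζ.im) → (γ t + ζ * vel γ t₀ ∈ Ω ↔ b)) ∧
      ∀ (c : ℝ → ℂ) (d : ℂ), HasDerivWithinAt c d (Ioi 0) 0 → c 0 = γ t →
        |(d / vel γ t₀).re| < K * (e * (d / vel γ t₀).im) →
        ∀ᶠ x in 𝓝[>] (0 : ℝ), (c x ∈ Ω ↔ b) := by
  obtain ⟨δ, hδ, η, hη, b, H⟩ := h.exists_side hΩ ht₀ hK he
  refine ⟨δ, hδ, η, hη, b, fun t ht => ⟨?_, (H t ht).2.2⟩⟩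
  obtain ⟨-, hv, -, hc⟩ := H t ht
  have := hc _ _ (hasDerivWithinAt_normal γ e t) (by simp) ?_
  · constructor
    · intro hs
      obtain ⟨x, hx1, hx2⟩ := (hs.and this).exists
      exact hx2.1 hx1
    · intro hb
      exact this.mono fun x hx => hx.2 hb
  · set w := vel γ t / vel γ t₀ - 1 with hw
    have e1 : (e * (Complex.I * vel γ t)) / vel γ t₀ = e * (Complex.I * (1 + w)) := by
      rw [hw]; ring
    have h1 := (Complex.abs_re_le_norm w).trans_lt hv
    have h2 := (Complex.abs_im_le_norm w).trans_lt hv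
    rw [abs_lt] at h1 h2
    rw [e1, Complex.re_ofReal_mul, Complex.im_ofReal_mul]
    simp only [Complex.mul_re, Complex.mul_im, Complex.I_re, Complex.I_im, Complex.add_re,
      Complex.add_im, Complex.one_re, Complex.one_im]
    rcases he with rfl | rfl <;> rw [abs_lt] <;> constructor <;> nlinarith

/-- Any curve leaving the arc transversally stays for a short time in a sufficiently wide cone
around the normal; `K` is chosen from the slope of `d`. -/
theorem onSide_iff_of_transversal (h : IsFreeArc (frontier Ω) γ) (hΩ : IsOpen Ω)
    (ht₀ : t₀ ∈ Ioo (0 : ℝ) 1) {e : ℝ} (he : e = 1 ∨ e = -1) {c : ℝ → ℂ} {d : ℂ}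
    (hc : HasDerivWithinAt c d (Ioi 0) 0) (hc0 : c 0 = γ t₀) (hd : 0 < e * (d / vel γ t₀).im) :
    ∀ᶠ x in 𝓝[>] (0 : ℝ), (c x ∈ Ω ↔ OnSide Ω γ e t₀) := by
  set a := e * (d / vel γ t₀).im with ha
  obtain ⟨δ, hδ, η, hη, b, H⟩ := h.exists_onSide hΩ ht₀ (K := |(d / vel γ t₀).re| / a + 1)
    (by have : 0 ≤ |(d / vel γ t₀).re| / a := by positivity
        linarith) he
  obtain ⟨h1, -, h2⟩ := H t₀ (by simpa using hδ)
  have h3 : (|(d / vel γ t₀).re| / a + 1) * a = |(d / vel γ t₀).re| + a := by field_simp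
  have := h2 c d hc hc0 (by rw [← ha, h3]; linarith)
  filter_upwards [this] with x hx
  rw [hx, h1]

/-- By `exists_onSide` the property is locally constant in the parameter, and the open interval is
connected. -/
theorem onSide_imp (h : IsFreeArc (frontier Ω) γ) (hΩ : IsOpen Ω) {e : ℝ} (he : e = 1 ∨ e = -1)
    {s t : ℝ} (hs : s ∈ Ioo (0 : ℝ) 1) (ht : t ∈ Ioo (0 : ℝ) 1) (hside : OnSide Ω γ e s) :
    OnSide Ω γ e t := by
  have hloc : ∀ u ∈ Ioo (0 : ℝ) 1, ∀ᶠ v in 𝓝 u, (OnSide Ω γ e v ↔ OnSide Ω γ e u) := by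
    intro u hu
    obtain ⟨δ, hδ, η, hη, b, H⟩ := h.exists_onSide hΩ hu le_rfl he
    filter_upwards [Metric.ball_mem_nhds u hδ] with v hv
    have h1 := (H v (by simpa [Real.dist_eq] using hv)).1
    have h2 := (H u (by simpa using hδ)).1
    exact h1.trans h2.symm
  have hopen : ∀ q : Prop, IsOpen {u | u ∈ Ioo (0 : ℝ) 1 ∧ (OnSide Ω γ e u ↔ q)} := by
    intro q
    rw [isOpen_iff_mem_nhds]
    rintro u ⟨hu, hq⟩
    filter_upwards [hloc u hu, isOpen_Ioo.mem_nhds hu] with v hv hv2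
    exact ⟨hv2, hv.trans hq⟩
  have := (isPreconnected_Ioo (a := (0 : ℝ)) (b := 1)).subset_left_of_subset_union
    (hopen True) (hopen False) ?_ ?_ ⟨s, hs, hs, by simpa using hside⟩ ht
  · simpa using this.2
  · rw [Set.disjoint_left]
    rintro u ⟨-, h1⟩ ⟨-, h2⟩
    exact h2.1 (h1.2 trivial)
  · intro u hu
    by_cases hq : OnSide Ω γ e u
    · exact Or.inl ⟨hu, by simpa using hq⟩
    · exact Or.inr ⟨hu, by simpa using hq⟩

theorem onSide_iff (h : IsFreeArc (frontier Ω) γ) (hΩ : IsOpen Ω) {e : ℝ} (he : e = 1 ∨ e = -1)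
    {s t : ℝ} (hs : s ∈ Ioo (0 : ℝ) 1) (ht : t ∈ Ioo (0 : ℝ) 1) :
    OnSide Ω γ e s ↔ OnSide Ω γ e t :=
  ⟨h.onSide_imp hΩ he hs ht, h.onSide_imp hΩ he ht hs⟩

/-- Otherwise, by normal coordinates, a whole neighbourhood of `γ t₀` would miss `Ω`, although `γ
t₀` lies in its closure. -/
theorem onSide_or (h : IsFreeArc (frontier Ω) γ) (hΩ : IsOpen Ω) (ht₀ : t₀ ∈ Ioo (0 : ℝ) 1) :
    OnSide Ω γ 1 t₀ ∨ OnSide Ω γ (-1) t₀ := by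
  by_contra hcon
  push Not at hcon
  obtain ⟨δ₁, hδ₁, η₁, hη₁, b₁, H₁⟩ := h.exists_onSide hΩ ht₀ le_rfl (Or.inl rfl)
  obtain ⟨δ₂, hδ₂, η₂, hη₂, b₂, H₂⟩ := h.exists_onSide hΩ ht₀ le_rfl (Or.inr rfl)
  have hb₁ : ¬b₁ := fun hb => hcon.1 ((H₁ t₀ (by simpa using hδ₁)).1.2 hb)
  have hb₂ : ¬b₂ := fun hb => hcon.2 ((H₂ t₀ (by simpa using hδ₂)).1.2 hb)
  have hev := h.exists_normal_coordinates ht₀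
    (lt_min (lt_min hδ₁ hδ₂) (lt_min ht₀.1 (sub_pos.2 ht₀.2))) (lt_min hη₁ hη₂)
  have hfr := h.mem t₀ (Ioo_subset_Icc_self ht₀)
  have hcl : γ t₀ ∈ closure Ω := hfr.1
  obtain ⟨z, hz, t, y, ht, hy, rfl⟩ :=
    ((mem_closure_iff_frequently.1 hcl).and_eventually hev).exists
  rw [lt_min_iff, lt_min_iff, lt_min_iff] at ht
  rw [lt_min_iff] at hy
  obtain ⟨⟨ht1, ht2⟩, ht3, ht4⟩ := ht
  rcases lt_trichotomy y 0 with hy0 | hy0 | hy0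
  · exact hb₂ (((H₂ t ht2).2.1 (y * Complex.I) (by simpa using hy.2) (by simpa using hy0)).1 hz)
  · subst hy0
    have : γ t ∈ frontier Ω := h.mem t (by
      rw [abs_lt] at ht3 ht4
      constructor <;> linarith [ht3.1, ht4.2])
    rw [hΩ.frontier_eq] at this
    simp at hz
    exact this.2 hz
  · exact hb₁ (((H₁ t ht1).2.1 (y * Complex.I) (by simpa using hy.1) (by simpa using hy0)).1 hz)

end IsFreeArc

/-! ### Balance of multiplicities at a vertex -/

/-- The total jump of a function with finitely many jumps and locally constant elsewhere. -/
theorem sub_eq_sum_jumps {f l r : ℝ → ℝ} {a b : ℝ} (hab : a < b) {S : Finset ℝ}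
    (hS : ∀ s ∈ S, a < s ∧ s < b)
    (hloc : ∀ x ∈ Icc a b, x ∉ S → ∀ᶠ y in 𝓝 x, f y = f x)
    (hr : ∀ s ∈ S, ∀ᶠ y in 𝓝[>] s, f y = r s) (hl : ∀ s ∈ S, ∀ᶠ y in 𝓝[<] s, f y = l s) :
    f b - f a = ∑ s ∈ S, (r s - l s) := by
  classical
  -- Made left-continuous at the jumps and diminished by the jumps already passed, the function
  -- becomes locally constant on `[a, b]`, hence constant.
  set G : ℝ → ℝ := fun y => (if y ∈ S then l y else f y) - ∑ s ∈ S, if s < y then r s - l s else 0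
    with hG
  have hne : ∀ x : ℝ, ∀ᶠ y in 𝓝 x, ∀ s ∈ S, s ≠ x → (y ≠ s ∧ (s < y ↔ s < x)) := by
    intro x
    rw [Filter.eventually_all_finset]
    intro s _
    by_cases hsx : s = x
    · exact Eventually.of_forall fun y h => absurd hsx h
    rcases lt_or_gt_of_ne hsx with h | h
    · filter_upwards [lt_mem_nhds h] with y hy _
      exact ⟨hy.ne', by simp [hy, h]⟩
    · filter_upwards [gt_mem_nhds h] with y hy _
      exact ⟨hy.ne, by simp only [hy.not_gt, h.not_gt]⟩
  have hGloc : ∀ x ∈ Icc a b, ∀ᶠ y in 𝓝 x, G y = G x := by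
    intro x hx
    by_cases hxS : x ∈ S
    · have hright := eventually_nhdsWithin_iff.1 (hr x hxS)
      have hleft := eventually_nhdsWithin_iff.1 (hl x hxS)
      filter_upwards [hright, hleft, hne x] with y h1 h2 h3
      rcases lt_trichotomy y x with hy | rfl | hy
      · have hyS : y ∉ S := fun h => (h3 y h hy.ne).1 rfl
        have e : ∀ s ∈ S, (if s < y then r s - l s else 0) = if s < x then r s - l s else 0 := by
          intro s hs
          by_cases hsx : s = x
          · subst hsx; simp [hy.le]
          · simp only [(h3 s hs hsx).2]
        simp only [hG, if_pos hxS, if_neg hyS, h2 hy, Finset.sum_congr rfl e]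
      · rfl
      · have hyS : y ∉ S := fun h => (h3 y h hy.ne').1 rfl
        have e : ∀ s ∈ S, (if s < y then r s - l s else 0) =
            (if s < x then r s - l s else 0) + if s = x then r s - l s else 0 := by
          intro s hs
          by_cases hsx : s = x
          · subst hsx; simp [hy]
          · simp only [(h3 s hs hsx).2, if_neg hsx, add_zero]
        simp only [hG, if_pos hxS, if_neg hyS, h1 hy, Finset.sum_congr rfl e,
          Finset.sum_add_distrib, Finset.sum_ite_eq' S x]
        ring
    · filter_upwards [hloc x hx hxS, hne x] with y h1 h3
      have hyS : y ∉ S := fun h => by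
        by_cases hyx : y = x
        · exact hxS (hyx ▸ h)
        · exact (h3 y h hyx).1 rfl
      have e : ∀ s ∈ S, (if s < y then r s - l s else 0) = if s < x then r s - l s else 0 := by
        intro s hs
        simp only [(h3 s hs (fun h => hxS (h ▸ hs))).2]
      simp only [hG, if_neg hxS, if_neg hyS, h1, Finset.sum_congr rfl e]
  have hconst : G b = G a := by
    refine constant_of_has_deriv_right_zero (a := a) (b := b) (fun x hx => ?_) (fun x hx => ?_) b
      ⟨hab.le, le_rfl⟩
    · have : G =ᶠ[𝓝 x] fun _ => G x := hGloc x hx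
      exact (continuousAt_const.congr this.symm).continuousWithinAt
    · have : G =ᶠ[𝓝 x] fun _ => G x := hGloc x ⟨hx.1, hx.2.le⟩
      exact ((hasDerivAt_const x (G x)).congr_of_eventuallyEq this).hasDerivWithinAt
  have haS : a ∉ S := fun h => (hS a h).1.false
  have hbS : b ∉ S := fun h => (hS b h).2.false
  have e1 : ∑ s ∈ S, (if s < b then r s - l s else 0) = ∑ s ∈ S, (r s - l s) :=
    Finset.sum_congr rfl fun s hs => if_pos (hS s hs).2
  have e2 : ∑ s ∈ S, (if s < a then r s - l s else 0) = 0 :=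
    Finset.sum_eq_zero fun s hs => if_neg (hS s hs).1.le.not_gt
  simp only [hG, if_neg haS, if_neg hbS, e1, e2] at hconst
  linarith

/-- A regular arc crosses each small circle around its initial point exactly once, outwards. -/
theorem IsRegularArc.exists_radius {γ : ℝ → ℂ} (h : IsRegularArc 1 γ) :
    ∃ R > 0, ∀ ρ > 0, ρ < R → ∃ t ∈ Ioo (0 : ℝ) 1, ‖γ t - γ 0‖ = ρ ∧
      0 < ((γ t - γ 0) / vel γ t).re ∧ ∀ s ∈ Icc (0 : ℝ) 1, ‖γ s - γ 0‖ = ρ → s = t := by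
  have h0 : (0 : ℝ) ∈ Icc (0 : ℝ) 1 := by simp
  set T := vel γ 0 with hT
  have hT0 : T ≠ 0 := h.vel_ne_zero h0
  have hTn : 0 < ‖T‖ := norm_pos_iff.2 hT0
  obtain ⟨δ, hδ, H⟩ := h.exists_approx (mul_pos (show (0 : ℝ) < 1 / 4 by norm_num) hTn)
  set d := min (δ / 2) (1 / 2) with hd
  have hd0 : 0 < d := by positivity
  have hdδ : d < δ := (min_le_left _ _).trans_lt (half_lt_self hδ)
  have hd1 : d < 1 := (min_le_right _ _).trans_lt (by norm_num)
  have hsub : Icc 0 d ⊆ Icc (0 : ℝ) 1 := Icc_subset_Icc le_rfl hd1.le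
  have hpos : ∀ t ∈ Ioc 0 d, 0 < ((γ t - γ 0) / vel γ t).re := by
    intro t ht
    have htI := hsub ⟨ht.1.le, ht.2⟩
    obtain ⟨h1, h2⟩ := H 0 h0 0 h0 t htI (by simpa using hδ)
      (by rw [sub_zero, abs_of_pos ht.1]; exact ht.2.trans_lt hdδ)
    have hv0 := h.vel_ne_zero htI
    have hvn : 0 < ‖vel γ t‖ := norm_pos_iff.2 hv0
    rw [sub_zero, abs_of_pos ht.1] at h1
    have hvT : 3 / 4 * ‖T‖ ≤ ‖vel γ t‖ := by
      have := norm_sub_norm_le T (vel γ t)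
      rw [norm_sub_rev] at this
      linarith
    have key : ‖(γ t - γ 0) / vel γ t - t‖ < t := by
      have e : (γ t - γ 0) / vel γ t - t =
          (γ t - γ 0 - t * T - t * (vel γ t - T)) / vel γ t := by
        field_simp; ring
      rw [e, norm_div, div_lt_iff₀ hvn]
      calc ‖γ t - γ 0 - t * T - t * (vel γ t - T)‖
          ≤ ‖γ t - γ 0 - t * T‖ + ‖t * (vel γ t - T)‖ := norm_sub_le _ _
        _ ≤ 1 / 4 * ‖T‖ * t + t * (1 / 4 * ‖T‖) := by
            gcongr
            rw [norm_mul, Complex.norm_real, Real.norm_eq_abs, abs_of_pos ht.1]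
            exact mul_le_mul_of_nonneg_left h2.le ht.1.le
        _ < t * ‖vel γ t‖ := by nlinarith [mul_pos ht.1 hTn, mul_le_mul_of_nonneg_left hvT ht.1.le]
    have h3 := Complex.abs_re_le_norm ((γ t - γ 0) / vel γ t - t)
    have h4 := (abs_le.1 (h3.trans key.le))
    have h5 := (abs_lt.1 (h3.trans_lt key)).1
    simp at h5
    exact h5
  have hcont : ContinuousOn (fun t => ‖γ t - γ 0‖) (Icc 0 1) := by
    have := h.continuousOn
    fun_prop
  -- The derivative of the squared distance is twice the inner product of `γ t - γ 0` and the
  -- velocity, which has the sign of the real part in `hpos`.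
  have hmono : StrictMonoOn (fun t => ‖γ t - γ 0‖ ^ 2) (Icc 0 d) := by
    refine strictMonoOn_of_deriv_pos (convex_Icc _ _) ((hcont.mono hsub).pow 2) fun t ht => ?_
    rw [interior_Icc] at ht
    have hder := ((h.hasDerivAt ⟨ht.1, ht.2.trans hd1⟩).sub_const (γ 0)).norm_sq
    rw [hder.deriv]
    have hp := hpos t ⟨ht.1, ht.2.le⟩
    have hv0 := h.vel_ne_zero (hsub ⟨ht.1.le, ht.2.le⟩)
    rw [Complex.div_re] at hp
    rw [Complex.inner]
    have : 0 < Complex.normSq (vel γ t) := Complex.normSq_pos.2 hv0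
    rw [← add_div] at hp
    have hp' := (div_pos_iff_of_pos_right this).1 hp
    simp only [Complex.mul_re, Complex.conj_re, Complex.conj_im]
    linarith
  have hmono' : StrictMonoOn (fun t => ‖γ t - γ 0‖) (Icc 0 d) := by
    intro s hs t ht hst
    exact lt_of_pow_lt_pow_left₀ 2 (norm_nonneg _) (hmono hs ht hst)
  -- Beyond `d` the distance to `γ 0` is bounded below, by injectivity and compactness; circles
  -- smaller than this bound meet the arc only in its monotone part.
  obtain ⟨u, hu, hmin⟩ := (isCompact_Icc (a := d) (b := 1)).exists_isMinOn ⟨d, le_rfl, hd1.le⟩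
    (hcont.mono (Icc_subset_Icc hd0.le le_rfl))
  have huI : u ∈ Icc (0 : ℝ) 1 := ⟨hd0.le.trans hu.1, hu.2⟩
  refine ⟨‖γ u - γ 0‖, ?_, fun ρ hρ hρR => ?_⟩
  · refine norm_pos_iff.2 (sub_ne_zero.2 fun he => ?_)
    have := h.injOn huI h0 he
    linarith [hu.1]
  · have hlarge : ∀ s ∈ Icc d 1, ρ < ‖γ s - γ 0‖ := fun s hs => hρR.trans_le (hmin hs)
    obtain ⟨t, ht, hte⟩ := intermediate_value_Icc hd0.le (hcont.mono hsub)
      (show ρ ∈ Icc ‖γ 0 - γ 0‖ ‖γ d - γ 0‖ from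
        ⟨by simpa using hρ.le, (hlarge d ⟨le_rfl, hd1.le⟩).le⟩)
    have hte' : ‖γ t - γ 0‖ = ρ := hte
    have ht0 : 0 < t := by
      rcases ht.1.lt_or_eq with h1 | h1
      · exact h1
      · subst h1
        simp at hte'
        linarith
    have htd : t < d := by
      by_contra hcon
      exact absurd hte' (hlarge t ⟨not_lt.1 hcon, ht.2.trans hd1.le⟩).ne'
    refine ⟨t, ⟨ht0, htd.trans hd1⟩, hte', hpos t ⟨ht0, htd.le⟩, fun s hs hse => ?_⟩
    have hsd : s < d := by
      by_contra hcon
      exact absurd hse (hlarge s ⟨not_lt.1 hcon, hs.2⟩).ne'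
    exact hmono'.injOn ⟨hs.1, hsd.le⟩ ht (hse.trans hte'.symm)

open Classical in
/-- The multiplicity of a boundary arc: `1` if `Ω` is only on its left, `-1` if it is only on its
right, and `0` otherwise. -/
def mult (Ω : Set ℂ) (γ : ℝ → ℂ) : ℝ :=
  (if OnSide Ω γ 1 (1 / 2) then 1 else 0) - if OnSide Ω γ (-1) (1 / 2) then 1 else 0

theorem half_mem_Ioo : (1 / 2 : ℝ) ∈ Ioo (0 : ℝ) 1 := by norm_num

theorem abs_mult_le (Ω : Set ℂ) (γ : ℝ → ℂ) : |mult Ω γ| ≤ 1 := by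
  unfold mult
  split_ifs <;> norm_num

theorem IsFreeArc.reverse {F : Set ℂ} {γ : ℝ → ℂ} (h : IsFreeArc F γ) :
    IsFreeArc F fun t => γ (1 - t) := by
  refine ⟨h.arc.reverse.1, fun t ht => h.mem _ ⟨by linarith [ht.2], by linarith [ht.1]⟩, ?_⟩
  intro t₀ ht₀ δ hδ
  obtain ⟨ρ, hρ, H⟩ := h.isolated (1 - t₀) ⟨by linarith [ht₀.2], by linarith [ht₀.1]⟩ δ hδ
  refine ⟨ρ, hρ, fun z hz hzρ => ?_⟩
  obtain ⟨t, ht, htδ, hte⟩ := H z hz hzρ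
  refine ⟨1 - t, ⟨by linarith [ht.2], by linarith [ht.1]⟩, ?_, by simpa using hte⟩
  rw [abs_sub_comm] at htδ
  convert htδ using 2
  ring

/-- Reversal negates the velocity and so exchanges left and right. The parameter `1 / 2` used in
`mult` is fixed by the reversal. -/
theorem IsFreeArc.mult_reverse {F : Set ℂ} {γ : ℝ → ℂ} (h : IsFreeArc F γ) (Ω : Set ℂ) :
    mult Ω (fun t => γ (1 - t)) = -mult Ω γ := by
  have key : ∀ e : ℝ, OnSide Ω (fun t => γ (1 - t)) e (1 / 2) ↔ OnSide Ω γ (-e) (1 / 2) := by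
    intro e
    have hv := h.arc.reverse.2 (1 / 2) (Ioo_subset_Icc_self half_mem_Ioo)
    unfold OnSide
    rw [hv, show (1 : ℝ) - 1 / 2 = 1 / 2 by norm_num]
    refine eventually_congr (Eventually.of_forall fun x => ?_)
    have e1 : γ (1 / 2) + (e * x : ℝ) * (Complex.I * -vel γ (1 / 2)) =
      γ (1 / 2) + (-e * x : ℝ) * (Complex.I * vel γ (1 / 2)) := by push_cast; ring
    show γ (1 - 1 / 2) + (e * x : ℝ) * (Complex.I * -vel γ (1 / 2)) ∈ Ω ↔ _
    rw [show (1 : ℝ) - 1 / 2 = 1 / 2 by norm_num, e1]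
  have k1 := key 1
  have k2 := key (-1)
  rw [neg_neg] at k2
  unfold mult
  rw [propext k1, propext k2]
  ring

/-- The multiplicities of the boundary arcs that start at a point sum up to zero. -/
theorem sum_mult_eq_zero {κ : Type*} [Fintype κ] {Ω : Set ℂ} (hΩ : IsOpen Ω) {β : κ → ℝ → ℂ}
    {v : ℂ} (hβ : ∀ i, IsFreeArc (frontier Ω) (β i)) (hv : ∀ i, β i 0 = v)
    (hdisj : ∀ i j, i ≠ j → Disjoint (β i '' Ioo 0 1) (β j '' Ioo 0 1)) {ρ₀ : ℝ} (hρ₀ : 0 < ρ₀)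
    (hcover : ∀ z ∈ frontier Ω, ‖z - v‖ < ρ₀ → ∃ i, z ∈ β i '' Icc 0 1) :
    ∑ i, mult Ω (β i) = 0 := by
  classical
  choose R hR hcross using fun i => (hβ i).arc.exists_radius
  obtain ⟨ρ, hρ, hρR, hρ1⟩ : ∃ ρ > 0, (∀ i, ρ < R i) ∧ ρ < ρ₀ := by
    have h1 : ∀ᶠ ρ in 𝓝[>] (0 : ℝ), ∀ i, ρ < R i := eventually_all.2 fun i =>
      mem_nhdsWithin_of_mem_nhds (gt_mem_nhds (hR i))
    have h2 : ∀ᶠ ρ in 𝓝[>] (0 : ℝ), ρ < ρ₀ := mem_nhdsWithin_of_mem_nhds (gt_mem_nhds hρ₀)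
    obtain ⟨ρ, h3, h4, h5⟩ := ((eventually_mem_nhdsWithin (a := (0 : ℝ)) (s := Ioi 0)).and
      (h1.and h2)).exists
    exact ⟨ρ, h3, h4, h5⟩
  choose t ht htρ htre htuniq using fun i => hcross i ρ hρ (hρR i)
  set c : ℝ → ℂ := fun θ => v + ρ * Complex.exp (θ * Complex.I) with hc
  have hcd : ∀ θ : ℝ, HasDerivAt c (Complex.I * (c θ - v)) θ := by
    intro θ
    have h1 : HasDerivAt (fun θ : ℝ => (θ : ℂ) * Complex.I) (1 * Complex.I) θ :=
      (Complex.ofRealCLM.hasDerivAt (x := θ)).mul_const Complex.I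
    have h2 := ((h1.cexp).const_mul (ρ : ℂ)).const_add v
    have e : Complex.I * (c θ - v) = ρ * (Complex.exp (θ * Complex.I) * (1 * Complex.I)) := by
      simp only [hc]
      ring
    rw [e]
    exact h2
  have hcn : ∀ θ, ‖c θ - v‖ = ρ := by
    intro θ
    simp [hc, Complex.norm_exp_ofReal_mul_I, abs_of_pos hρ]
  have hcper : ∀ θ, c (θ + 2 * Real.pi) = c θ := by
    intro θ
    simp only [hc]
    push_cast
    rw [add_mul, Complex.exp_add, Complex.exp_two_pi_mul_I, mul_one]
  have hcinj : ∀ θ θ', c θ = c θ' → ∃ n : ℤ, θ = θ' + n * (2 * Real.pi) := by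
    intro θ θ' h
    have h1 : Complex.exp (θ * Complex.I) = Complex.exp (θ' * Complex.I) := by
      have hρ' : (ρ : ℂ) ≠ 0 := by exact_mod_cast hρ.ne'
      exact mul_left_cancel₀ hρ' (add_left_cancel h)
    obtain ⟨n, hn⟩ := Complex.exp_eq_exp_iff_exists_int.1 h1
    refine ⟨n, ?_⟩
    have h2 : ((θ : ℂ) - (θ' + n * (2 * Real.pi))) * Complex.I = 0 := by linear_combination hn
    have h3 := (mul_eq_zero.1 h2).resolve_right Complex.I_ne_zero
    have h4 : (θ : ℂ) = ((θ' + n * (2 * Real.pi) : ℝ) : ℂ) := by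
      push_cast; linear_combination h3
    exact_mod_cast h4
  have hzn : ∀ i, ‖β i (t i) - v‖ = ρ := fun i => by rw [← hv i]; exact htρ i
  -- The turn must start off the arcs, so that all crossings have angles strictly inside one period.
  obtain ⟨a, ha⟩ : ∃ a : ℝ, ∀ i, c a ≠ β i (t i) := by
    have hinj : InjOn c (Ioo 0 1) := by
      intro x hx y hy hxy
      obtain ⟨n, hn⟩ := hcinj x y hxy
      have hπ := Real.pi_gt_three
      have h1 : |(n : ℝ)| * (2 * Real.pi) < 1 := by
        rw [← abs_of_pos (show (0 : ℝ) < 2 * Real.pi by positivity), ← abs_mul, abs_lt]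
        constructor <;> linarith [hx.1, hx.2, hy.1, hy.2]
      have h2 : n = 0 := by
        by_contra hn0
        have h3 : (1 : ℝ) ≤ |(n : ℝ)| := by exact_mod_cast Int.one_le_abs hn0
        nlinarith
      simpa [h2] using hn
    have hinf : (c '' Ioo 0 1).Infinite := (Ioo_infinite one_pos).image hinj
    obtain ⟨z, ⟨a, -, rfl⟩, hz⟩ := hinf.exists_notMem_finite
      (Set.finite_range fun i => β i (t i))
    exact ⟨a, fun i hi => hz ⟨i, hi.symm⟩⟩
  have hπ2 : (0 : ℝ) < 2 * Real.pi := by positivity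
  have hang : ∀ i, ∃ θ ∈ Ioo a (a + 2 * Real.pi), c θ = β i (t i) := by
    intro i
    have hcarg : c (Complex.arg (β i (t i) - v)) = β i (t i) := by
      have h1 := Complex.norm_mul_exp_arg_mul_I (β i (t i) - v)
      rw [hzn i] at h1
      simp only [hc, h1]
      ring
    obtain ⟨x, hx, hxe⟩ := (show Function.Periodic c (2 * Real.pi) from hcper).exists_mem_Ico hπ2
      (Complex.arg (β i (t i) - v)) a
    rw [hcarg] at hxe
    refine ⟨x, ⟨lt_of_le_of_ne hx.1 ?_, hx.2⟩, hxe.symm⟩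
    rintro rfl
    exact ha i hxe.symm
  choose θ hθ hcθ using hang
  have hθinj : Function.Injective θ := by
    intro i j hij
    by_contra hne
    refine Set.disjoint_left.1 (hdisj i j hne) ⟨t i, ht i, rfl⟩ ⟨t j, ht j, ?_⟩
    rw [← hcθ i, ← hcθ j, hij]
  have hnot : ∀ x ∈ Icc a (a + 2 * Real.pi), x ∉ Finset.univ.image θ → c x ∉ frontier Ω := by
    intro x hx hxθ hfr
    obtain ⟨i, s, hs, hse⟩ := hcover _ hfr (by rw [hcn]; exact hρ1)
    have hst : s = t i := htuniq i s hs (by rw [hv, hse, hcn])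
    subst hst
    obtain ⟨n, hn⟩ := hcinj x (θ i) (by rw [hcθ, hse])
    have hxa : x ≠ a := by
      rintro rfl
      exact ha i hse.symm
    have hxb : x ≠ a + 2 * Real.pi := by
      rintro rfl
      exact ha i (by rw [← hcper, hse])
    have h1 := hθ i
    have hx1 : a < x := lt_of_le_of_ne hx.1 (Ne.symm hxa)
    have hx2 : x < a + 2 * Real.pi := lt_of_le_of_ne hx.2 hxb
    have hn0 : n = 0 := by
      have h2 : (n : ℝ) < 1 := by
        by_contra hcon
        nlinarith [h1.1, h1.2, not_lt.1 hcon]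
      have h3 : (-1 : ℝ) < n := by
        by_contra hcon
        nlinarith [h1.1, h1.2, not_lt.1 hcon]
      have h2' : n < 1 := by exact_mod_cast h2
      have h3' : -1 < n := by exact_mod_cast h3
      omega
    apply hxθ
    rw [Finset.mem_image]
    exact ⟨i, Finset.mem_univ _, by simp [hn, hn0]⟩
  set f : ℝ → ℝ := fun x => if c x ∈ Ω then 1 else 0 with hf
  have hside : ∀ i (e : ℝ), e = 1 ∨ e = -1 → ∀ᶠ x in 𝓝[>] (0 : ℝ),
      (c (θ i + e * x) ∈ Ω ↔ OnSide Ω (β i) e (1 / 2)) := by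
    intro i e he
    have hd : HasDerivAt (fun x : ℝ => θ i + e * x) e 0 := by
      simpa using ((hasDerivAt_id (0 : ℝ)).const_mul e).const_add (θ i)
    have hcomp : HasDerivAt (fun x : ℝ => c (θ i + e * x))
        (e • (Complex.I * (c (θ i) - v))) 0 := by
      have := HasDerivAt.scomp (0 : ℝ) (by simpa using hcd (θ i)) hd
      exact this
    -- The circle crosses the outgoing arc transversally: the imaginary part required here is the
    -- positive real part provided by `exists_radius`.
    have := (hβ i).onSide_iff_of_transversal hΩ (ht i) he (hcomp.hasDerivWithinAt (s := Ioi 0))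
      (by simp [hcθ]) ?_
    · filter_upwards [this] with x hx
      rw [hx, (hβ i).onSide_iff hΩ he (ht i) half_mem_Ioo]
    · have hpos := htre i
      rw [hv i] at hpos
      rw [hcθ, Complex.real_smul, mul_div_assoc, mul_div_assoc, Complex.im_ofReal_mul, ← mul_assoc]
      have he2 : e * e = 1 := by rcases he with rfl | rfl <;> norm_num
      rw [he2, one_mul, Complex.I_mul_im]
      exact hpos
  have hex : ∀ i e, (∃ j, θ j = θ i ∧ OnSide Ω (β j) e (1 / 2)) ↔ OnSide Ω (β i) e (1 / 2) := by
    intro i e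
    constructor
    · rintro ⟨j, hj, h⟩
      rwa [← hθinj hj]
    · intro h
      exact ⟨i, rfl, h⟩
  -- Turning counterclockwise, the circle crosses each outgoing arc from right to left. The jump of
  -- the indicator of `Ω` there is the multiplicity, and the total jump over a full turn vanishes.
  have hjump := sub_eq_sum_jumps (f := f) (a := a) (b := a + 2 * Real.pi) (by linarith)
    (S := Finset.univ.image θ)
    (r := fun s => if ∃ i, θ i = s ∧ OnSide Ω (β i) 1 (1 / 2) then 1 else 0)
    (l := fun s => if ∃ i, θ i = s ∧ OnSide Ω (β i) (-1) (1 / 2) then 1 else 0)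
    ?_ ?_ ?_ ?_
  · rw [Finset.sum_image (fun i _ j _ h => hθinj h)] at hjump
    have e1 : f (a + 2 * Real.pi) = f a := by simp only [hf, hcper]
    rw [e1, sub_self] at hjump
    rw [hjump]
    refine Finset.sum_congr rfl fun i _ => ?_
    simp only [mult, hex]
  · intro s hs
    obtain ⟨i, -, rfl⟩ := Finset.mem_image.1 hs
    exact hθ i
  · intro x hx hxS
    have hfr := hnot x hx hxS
    have hcc : ContinuousAt c x := (hcd x).continuousAt
    by_cases hxΩ : c x ∈ Ω
    · filter_upwards [hcc.eventually (hΩ.mem_nhds hxΩ)] with y hy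
      have hy' : c y ∈ Ω := hy
      simp only [hf, if_pos hxΩ, if_pos hy']
    · have hncl : c x ∉ closure Ω := fun hcl => hfr (by
        rw [hΩ.frontier_eq]; exact ⟨hcl, hxΩ⟩)
      filter_upwards [hcc.eventually (isClosed_closure.isOpen_compl.mem_nhds hncl)] with y hy
      have hy' : c y ∉ Ω := fun h => hy (subset_closure h)
      simp only [hf, if_neg hxΩ, if_neg hy']
  · intro s hs
    obtain ⟨i, -, rfl⟩ := Finset.mem_image.1 hs
    have htend : Tendsto (fun y => y - θ i) (𝓝[>] θ i) (𝓝[>] 0) := by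
      refine tendsto_nhdsWithin_iff.2 ⟨?_, ?_⟩
      · refine Tendsto.mono_left ?_ nhdsWithin_le_nhds
        exact Continuous.tendsto' (by fun_prop) _ _ (by simp)
      · filter_upwards [self_mem_nhdsWithin] with y hy using sub_pos.2 (mem_Ioi.1 hy)
    filter_upwards [htend.eventually (hside i 1 (Or.inl rfl))] with y hy
    rw [one_mul, add_sub_cancel] at hy
    simp only [hf, hy, hex]
  · intro s hs
    obtain ⟨i, -, rfl⟩ := Finset.mem_image.1 hs
    have htend : Tendsto (fun y => θ i - y) (𝓝[<] θ i) (𝓝[>] 0) := by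
      refine tendsto_nhdsWithin_iff.2 ⟨?_, ?_⟩
      · refine Tendsto.mono_left ?_ nhdsWithin_le_nhds
        exact Continuous.tendsto' (by fun_prop) _ _ (by simp)
      · filter_upwards [self_mem_nhdsWithin] with y hy using sub_pos.2 (mem_Iio.1 hy)
    filter_upwards [htend.eventually (hside i (-1) (Or.inr rfl))] with y hy
    rw [neg_one_mul, neg_sub, add_sub_cancel] at hy
    simp only [hf, hy, hex]

/-! ### Arc systems and the cycle property of the boundary -/

/-- The union of finitely many regular arcs that meet at most at end points. -/
structure IsArcSystem {ι : Type*} (γ : ι → ℝ → ℂ) (F : Set ℂ) : Prop where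
  arc : ∀ i, IsRegularArc 1 (γ i)
  disjoint : ∀ i j, i ≠ j → Disjoint (γ i '' Ioo 0 1) (γ j '' Icc 0 1)
  eq_iUnion : F = ⋃ i, γ i '' Icc 0 1

namespace IsArcSystem

variable {ι : Type*} {γ : ι → ℝ → ℂ} {F Ω : Set ℂ}

theorem isClosed_image (h : IsArcSystem γ F) (i : ι) : IsClosed (γ i '' Icc 0 1) :=
  (isCompact_Icc.image_of_continuousOn (h.arc i).continuousOn).isClosed

theorem eq_of_mem_Ioo (h : IsArcSystem γ F) {i j : ι} {s t : ℝ} (hs : s ∈ Ioo (0 : ℝ) 1)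
    (ht : t ∈ Icc (0 : ℝ) 1) (hst : γ i s = γ j t) : i = j ∧ s = t := by
  by_cases hij : i = j
  · subst hij
    exact ⟨rfl, (h.arc i).injOn (Ioo_subset_Icc_self hs) ht hst⟩
  · exact absurd ⟨t, ht, hst.symm⟩ (Set.disjoint_left.1 (h.disjoint i j hij) ⟨s, hs, rfl⟩)

theorem isFreeArc [Finite ι] (h : IsArcSystem γ F) (i : ι) : IsFreeArc F (γ i) := by
  refine ⟨h.arc i, fun t ht => by rw [h.eq_iUnion]; exact mem_iUnion.2 ⟨i, t, ht, rfl⟩, ?_⟩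
  intro t₀ ht₀ δ hδ
  set δ' := min δ (min t₀ (1 - t₀)) with hδ'
  have hδ'0 : 0 < δ' := lt_min hδ (lt_min ht₀.1 (sub_pos.2 ht₀.2))
  -- This is the part of `F` to be avoided: the other arcs, and the points of the same arc with
  -- parameters far from `t₀`. It is closed and misses `γ i t₀`.
  set A : Set ℂ := (⋃ j : {j // j ≠ i}, γ j '' Icc 0 1) ∪
    γ i '' (Icc 0 1 ∩ {t | δ' ≤ |t - t₀|}) with hA
  have hAc : IsClosed A := by
    refine (isClosed_iUnion_of_finite fun j : {j // j ≠ i} => h.isClosed_image j).union ?_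
    refine (IsCompact.image_of_continuousOn ?_
      ((h.arc i).continuousOn.mono inter_subset_left)).isClosed
    exact isCompact_Icc.inter_right (isClosed_le (by fun_prop) (by fun_prop))
  have hnot : γ i t₀ ∉ A := by
    rintro (h1 | ⟨t, ⟨ht, ht2⟩, hte⟩)
    · obtain ⟨⟨j, hj⟩, t, ht, hte⟩ := mem_iUnion.1 h1
      exact hj (h.eq_of_mem_Ioo ht₀ ht hte.symm).1.symm
    · have := (h.eq_of_mem_Ioo ht₀ ht hte.symm).2
      subst this
      have ht2' : δ' ≤ |t₀ - t₀| := ht2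
      simp at ht2'
      linarith
  obtain ⟨ρ, hρ, hball⟩ := Metric.isOpen_iff.1 hAc.isOpen_compl _ hnot
  refine ⟨ρ, hρ, fun z hz hzρ => ?_⟩
  have hzA : z ∉ A := hball (by simpa [dist_eq_norm] using hzρ)
  rw [h.eq_iUnion] at hz
  obtain ⟨j, t, ht, rfl⟩ := mem_iUnion.1 hz
  have hji : j = i := by
    by_contra hne
    exact hzA (Or.inl (mem_iUnion.2 ⟨⟨j, hne⟩, t, ht, rfl⟩))
  subst hji
  have hlt : |t - t₀| < δ' := by
    by_contra hcon
    exact hzA (Or.inr ⟨t, ⟨ht, not_lt.1 hcon⟩, rfl⟩)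
  rw [hδ', lt_min_iff, lt_min_iff, abs_lt, abs_lt, abs_lt] at hlt
  refine ⟨t, ⟨by linarith [hlt.2.1.1], by linarith [hlt.2.2.2]⟩, ?_, rfl⟩
  rw [abs_lt]
  exact hlt.1

/-- This is summation by parts: grouped by vertices, the coefficient of `ψ v` is, up to sign, the
sum of the multiplicities of the arcs oriented away from `v`, which is zero. -/
theorem sum_mult_mul_eq_zero {ι : Type*} [Fintype ι] {γ : ι → ℝ → ℂ} {Ω : Set ℂ}
    (h : IsArcSystem γ (frontier Ω)) (hΩ : IsOpen Ω) (ψ : ℂ → ℝ) :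
    ∑ i, mult Ω (γ i) * (ψ (γ i 1) - ψ (γ i 0)) = 0 := by
  classical
  -- Every arc is listed with both orientations, so that all arcs at a vertex can be taken to start
  -- there.
  set β : ι × Bool → ℝ → ℂ := fun e => if e.2 then fun t => γ e.1 (1 - t) else γ e.1 with hβ
  have hfree : ∀ e, IsFreeArc (frontier Ω) (β e) := by
    rintro ⟨i, b⟩
    cases b
    · exact h.isFreeArc i
    · exact (h.isFreeArc i).reverse
  have himg : ∀ e, β e '' Ioo 0 1 ⊆ γ e.1 '' Ioo 0 1 := by
    rintro ⟨i, b⟩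
    cases b
    · exact subset_rfl
    · rintro z ⟨t, ht, rfl⟩
      exact ⟨1 - t, ⟨by linarith [ht.2], by linarith [ht.1]⟩, rfl⟩
  have himg' : ∀ e, γ e.1 '' Icc 0 1 ⊆ β e '' Icc 0 1 := by
    rintro ⟨i, b⟩
    cases b
    · exact subset_rfl
    · rintro z ⟨t, ht, rfl⟩
      exact ⟨1 - t, ⟨by linarith [ht.2], by linarith [ht.1]⟩, by simp [hβ]⟩
  have hβ0 : ∀ e, ∃ t ∈ Icc (0 : ℝ) 1, t ∉ Ioo (0 : ℝ) 1 ∧ γ e.1 t = β e 0 := by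
    rintro ⟨i, b⟩
    cases b
    · exact ⟨0, by simp, by simp, rfl⟩
    · exact ⟨1, by simp, by simp, by simp [hβ]⟩
  have hbal : ∀ v ∈ Finset.univ.image (fun e => β e 0),
      ∑ e with β e 0 = v, mult Ω (β e) = 0 := by
    intro v hv
    obtain ⟨e₀, -, hev⟩ := Finset.mem_image.1 hv
    -- Close to `v` only the arcs through `v` are present, and `v` is an end point of each of them.
    obtain ⟨ρ₀, hρ₀, hball⟩ := Metric.isOpen_iff.1
      (isClosed_iUnion_of_finite fun j : {j // v ∉ γ j '' Icc 0 1} =>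
        h.isClosed_image j).isOpen_compl v (by
          intro hmem
          obtain ⟨⟨j, hj⟩, hj2⟩ := mem_iUnion.1 hmem
          exact hj hj2)
    have := sum_mult_eq_zero (κ := {e // β e 0 = v}) hΩ (β := fun e => β e) (v := v)
      (fun e => hfree e) (fun e => e.2) ?_ hρ₀ ?_
    · refine Eq.trans (Finset.sum_subtype _ (fun e => ?_) _) this
      simp
    · rintro ⟨⟨i, b⟩, hi⟩ ⟨⟨j, b'⟩, hj⟩ hne
      by_cases hij : i = j
      · subst hij
        exfalso
        have h01 : γ i 0 ≠ γ i 1 := fun h0 => by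
          have := (h.arc i).injOn (by simp) (by simp) h0
          norm_num at this
        cases b <;> cases b'
        · exact hne rfl
        · simp only [hβ] at hi hj
          simp at hi hj
          exact h01 (hi.trans hj.symm)
        · simp only [hβ] at hi hj
          simp at hi hj
          exact h01 (hj.trans hi.symm)
        · exact hne rfl
      · exact ((h.disjoint i j hij).mono_right (image_mono Ioo_subset_Icc_self)).mono
          (himg _) (himg _)
    · intro z hz hzv
      have hzn := hball (show z ∈ Metric.ball v ρ₀ by simpa [dist_eq_norm] using hzv)
      rw [h.eq_iUnion] at hz
      obtain ⟨j, hjz⟩ := mem_iUnion.1 hz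
      have hvj : v ∈ γ j '' Icc 0 1 := by
        by_contra hcon
        exact hzn (mem_iUnion.2 ⟨⟨j, hcon⟩, hjz⟩)
      obtain ⟨t, ht, htv⟩ := hvj
      obtain ⟨t₀, ht₀, hnt₀, hgt₀⟩ := hβ0 e₀
      have htn : t ∉ Ioo (0 : ℝ) 1 := fun hto => by
        obtain ⟨-, rfl⟩ := h.eq_of_mem_Ioo hto ht₀ (htv.trans (hev.symm.trans hgt₀.symm))
        exact hnt₀ hto
      have ht01 : t = 0 ∨ t = 1 := by
        by_contra hcon
        push Not at hcon
        exact htn ⟨lt_of_le_of_ne ht.1 (Ne.symm hcon.1), lt_of_le_of_ne ht.2 hcon.2⟩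
      rcases ht01 with rfl | rfl
      · exact ⟨⟨(j, false), htv⟩, himg' (j, false) hjz⟩
      · exact ⟨⟨(j, true), by simpa [hβ] using htv⟩, himg' (j, true) hjz⟩
  have hsum : ∑ e, mult Ω (β e) * ψ (β e 0) = 0 := by
    rw [← Finset.sum_fiberwise_of_maps_to (g := fun e => β e 0)
      (t := Finset.univ.image (fun e => β e 0))
      (fun e _ => Finset.mem_image_of_mem _ (Finset.mem_univ e))]
    refine Finset.sum_eq_zero fun v hv => ?_
    have e1 : ∀ e ∈ Finset.univ.filter (fun e => β e 0 = v),
        mult Ω (β e) * ψ (β e 0) = mult Ω (β e) * ψ v := by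
      intro e he
      rw [(Finset.mem_filter.1 he).2]
    rw [Finset.sum_congr rfl e1, ← Finset.sum_mul, hbal v hv, zero_mul]
  rw [Fintype.sum_prod_type] at hsum
  have e2 : ∀ i, ∑ b, mult Ω (β (i, b)) * ψ (β (i, b) 0) =
      -(mult Ω (γ i) * (ψ (γ i 1) - ψ (γ i 0))) := by
    intro i
    have e3 : mult Ω (β (i, true)) = -mult Ω (γ i) := (h.isFreeArc i).mult_reverse Ω
    have e4 : β (i, true) 0 = γ i 1 := by simp [hβ]
    have e5 : β (i, false) = γ i := rfl
    rw [Fintype.sum_bool, e3, e4, e5]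
    ring
  rw [Finset.sum_congr rfl fun i _ => e2 i, Finset.sum_neg_distrib, neg_eq_zero] at hsum
  exact hsum

end IsArcSystem

/-! ### Length of arcs as an integral of the speed -/

/-- On a set where `γ` is nearly affine it is Lipschitz with constant `‖T‖ + ε`, and this constant
exceeds the speed by at most `2 * ε`. -/
theorem hausdorff_image_le_of_approx {γ : ℝ → ℂ} {B : Set ℝ} (hB : MeasurableSet B) {T : ℂ} {ε : ℝ}
    (hε : 0 ≤ ε) (h1 : ∀ s ∈ B, ∀ t ∈ B, ‖γ t - γ s - (t - s : ℝ) * T‖ ≤ ε * |t - s|)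
    (h2 : ∀ t ∈ B, ‖vel γ t - T‖ ≤ ε) :
    μH[1] (γ '' B) ≤ (∫⁻ t in B, ‖vel γ t‖ₑ) + 2 * ENNReal.ofReal ε * volume B := by
  have hLip : LipschitzOnWith (Real.toNNReal (‖T‖ + ε)) γ B := by
    refine LipschitzOnWith.of_dist_le_mul fun s hs t ht => ?_
    rw [Real.coe_toNNReal _ (by positivity), dist_eq_norm, Real.dist_eq]
    have e : γ s - γ t = (γ s - γ t - (s - t : ℝ) * T) + (s - t : ℝ) * T := by ring
    rw [e]
    refine (norm_add_le _ _).trans ?_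
    rw [norm_mul, Complex.norm_real, Real.norm_eq_abs]
    linarith [h1 t ht s hs]
  have h3 := hLip.hausdorffMeasure_image_le zero_le_one
  rw [ENNReal.rpow_one, hausdorffMeasure_real] at h3
  refine h3.trans ?_
  have h4 : ∀ t ∈ B, ENNReal.ofReal (‖T‖ + ε) ≤ ‖vel γ t‖ₑ + 2 * ENNReal.ofReal ε := by
    intro t ht
    rw [← ofReal_norm, ← ENNReal.ofReal_ofNat, ← ENNReal.ofReal_mul (by norm_num),
      ← ENNReal.ofReal_add (norm_nonneg _) (by positivity)]
    apply ENNReal.ofReal_le_ofReal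
    have := norm_sub_norm_le T (vel γ t)
    rw [norm_sub_rev] at this
    linarith [h2 t ht]
  calc ENNReal.ofReal (‖T‖ + ε) * volume B = ∫⁻ t in B, ENNReal.ofReal (‖T‖ + ε) := by
        rw [setLIntegral_const]
    _ ≤ ∫⁻ t in B, (‖vel γ t‖ₑ + 2 * ENNReal.ofReal ε) := setLIntegral_mono' hB h4
    _ = _ := by rw [lintegral_add_right _ measurable_const, setLIntegral_const]

/-- Where `γ` is nearly affine with `‖T‖ > ε`, the inverse of `γ` is Lipschitz with constant `(‖T‖ -
ε)⁻¹`. If `‖T‖ ≤ ε`, the speed itself is at most `2 * ε`. -/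
theorem le_hausdorff_image_of_approx {γ : ℝ → ℂ} {B : Set ℝ} (hB : MeasurableSet B) {T : ℂ} {ε : ℝ}
    (hinj : InjOn γ B)
    (h1 : ∀ s ∈ B, ∀ t ∈ B, ‖γ t - γ s - (t - s : ℝ) * T‖ ≤ ε * |t - s|)
    (h2 : ∀ t ∈ B, ‖vel γ t - T‖ ≤ ε) :
    ∫⁻ t in B, ‖vel γ t‖ₑ ≤ μH[1] (γ '' B) + 2 * ENNReal.ofReal ε * volume B := by
  have h4 : ∀ t ∈ B, ‖vel γ t‖ₑ ≤ ENNReal.ofReal (‖T‖ - ε) + 2 * ENNReal.ofReal ε := by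
    intro t ht
    have h5 : ‖vel γ t‖ ≤ (‖T‖ - ε) + 2 * ε := by
      have := norm_sub_norm_le (vel γ t) T
      linarith [h2 t ht]
    rw [← ofReal_norm]
    refine (ENNReal.ofReal_le_ofReal h5).trans (ENNReal.ofReal_add_le.trans ?_)
    rw [ENNReal.ofReal_mul (by norm_num), ENNReal.ofReal_ofNat]
  have h5 : ENNReal.ofReal (‖T‖ - ε) * volume B ≤ μH[1] (γ '' B) := by
    rcases le_or_gt (‖T‖ - ε) 0 with hc | hc
    · rw [ENNReal.ofReal_of_nonpos hc, zero_mul]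
      exact zero_le
    · set c := ‖T‖ - ε with hcdef
      have hLip : LipschitzOnWith (Real.toNNReal c⁻¹) (Function.invFunOn γ B) (γ '' B) := by
        refine LipschitzOnWith.of_dist_le_mul ?_
        rintro _ ⟨s, hs, rfl⟩ _ ⟨t, ht, rfl⟩
        rw [hinj.leftInvOn_invFunOn hs, hinj.leftInvOn_invFunOn ht,
          Real.coe_toNNReal _ (by positivity), Real.dist_eq, dist_eq_norm, inv_mul_eq_div,
          le_div_iff₀ hc, hcdef]
        have h6 := norm_sub_norm_le ((s - t : ℝ) * T) (γ s - γ t)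
        rw [norm_sub_rev (_ * T), norm_mul, Complex.norm_real, Real.norm_eq_abs] at h6
        linarith [h1 t ht s hs]
      have h3 := hLip.hausdorffMeasure_image_le zero_le_one
      rw [ENNReal.rpow_one, hausdorffMeasure_real, hinj.invFunOn_image subset_rfl] at h3
      calc ENNReal.ofReal c * volume B
          ≤ ENNReal.ofReal c * (ENNReal.ofReal c⁻¹ * μH[1] (γ '' B)) := by gcongr; exact h3
        _ = μH[1] (γ '' B) := by
            rw [← mul_assoc, ← ENNReal.ofReal_mul hc.le, mul_inv_cancel₀ hc.ne',
              ENNReal.ofReal_one, one_mul]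
  calc ∫⁻ t in B, ‖vel γ t‖ₑ
      ≤ ∫⁻ t in B, (ENNReal.ofReal (‖T‖ - ε) + 2 * ENNReal.ofReal ε) := setLIntegral_mono' hB h4
    _ = ENNReal.ofReal (‖T‖ - ε) * volume B + 2 * ENNReal.ofReal ε * volume B := by
        rw [setLIntegral_const, add_mul]
    _ ≤ _ := by gcongr

/-- The length of a part of a regular arc is the integral of the speed. -/
theorem IsRegularArc.hausdorff_image {γ : ℝ → ℂ} (h : IsRegularArc 1 γ) {A : Set ℝ}
    (hA : MeasurableSet A) (hAI : A ⊆ Icc 0 1) :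
    μH[1] (γ '' A) = ∫⁻ t in A, ‖vel γ t‖ₑ := by
  have key : ∀ ε : ℝ, 0 < ε →
      μH[1] (γ '' A) ≤ (∫⁻ t in A, ‖vel γ t‖ₑ) + 2 * ENNReal.ofReal ε ∧
      ∫⁻ t in A, ‖vel γ t‖ₑ ≤ μH[1] (γ '' A) + 2 * ENNReal.ofReal ε := by
    intro ε hε
    obtain ⟨δ, hδ, H⟩ := h.exists_approx hε
    obtain ⟨N, hN⟩ := exists_nat_gt δ⁻¹
    have hN0 : (0 : ℝ) < N := (inv_pos.2 hδ).trans hN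
    -- The parameters are cut into pieces of length at most `1 / N < δ`; the errors on the pieces
    -- add up to at most `2 * ε`.
    set B : ℕ → Set ℝ := fun j => A ∩ (fun t : ℝ => ⌊t * N⌋₊) ⁻¹' {j} with hB
    have hBm : ∀ j, MeasurableSet (B j) := fun j =>
      hA.inter ((Nat.measurable_floor.comp (measurable_id.mul_const (N : ℝ)))
        (measurableSet_singleton j))
    have hBA : ∀ j, B j ⊆ A := fun j => inter_subset_left
    have hBd : Pairwise (Function.onFun Disjoint B) := by
      intro i j hij
      refine Set.disjoint_left.2 fun t ht ht' => hij ?_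
      exact (mem_singleton_iff.1 ht.2).symm.trans (mem_singleton_iff.1 ht'.2)
    have hBU : A = ⋃ j, B j := by
      ext t
      simp only [hB, mem_iUnion, mem_inter_iff, mem_preimage, mem_singleton_iff]
      exact ⟨fun ht => ⟨_, ht, rfl⟩, fun ⟨_, ht, _⟩ => ht⟩
    have hclose : ∀ j, ∀ s ∈ B j, ∀ t ∈ B j, |t - s| < δ := by
      intro j s hs t ht
      have h1 : ⌊s * N⌋₊ = j := hs.2
      have h2 : ⌊t * N⌋₊ = j := ht.2
      have hs0 : 0 ≤ s * N := mul_nonneg (hAI (hBA j hs)).1 hN0.le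
      have ht0 : 0 ≤ t * N := mul_nonneg (hAI (hBA j ht)).1 hN0.le
      rw [Nat.floor_eq_iff hs0] at h1
      rw [Nat.floor_eq_iff ht0] at h2
      have h3 : |t - s| * N < 1 := by
        rw [← abs_of_pos hN0, ← abs_mul, abs_lt]
        constructor <;> nlinarith
      have h4 : 1 < δ * N := by
        rw [inv_eq_one_div, div_lt_iff₀ hδ] at hN
        linarith
      exact lt_of_mul_lt_mul_right (h3.trans h4) hN0.le
    have hpiece : ∀ j,
        μH[1] (γ '' B j) ≤ (∫⁻ t in B j, ‖vel γ t‖ₑ) + 2 * ENNReal.ofReal ε * volume (B j) ∧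
        ∫⁻ t in B j, ‖vel γ t‖ₑ ≤ μH[1] (γ '' B j) + 2 * ENNReal.ofReal ε * volume (B j) := by
      intro j
      rcases (B j).eq_empty_or_nonempty with he | ⟨u, hu⟩
      · simp [he]
      · have hsub : ∀ s ∈ B j, s ∈ Icc (0 : ℝ) 1 := fun s hs => hAI (hBA j hs)
        have h1 : ∀ s ∈ B j, ∀ t ∈ B j,
            ‖γ t - γ s - (t - s : ℝ) * vel γ u‖ ≤ ε * |t - s| := fun s hs t ht =>
          (H u (hsub u hu) s (hsub s hs) t (hsub t ht) (hclose j u hu s hs)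
            (hclose j u hu t ht)).1
        have h2 : ∀ t ∈ B j, ‖vel γ t - vel γ u‖ ≤ ε := fun t ht =>
          (H u (hsub u hu) t (hsub t ht) t (hsub t ht) (hclose j u hu t ht)
            (hclose j u hu t ht)).2.le
        exact ⟨hausdorff_image_le_of_approx (hBm j) hε.le h1 h2,
          le_hausdorff_image_of_approx (hBm j) (h.injOn.mono hsub) h1 h2⟩
    have hvol : ∑' j, 2 * ENNReal.ofReal ε * volume (B j) ≤ 2 * ENNReal.ofReal ε := by
      rw [ENNReal.tsum_mul_left, ← measure_iUnion hBd hBm, ← hBU]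
      calc 2 * ENNReal.ofReal ε * volume A ≤ 2 * ENNReal.ofReal ε * volume (Icc (0 : ℝ) 1) := by
            gcongr
        _ = _ := by simp
    have hinteg : ∫⁻ t in A, ‖vel γ t‖ₑ = ∑' j, ∫⁻ t in B j, ‖vel γ t‖ₑ := by
      conv_lhs => rw [hBU]
      exact lintegral_iUnion hBm hBd _
    have himg : μH[1] (γ '' A) = ∑' j, μH[1] (γ '' B j) := by
      conv_lhs => rw [hBU, image_iUnion]
      refine measure_iUnion ?_ fun j => ?_
      · intro i j hij
        refine Set.disjoint_left.2 ?_
        rintro _ ⟨s, hs, rfl⟩ ⟨t, ht, hst⟩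
        have := h.injOn (hAI (hBA j ht)) (hAI (hBA i hs)) hst
        subst this
        exact Set.disjoint_left.1 (hBd hij) hs ht
      · exact (hBm j).image_of_continuousOn_injOn
          (h.continuousOn.mono ((hBA j).trans hAI)) (h.injOn.mono ((hBA j).trans hAI))
    rw [hinteg, himg]
    constructor
    · calc ∑' j, μH[1] (γ '' B j) ≤ ∑' j, ((∫⁻ t in B j, ‖vel γ t‖ₑ) +
            2 * ENNReal.ofReal ε * volume (B j)) := ENNReal.tsum_le_tsum fun j => (hpiece j).1
        _ ≤ _ := by rw [ENNReal.tsum_add]; gcongr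
    · calc ∑' j, ∫⁻ t in B j, ‖vel γ t‖ₑ ≤ ∑' j, (μH[1] (γ '' B j) +
            2 * ENNReal.ofReal ε * volume (B j)) := ENNReal.tsum_le_tsum fun j => (hpiece j).2
        _ ≤ _ := by rw [ENNReal.tsum_add]; gcongr
  have hε : ∀ ε : ℝ≥0, 0 < ε → 2 * ENNReal.ofReal (ε / 2 : ℝ) = ε := by
    intro ε _
    rw [← ENNReal.ofReal_ofNat, ← ENNReal.ofReal_mul (by norm_num),
      mul_div_cancel₀ _ (two_ne_zero), ENNReal.ofReal_coe_nnreal]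
  apply le_antisymm
  · refine ENNReal.le_of_forall_pos_le_add fun ε hε0 _ => ?_
    rw [← hε ε hε0]
    exact (key (ε / 2) (by positivity)).1
  · refine ENNReal.le_of_forall_pos_le_add fun ε hε0 _ => ?_
    rw [← hε ε hε0]
    exact (key (ε / 2) (by positivity)).2

theorem measurableSet_inter_preimage {f : ℝ → ℂ} {s : Set ℝ} {Z : Set ℂ} (hf : ContinuousOn f s)
    (hs : MeasurableSet s) (hZ : MeasurableSet Z) : MeasurableSet (s ∩ f ⁻¹' Z) := by
  have h1 : MeasurableSet (s.domRestrict f ⁻¹' Z) :=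
    (continuousOn_iff_continuous_domRestrict.1 hf).measurable hZ
  have h2 := hs.subtype_image h1
  convert h2 using 1
  ext t
  simp [and_comm]

/-- A regular arc meets a set of length zero in a null set of parameters. -/
theorem IsRegularArc.ae_notMem {γ : ℝ → ℂ} (h : IsRegularArc 1 γ) {Z : Set ℂ}
    (hZ : μH[1] Z = 0) : ∀ᵐ t, t ∈ Ioo (0 : ℝ) 1 → γ t ∉ Z := by
  set Z' := toMeasurable μH[1] Z with hZ'
  have hZ'0 : μH[1] Z' = 0 := by rw [hZ', measure_toMeasurable, hZ]
  set A : Set ℝ := Ioo 0 1 ∩ γ ⁻¹' Z' with hA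
  have hAm : MeasurableSet A := by
    have hc : ContinuousOn γ (Ioo 0 1) := h.continuousOn.mono Ioo_subset_Icc_self
    exact measurableSet_inter_preimage hc measurableSet_Ioo (measurableSet_toMeasurable _ _)
  have hAI : A ⊆ Icc 0 1 := inter_subset_left.trans Ioo_subset_Icc_self
  have h0 : ∫⁻ t in A, ‖vel γ t‖ₑ = 0 := by
    rw [← h.hausdorff_image hAm hAI]
    refine measure_mono_null ?_ hZ'0
    rintro _ ⟨t, ht, rfl⟩
    exact ht.2
  have hm : AEMeasurable (fun t => ‖vel γ t‖ₑ) (volume.restrict A) := by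
    have : ContinuousOn (fun t => ‖vel γ t‖ₑ) A := (h.continuousOn_vel.mono hAI).enorm
    exact this.aemeasurable hAm
  have h1 := (lintegral_eq_zero_iff' hm).1 h0
  have h2 := (ae_restrict_iff' hAm).1 h1
  filter_upwards [h2] with t ht htI hmem
  have htA : t ∈ A := ⟨htI, subset_toMeasurable _ _ hmem⟩
  have := ht htA
  simp only [Pi.zero_apply, enorm_eq_zero] at this
  exact h.vel_ne_zero (hAI htA) this

/-! ### Boundary curves and contact of `∂Ω` with `∂M` -/

/-- The curve `p`, of constant speed `σ` on `[0, P)`, covers the boundary of `M`. Away from a finite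
set `B` of corners, `M` lies on the left of its tangents. -/
structure IsBoundaryCurve (M : Set ℂ) (p : ℝ → ℂ) (P σ : ℝ) (B : Set ℂ) : Prop where
  isOpen : IsOpen M
  speed_pos : 0 < σ
  measurable : Measurable p
  cover : frontier M ⊆ p '' Ico 0 P
  null : ∀ N : Set ℝ, volume N = 0 → μH[1] (p '' N) = 0
  finite : B.Finite
  tangent : ∀ s ∈ Ico 0 P, p s ∉ B →
    ∃ τ : ℂ, ‖τ‖ = σ ∧ HasDerivAt p τ s ∧ ∀ z ∈ M, 0 < ((z - p s) / τ).im

theorem hausdorff_finite {S : Set ℂ} (hS : S.Finite) : μH[1] S = 0 := by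
  have := Measure.nullSingletonClass_hausdorff ℂ zero_lt_one
  exact hS.measure_zero _

/-- At a common point of a boundary arc of `Ω ⊆ M` and of `∂M`, away from the corners, the arc is
tangent to `∂M` and `Ω` lies on the inner side only. -/
theorem IsFreeArc.tangent {M Ω B : Set ℂ} {p γ : ℝ → ℂ} {P σ s t : ℝ}
    (hp : IsBoundaryCurve M p P σ B) (h : IsFreeArc (frontier Ω) γ) (hΩ : IsOpen Ω)
    (hΩM : Ω ⊆ M) (hs : s ∈ Ico 0 P) (hsB : p s ∉ B) (ht : t ∈ Ioo (0 : ℝ) 1) (hst : γ t = p s) :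
    ∃ (τ : ℂ) (κ : ℝ), ‖τ‖ = σ ∧ HasDerivAt p τ s ∧ vel γ t = κ * τ ∧ mult Ω γ * κ = |κ| ∧
      (mult Ω γ = 1 ∨ mult Ω γ = -1) ∧
      (∀ z ∈ M, 0 < ((z - p s) / τ).im) ∧
      ∀ᶠ x : ℝ in 𝓝[>] 0, p s + (x : ℂ) * (Complex.I * τ) ∈ Ω := by
  obtain ⟨τ, hτn, hτ, hM⟩ := hp.tangent s hs hsB
  have hτ0 : τ ≠ 0 := by
    rw [← norm_pos_iff, hτn]
    exact hp.speed_pos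
  have hcl : ∀ z ∈ closure M, 0 ≤ ((z - p s) / τ).im := by
    intro z hz
    have hclosed : IsClosed {z : ℂ | 0 ≤ ((z - p s) / τ).im} :=
      isClosed_le continuous_const (by fun_prop)
    exact closure_minimal (fun z hz => (hM z hz).le) hclosed hz
  have hv := h.arc.hasDerivAt ht
  have hder : HasDerivAt (fun x => ((γ x - p s) / τ).im) (vel γ t / τ).im t := by
    have h1 := (hv.sub_const (p s)).div_const τ
    have h2 := Complex.imCLM.hasFDerivAt.comp_hasDerivAt t h1
    exact h2
  -- The arc stays in the closed half plane to the left of the tangent of `∂M` and touches its edge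
  -- at `t`.
  have hmin : IsLocalMin (fun x => ((γ x - p s) / τ).im) t := by
    filter_upwards [isOpen_Ioo.mem_nhds ht] with x hx
    have h1 : γ x ∈ closure M :=
      closure_mono hΩM (frontier_subset_closure (h.mem x (Ioo_subset_Icc_self hx)))
    simpa [hst] using hcl _ h1
  have him : (vel γ t / τ).im = 0 := hmin.hasDerivAt_eq_zero hder
  set κ : ℝ := (vel γ t / τ).re with hκ
  have hκe : vel γ t / τ = κ := Complex.ext (by simp [hκ]) (by simpa using him)
  have hvκ : vel γ t = κ * τ := by
    rw [← hκe]; field_simp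
  have hv0 := h.arc.vel_ne_zero (Ioo_subset_Icc_self ht)
  have hκ0 : κ ≠ 0 := by
    intro h0
    rw [h0, Complex.ofReal_zero, zero_mul] at hvκ
    exact hv0 hvκ
  -- The side with `e * κ < 0` points out of the half plane containing `M`, so `Ω` cannot lie there;
  -- by `onSide_or` it lies on the other side.
  have hout : ∀ e : ℝ, e * κ < 0 → ¬OnSide Ω γ e t := by
    intro e he hside
    obtain ⟨x, hx, hx0⟩ := (hside.and (eventually_mem_nhdsWithin (a := (0 : ℝ)) (s := Ioi 0))).exists
    have h1 := hM _ (hΩM hx)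
    have e1 : (γ t + (e * x : ℝ) * (Complex.I * vel γ t) - p s) / τ =
        (e * κ * x : ℝ) * Complex.I := by
      rw [hst, hvκ]
      push_cast
      field_simp
      ring
    rw [e1, Complex.im_ofReal_mul, Complex.I_im, mul_one] at h1
    have hx0' : 0 < x := hx0
    nlinarith
  have hnormal : ∀ e : ℝ, (e = 1 ∨ e = -1) → 0 < e * κ → OnSide Ω γ e t →
      ∀ᶠ x : ℝ in 𝓝[>] 0, p s + (x : ℂ) * (Complex.I * τ) ∈ Ω := by
    intro e he heκ hside
    have hc : HasDerivWithinAt (fun x : ℝ => p s + x * (Complex.I * τ)) (Complex.I * τ)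
        (Ioi 0) 0 := by
      have h1 := ((Complex.ofRealCLM.hasDerivAt (x := (0 : ℝ))).mul_const
        (Complex.I * τ)).const_add (p s)
      simpa using h1.hasDerivWithinAt
    have := h.onSide_iff_of_transversal hΩ ht he hc (by simp [hst]) ?_
    · filter_upwards [this] with x hx
      exact hx.2 hside
    · have e1 : Complex.I * τ / vel γ t = ((κ⁻¹ : ℝ) : ℂ) * Complex.I := by
        rw [hvκ]
        have : (κ : ℂ) ≠ 0 := by exact_mod_cast hκ0
        push_cast
        field_simp
      rw [e1, Complex.im_ofReal_mul, Complex.I_im, mul_one]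
      have : e * κ⁻¹ = (e * κ) / κ ^ 2 := by field_simp
      rw [this]
      positivity
  have hiff : ∀ e : ℝ, (e = 1 ∨ e = -1) → (OnSide Ω γ e (1 / 2) ↔ OnSide Ω γ e t) := fun e he =>
    h.onSide_iff hΩ he half_mem_Ioo ht
  have hL := hiff 1 (Or.inl rfl)
  have hR := hiff (-1) (Or.inr rfl)
  rcases lt_or_gt_of_ne hκ0 with hneg | hpos
  · have h1 := hout 1 (by linarith)
    have h2 := (h.onSide_or hΩ ht).resolve_left h1
    have hm : mult Ω γ = -1 := by
      unfold mult
      rw [if_neg (mt hL.1 h1), if_pos (hR.2 h2)]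
      norm_num
    exact ⟨τ, κ, hτn, hτ, hvκ, by rw [hm, abs_of_neg hneg]; ring, Or.inr hm, hM,
      hnormal (-1) (Or.inr rfl) (by linarith) h2⟩
  · have h1 := hout (-1) (by linarith)
    have h2 := (h.onSide_or hΩ ht).resolve_right h1
    have hm : mult Ω γ = 1 := by
      unfold mult
      rw [if_pos (hL.2 h2), if_neg (mt hR.1 h1)]
      norm_num
    exact ⟨τ, κ, hτn, hτ, hvκ, by rw [hm, abs_of_pos hpos]; ring, Or.inl hm, hM,
      hnormal 1 (Or.inl rfl) (by linarith) h2⟩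

theorem IsPiecewiseSmooth.exists_arcSystem {F : Set ℂ} (h : IsPiecewiseSmooth 1 F) :
    ∃ (m : ℕ) (γ : Fin m → ℝ → ℂ), IsArcSystem γ F := by
  obtain ⟨m, γ, h1, h2, h3⟩ := h
  exact ⟨m, γ, h1, h2, h3⟩

/-- The end points of the arcs of an arc system. -/
def vertices {ι : Type*} (γ : ι → ℝ → ℂ) : Set ℂ :=
  range (fun i => γ i 0) ∪ range fun i => γ i 1

theorem vertices_finite {ι : Type*} [Finite ι] (γ : ι → ℝ → ℂ) : (vertices γ).Finite :=
  (finite_range _).union (finite_range _)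

theorem IsArcSystem.exists_of_notMem_vertices {ι : Type*} {γ : ι → ℝ → ℂ} {F : Set ℂ}
    (h : IsArcSystem γ F) {z : ℂ} (hz : z ∈ F) (hzv : z ∉ vertices γ) :
    ∃ i, ∃ t ∈ Ioo (0 : ℝ) 1, γ i t = z := by
  rw [h.eq_iUnion] at hz
  obtain ⟨i, t, ht, rfl⟩ := mem_iUnion.1 hz
  refine ⟨i, t, ⟨lt_of_le_of_ne ht.1 ?_, lt_of_le_of_ne ht.2 ?_⟩, rfl⟩
  · rintro rfl
    exact hzv (Or.inl ⟨i, rfl⟩)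
  · rintro rfl
    exact hzv (Or.inr ⟨i, rfl⟩)

/-- The exterior boundaries of disjoint admissible sets overlap in a finite set. -/
theorem finite_inter_exterior {M B Ω₁ Ω₂ : Set ℂ} {p : ℝ → ℂ} {P σ : ℝ}
    (hp : IsBoundaryCurve M p P σ B) (h₁ : IsAdmissible 1 M Ω₁) (h₂ : IsAdmissible 1 M Ω₂)
    (hd : Disjoint Ω₁ Ω₂) :
    ((frontier Ω₁ ∩ frontier M) ∩ (frontier Ω₂ ∩ frontier M)).Finite := by
  obtain ⟨m₁, γ₁, hγ₁⟩ := h₁.boundary.exists_arcSystem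
  obtain ⟨m₂, γ₂, hγ₂⟩ := h₂.boundary.exists_arcSystem
  refine ((hp.finite.union (vertices_finite γ₁)).union (vertices_finite γ₂)).subset ?_
  rintro z ⟨⟨hz1, hzM⟩, hz2, -⟩
  by_contra hcon
  simp only [mem_union, not_or] at hcon
  obtain ⟨⟨hzB, hzv1⟩, hzv2⟩ := hcon
  obtain ⟨s, hs, rfl⟩ := hp.cover hzM
  obtain ⟨i, t, ht, hti⟩ := hγ₁.exists_of_notMem_vertices hz1 hzv1
  obtain ⟨j, u, hu, huj⟩ := hγ₂.exists_of_notMem_vertices hz2 hzv2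
  obtain ⟨τ, κ, -, hτ, -, -, -, -, hev⟩ :=
    (hγ₁.isFreeArc i).tangent hp h₁.isOpen h₁.subset hs hzB ht hti
  obtain ⟨τ', κ', -, hτ', -, -, -, -, hev'⟩ :=
    (hγ₂.isFreeArc j).tangent hp h₂.isOpen h₂.subset hs hzB hu huj
  have : τ' = τ := hτ'.unique hτ
  subst this
  -- Off the corners and the vertices both sets contain a short piece of the same inner normal,
  -- against disjointness.
  obtain ⟨x, hx, hx'⟩ := (hev.and hev').exists
  exact Set.disjoint_left.1 hd hx hx'

/-! ### The calibration inequality -/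

/-- A Lipschitz function has the same derivative along curves with the same tangent. -/
theorem hasDerivAt_comp_of_tangent {ψ : ℂ → ℝ} (hψ : LipschitzWith 1 ψ) {p γ : ℝ → ℂ} {s t κ D : ℝ}
    {τ : ℂ} (hp : HasDerivAt p τ s) (hγ : HasDerivAt γ (κ * τ) t) (hst : γ t = p s)
    (hD : HasDerivAt (fun x => ψ (p x)) D s) : HasDerivAt (fun x => ψ (γ x)) (D * κ) t := by
  have hlin : HasDerivAt (fun x => s + κ * (x - t)) κ t := by
    simpa using (((hasDerivAt_id t).sub_const t).const_mul κ).const_add s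
  have hq : HasDerivAt (fun x => p (s + κ * (x - t))) (κ * τ) t := by
    have := HasDerivAt.scomp t (h := fun x => s + κ * (x - t)) (g₁ := p) (by simpa using hp) hlin
    simpa [Function.comp_def] using this
  have hψq : HasDerivAt (fun x => ψ (p (s + κ * (x - t)))) (D * κ) t := by
    have := HasDerivAt.comp t (h := fun x => s + κ * (x - t)) (h₂ := fun x => ψ (p x))
      (by simpa using hD) hlin
    simpa [Function.comp_def] using this
  -- Differentiability of `ψ` at the point is not available. Instead, `γ` is compared with the
  -- reparametrized `p`: they differ by `o (x - t)`, and so do their images under the Lipschitz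
  -- function.
  have hdiff : HasDerivAt (fun x => ψ (γ x) - ψ (p (s + κ * (x - t)))) 0 t := by
    have h1 := (hγ.sub hq)
    rw [sub_self, hasDerivAt_iff_isLittleO] at h1
    rw [hasDerivAt_iff_isLittleO]
    refine Asymptotics.IsBigO.trans_isLittleO (Asymptotics.IsBigO.of_bound 1 ?_) h1
    refine Eventually.of_forall fun x => ?_
    have h2 := hψ.dist_le_mul (γ x) (p (s + κ * (x - t)))
    rw [Real.dist_eq, dist_eq_norm] at h2
    simpa [hst] using h2
  have := hdiff.add hψq
  rw [zero_add] at this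
  refine this.congr_of_eventuallyEq (Eventually.of_forall fun x => ?_)
  simp

theorem abs_deriv_comp_le {ψ : ℂ → ℝ} (hψ : LipschitzWith 1 ψ) {γ : ℝ → ℂ} {t : ℝ} {v : ℂ}
    (hγ : HasDerivAt γ v t) : |deriv (fun x => ψ (γ x)) t| ≤ ‖v‖ := by
  by_cases hd : DifferentiableAt ℝ (fun x => ψ (γ x)) t
  · have h1 := (hasDerivAt_iff_tendsto_slope.1 hd.hasDerivAt).norm
    have h2 := (hasDerivAt_iff_tendsto_slope.1 hγ).norm
    rw [← Real.norm_eq_abs]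
    refine le_of_tendsto_of_tendsto' h1 h2 fun x => ?_
    rw [slope_def_module, slope_def_module, norm_smul, norm_smul]
    gcongr
    have := hψ.dist_le_mul (γ x) (γ t)
    rw [dist_eq_norm, dist_eq_norm] at this
    simpa using this
  · rw [deriv_zero_of_not_differentiableAt hd]
    simp

theorem IsRegularArc.exists_lipschitzOnWith {γ : ℝ → ℂ} (h : IsRegularArc 1 γ) :
    ∃ C : ℝ≥0, LipschitzOnWith C γ (Icc 0 1) := by
  obtain ⟨C, hC⟩ := isCompact_Icc.exists_bound_of_continuousOn h.continuousOn_vel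
  refine ⟨Real.toNNReal C, (convex_Icc 0 1).lipschitzOnWith_of_nnnorm_hasDerivWithin_le
    (fun t ht => h.hasDerivWithinAt ht) fun t ht => ?_⟩
  rw [← NNReal.coe_le_coe, coe_nnnorm]
  exact (hC t ht).trans (Real.le_coe_toNNReal C)

theorem IsRegularArc.integrableOn_norm_vel {γ : ℝ → ℂ} (h : IsRegularArc 1 γ) {A : Set ℝ}
    (hA : A ⊆ Icc 0 1) : IntegrableOn (fun t => ‖vel γ t‖) A :=
  (h.continuousOn_vel.norm.integrableOn_compact isCompact_Icc).mono_set hA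

theorem frontier_subset_union {M Ω : Set ℂ} (hM : IsOpen M) (hΩM : Ω ⊆ M) :
    frontier Ω ⊆ M ∪ frontier M := by
  intro z hz
  have h1 : z ∈ closure M := closure_mono hΩM (frontier_subset_closure hz)
  rw [hM.frontier_eq]
  by_cases hzM : z ∈ M
  · exact Or.inl hzM
  · exact Or.inr ⟨h1, hzM⟩

/-- The increment of `ψ` along the arc is the integral of its derivative, split into the parameters
on `∂M` and those in `M`. On the former, orientation and multiplicity match, so each unit of length
gives exactly `lam`; on the latter only the Lipschitz bound is used. -/
theorem IsFreeArc.le_mult_mul {M Ω B : Set ℂ} {p γ : ℝ → ℂ} {P σ lam : ℝ}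
    (hp : IsBoundaryCurve M p P σ B) (h : IsFreeArc (frontier Ω) γ) (hΩ : IsOpen Ω)
    (hΩM : Ω ⊆ M) {ψ : ℂ → ℝ} (hψ : LipschitzWith 1 ψ) {N : Set ℝ} (hN : volume N = 0)
    (hder : ∀ s ∈ Ico 0 P, s ∉ N → p s ∈ frontier Ω → p s ∈ frontier M →
      HasDerivAt (fun x => ψ (p x)) (lam * σ) s) :
    lam * (∫ t in Ioo 0 1 ∩ γ ⁻¹' frontier M, ‖vel γ t‖) - ∫ t in Ioo 0 1 ∩ γ ⁻¹' M, ‖vel γ t‖ ≤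
      mult Ω γ * (ψ (γ 1) - ψ (γ 0)) := by
  obtain ⟨C, hC⟩ := h.arc.exists_lipschitzOnWith
  have hfLip : LipschitzOnWith (1 * C) (fun t => ψ (γ t)) (uIcc 0 1) := by
    rw [uIcc_of_le zero_le_one]
    exact (hψ.lipschitzOnWith (s := univ)).comp hC (mapsTo_univ _ _)
  have hAC := hfLip.absolutelyContinuousOnInterval
  have hinteg := hAC.intervalIntegrable_deriv
  rw [intervalIntegrable_iff_integrableOn_Ioc_of_le zero_le_one] at hinteg
  have hFTC := hAC.integral_deriv_eq_sub
  set f : ℝ → ℝ := fun t => ψ (γ t) with hf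
  set T := Ioo 0 1 ∩ γ ⁻¹' frontier M with hT
  set U := Ioo 0 1 ∩ γ ⁻¹' M with hU
  have hc : ContinuousOn γ (Ioo 0 1) := h.arc.continuousOn.mono Ioo_subset_Icc_self
  have hTm : MeasurableSet T :=
    measurableSet_inter_preimage hc measurableSet_Ioo isClosed_frontier.measurableSet
  have hUm : MeasurableSet U :=
    measurableSet_inter_preimage hc measurableSet_Ioo hp.isOpen.measurableSet
  have hTI : T ⊆ Ioo 0 1 := inter_subset_left
  have hUI : U ⊆ Ioo 0 1 := inter_subset_left
  have hdisj : Disjoint T U := by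
    refine Set.disjoint_left.2 fun t ht ht' => ?_
    have h1 : γ t ∈ frontier M := ht.2
    rw [hp.isOpen.frontier_eq] at h1
    exact h1.2 ht'.2
  have hunion : Ioo 0 1 = T ∪ U := by
    ext t
    refine ⟨fun ht => ?_, fun ht => ht.elim (fun h => hTI h) fun h => hUI h⟩
    rcases frontier_subset_union hp.isOpen hΩM (h.mem t (Ioo_subset_Icc_self ht)) with h1 | h1
    · exact Or.inr ⟨ht, h1⟩
    · exact Or.inl ⟨ht, h1⟩
  have hintT : IntegrableOn (deriv f) T := hinteg.mono_set (hTI.trans Ioo_subset_Ioc_self)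
  have hintU : IntegrableOn (deriv f) U := hinteg.mono_set (hUI.trans Ioo_subset_Ioc_self)
  have hsplit : f 1 - f 0 = (∫ t in T, deriv f t) + ∫ t in U, deriv f t := by
    rw [← hFTC, intervalIntegral.integral_of_le zero_le_one, integral_Ioc_eq_integral_Ioo, hunion,
      setIntegral_union hdisj hUm hintT hintU]
  have hTval : mult Ω γ * ∫ t in T, deriv f t = lam * ∫ t in T, ‖vel γ t‖ := by
    rw [← integral_const_mul, ← integral_const_mul]
    refine setIntegral_congr_ae hTm ?_
    filter_upwards [h.arc.ae_notMem (hp.null N hN), h.arc.ae_notMem (hausdorff_finite hp.finite)]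
      with t h1 h2 ht
    have htI := hTI ht
    obtain ⟨s, hs, hst⟩ := hp.cover ht.2
    have hsN : s ∉ N := fun hmem => h1 htI ⟨s, hmem, hst⟩
    have hsB : p s ∉ B := fun hmem => h2 htI (hst ▸ hmem)
    obtain ⟨τ, κ, hτn, hτ, hv, hmκ, -, -⟩ := h.tangent hp hΩ hΩM hs hsB htI hst.symm
    have hd := hder s hs hsN (hst ▸ h.mem t (Ioo_subset_Icc_self htI)) (hst ▸ ht.2)
    have hγ := h.arc.hasDerivAt htI
    rw [hv] at hγ
    -- The derivative along the arc is `lam * σ * κ`, and `mult Ω γ * κ = |κ|` turns it into `lam`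
    -- times the speed.
    rw [(hasDerivAt_comp_of_tangent hψ hτ hγ hst.symm hd).deriv, hv, norm_mul, hτn,
      Complex.norm_real, Real.norm_eq_abs, ← hmκ]
    ring
  have hUval : -∫ t in U, ‖vel γ t‖ ≤ mult Ω γ * ∫ t in U, deriv f t := by
    have h1 : |∫ t in U, deriv f t| ≤ ∫ t in U, ‖vel γ t‖ := by
      rw [← Real.norm_eq_abs]
      refine (norm_integral_le_integral_norm _).trans ?_
      refine setIntegral_mono_on hintU.norm
        (h.arc.integrableOn_norm_vel (hUI.trans Ioo_subset_Icc_self)) hUm fun t ht => ?_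
      rw [Real.norm_eq_abs]
      exact abs_deriv_comp_le hψ (h.arc.hasDerivAt (hUI ht))
    have h2 : |mult Ω γ * ∫ t in U, deriv f t| ≤ ∫ t in U, ‖vel γ t‖ := by
      rw [abs_mul]
      calc _ ≤ 1 * |∫ t in U, deriv f t| := by gcongr; exact abs_mult_le Ω γ
        _ ≤ _ := by rw [one_mul]; exact h1
    exact (abs_le.1 h2).1
  have : mult Ω γ * (f 1 - f 0) = mult Ω γ * (∫ t in T, deriv f t) +
      mult Ω γ * ∫ t in U, deriv f t := by rw [hsplit]; ring
  have e : mult Ω γ * (ψ (γ 1) - ψ (γ 0)) = mult Ω γ * (f 1 - f 0) := rfl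
  rw [e, this, hTval]
  linarith

/-- Summing the inequality over all arcs, the right-hand sides cancel by the cycle property. The
rest converts integrals of the speed into Hausdorff measure; end points have length zero. -/
theorem mul_exteriorLength_le {M Ω B : Set ℂ} {p : ℝ → ℂ} {P σ lam : ℝ} (hlam : 0 ≤ lam)
    (hp : IsBoundaryCurve M p P σ B) (hΩ : IsAdmissible 1 M Ω)
    {ψ : ℂ → ℝ} (hψ : LipschitzWith 1 ψ) {N : Set ℝ} (hN : volume N = 0)
    (hder : ∀ s ∈ Ico 0 P, s ∉ N → p s ∈ frontier Ω → p s ∈ frontier M →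
      HasDerivAt (fun x => ψ (p x)) (lam * σ) s) :
    ENNReal.ofReal lam * exteriorLength M Ω ≤ interiorLength M Ω := by
  obtain ⟨m, γ, hγ⟩ := hΩ.boundary.exists_arcSystem
  set T : Fin m → Set ℝ := fun i => Ioo 0 1 ∩ γ i ⁻¹' frontier M with hT
  set U : Fin m → Set ℝ := fun i => Ioo 0 1 ∩ γ i ⁻¹' M with hU
  have hc : ∀ i, ContinuousOn (γ i) (Ioo 0 1) := fun i =>
    (hγ.arc i).continuousOn.mono Ioo_subset_Icc_self
  have hTm : ∀ i, MeasurableSet (T i) := fun i =>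
    measurableSet_inter_preimage (hc i) measurableSet_Ioo isClosed_frontier.measurableSet
  have hUm : ∀ i, MeasurableSet (U i) := fun i =>
    measurableSet_inter_preimage (hc i) measurableSet_Ioo hp.isOpen.measurableSet
  have hTI : ∀ i, T i ⊆ Icc 0 1 := fun i => inter_subset_left.trans Ioo_subset_Icc_self
  have hUI : ∀ i, U i ⊆ Icc 0 1 := fun i => inter_subset_left.trans Ioo_subset_Icc_self
  have hreal : lam * ∑ i, ∫ t in T i, ‖vel (γ i) t‖ ≤ ∑ i, ∫ t in U i, ‖vel (γ i) t‖ := by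
    have h1 := Finset.sum_le_sum fun i (_ : i ∈ Finset.univ) =>
      (hγ.isFreeArc i).le_mult_mul hp hΩ.isOpen hΩ.subset hψ hN hder
    rw [hγ.sum_mult_mul_eq_zero hΩ.isOpen ψ, Finset.sum_sub_distrib, ← Finset.mul_sum] at h1
    linarith
  have hconv : ∀ i (A : Set ℝ), MeasurableSet A → A ⊆ Icc 0 1 →
      ENNReal.ofReal (∫ t in A, ‖vel (γ i) t‖) = μH[1] (γ i '' A) := by
    intro i A hA hAI
    rw [(hγ.arc i).hausdorff_image hA hAI]
    refine ofReal_integral_norm_eq_lintegral_enorm ?_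
    exact ((hγ.arc i).continuousOn_vel.integrableOn_compact isCompact_Icc).mono_set hAI
  have hext : exteriorLength M Ω ≤ ∑ i, μH[1] (γ i '' T i) := by
    have hsub : frontier Ω ∩ frontier M ⊆ (⋃ i, γ i '' T i) ∪ vertices γ := by
      rintro z ⟨hz, hzM⟩
      by_cases hzv : z ∈ vertices γ
      · exact Or.inr hzv
      · obtain ⟨i, t, ht, rfl⟩ := hγ.exists_of_notMem_vertices hz hzv
        exact Or.inl (mem_iUnion.2 ⟨i, t, ⟨ht, hzM⟩, rfl⟩)
    calc exteriorLength M Ω ≤ μH[1] ((⋃ i, γ i '' T i) ∪ vertices γ) := measure_mono hsub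
      _ ≤ μH[1] (⋃ i, γ i '' T i) + μH[1] (vertices γ) := measure_union_le _ _
      _ = μH[1] (⋃ i, γ i '' T i) := by rw [hausdorff_finite (vertices_finite γ), add_zero]
      _ ≤ _ := measure_iUnion_fintype_le _ _
  have hinte : ∑ i, μH[1] (γ i '' U i) ≤ interiorLength M Ω := by
    have h1 : μH[1] (⋃ i, γ i '' U i) = ∑' i, μH[1] (γ i '' U i) := by
      refine measure_iUnion (fun i j hij => ?_) fun i => ?_
      · exact (hγ.disjoint i j hij).mono (image_mono inter_subset_left) (image_mono (hUI j))
      · exact (hUm i).image_of_continuousOn_injOn ((hγ.arc i).continuousOn.mono (hUI i))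
          ((hγ.arc i).injOn.mono (hUI i))
    rw [tsum_fintype] at h1
    rw [← h1]
    refine measure_mono (iUnion_subset fun i => ?_)
    rintro _ ⟨t, ht, rfl⟩
    exact ⟨(hγ.isFreeArc i).mem t (hUI i ht), ht.2⟩
  have hnn : ∀ i (A : Set ℝ), 0 ≤ ∫ t in A, ‖vel (γ i) t‖ := fun i A =>
    integral_nonneg fun t => norm_nonneg _
  calc ENNReal.ofReal lam * exteriorLength M Ω
      ≤ ENNReal.ofReal lam * ∑ i, μH[1] (γ i '' T i) := by gcongr
    _ = ENNReal.ofReal (lam * ∑ i, ∫ t in T i, ‖vel (γ i) t‖) := by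
        rw [ENNReal.ofReal_mul hlam, ENNReal.ofReal_sum_of_nonneg fun i _ => hnn i _]
        congr 1
        exact Finset.sum_congr rfl fun i _ => (hconv i _ (hTm i) (hTI i)).symm
    _ ≤ ENNReal.ofReal (∑ i, ∫ t in U i, ‖vel (γ i) t‖) := ENNReal.ofReal_le_ofReal hreal
    _ = ∑ i, μH[1] (γ i '' U i) := by
        rw [ENNReal.ofReal_sum_of_nonneg fun i _ => hnn i _]
        exact Finset.sum_congr rfl fun i _ => hconv i _ (hUm i) (hUI i)
    _ ≤ _ := hinte

/-! ### Construction of calibrations and the general lower bound -/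

/-- A density on `[0, P]` with mean zero that equals `1` on `E` and whose integrals over intervals
are small. -/
theorem exists_density {P : ℝ} (hP : 0 < P) {E : Set ℝ} (hE : MeasurableSet E) (hEI : E ⊆ Ioo 0 P)
    (hEP : volume.real E ≤ P / 2) :
    ∃ g : ℝ → ℝ, (∀ x ∈ E, g x = 1) ∧ (∀ a b, IntervalIntegrable g volume a b) ∧
      ∀ a b, 0 ≤ a → a ≤ b → b ≤ P →
        |∫ x in a..b, g x| ≤ min (min (b - a) (P - (b - a))) (volume.real E) := by
  set L := volume.real E with hL
  have hL0 : 0 ≤ L := measureReal_nonneg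
  set c := L / (P - L) with hc
  have hPL : 0 < P - L := by linarith
  have hc0 : 0 ≤ c := by positivity
  have hc1 : c ≤ 1 := by
    rw [hc, div_le_one hPL]; linarith
  set χ : ℝ → ℝ := E.indicator 1 with hχ
  have hχ0 : ∀ x, 0 ≤ χ x := fun x => indicator_nonneg (fun _ _ => zero_le_one) x
  have hχ1 : ∀ x, χ x ≤ 1 := fun x => indicator_le_self' (fun _ _ => zero_le_one) x
  have hχi : ∀ a b, IntervalIntegrable χ volume a b := by
    intro a b
    rw [intervalIntegrable_iff]
    exact (integrableOn_const (C := (1 : ℝ)) (by simp)).indicator hE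
  have h1i : ∀ a b, IntervalIntegrable (fun _ : ℝ => (1 : ℝ)) volume a b := fun a b =>
    intervalIntegrable_const
  have hχtot : ∫ x in (0 : ℝ)..P, χ x = L := by
    rw [intervalIntegral.integral_of_le hP.le, hχ, integral_indicator_one hE, hL,
      measureReal_restrict_apply hE, inter_eq_left.2 (hEI.trans Ioo_subset_Ioc_self)]
  set g : ℝ → ℝ := fun x => χ x - c * (1 - χ x) with hg
  have hgi : ∀ a b, IntervalIntegrable g volume a b := fun a b =>
    (hχi a b).sub (((h1i a b).sub (hχi a b)).const_mul c)
  have hgabs : ∀ x, |g x| ≤ 1 := by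
    intro x
    rw [abs_le]
    have h1 := hχ0 x
    have h2 := hχ1 x
    constructor <;> simp only [hg] <;> nlinarith
  have hlen : ∀ a b, a ≤ b → |∫ x in a..b, g x| ≤ b - a := by
    intro a b hab
    have := intervalIntegral.norm_integral_le_of_norm_le_const (a := a) (b := b) (C := 1) (f := g)
      fun x _ => by rw [Real.norm_eq_abs]; exact hgabs x
    rwa [Real.norm_eq_abs, one_mul, abs_of_nonneg (sub_nonneg.2 hab)] at this
  have hgtot : ∫ x in (0 : ℝ)..P, g x = 0 := by
    simp only [hg]
    rw [intervalIntegral.integral_sub (hχi _ _) (((h1i _ _).sub (hχi _ _)).const_mul c),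
      intervalIntegral.integral_const_mul, intervalIntegral.integral_sub (h1i _ _) (hχi _ _), hχtot,
      intervalIntegral.integral_const, hc]
    simp only [sub_zero, smul_eq_mul, mul_one]
    field_simp
    ring
  have hmono : ∀ (u : ℝ → ℝ), (∀ x, 0 ≤ u x) → (∀ a b, IntervalIntegrable u volume a b) →
      ∀ a b, 0 ≤ a → a ≤ b → b ≤ P → ∫ x in a..b, u x ≤ ∫ x in (0 : ℝ)..P, u x := by
    intro u hu hui a b ha hab hb
    exact intervalIntegral.integral_mono_interval ha hab hb (Eventually.of_forall hu) (hui _ _)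
  refine ⟨g, fun x hx => by simp [hg, hχ, hx], hgi, fun a b ha hab hb => ?_⟩
  refine le_min (le_min (hlen a b hab) ?_) ?_
  -- Since the mean is zero, the integral over `[a, b]` is minus that over the complement, of length
  -- `P - (b - a)`.
  · have h1 := intervalIntegral.integral_add_adjacent_intervals (hgi 0 a) (hgi a b)
    have h2 := intervalIntegral.integral_add_adjacent_intervals (hgi 0 b) (hgi b P)
    have h3 := abs_le.1 (hlen 0 a ha)
    have h4 := abs_le.1 (hlen b P hb)
    rw [abs_le]
    constructor <;> linarith
  -- The positive and the negative part of the density both have total mass `L`.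
  · have h1 : ∫ x in a..b, g x ≤ ∫ x in a..b, χ x := by
      refine intervalIntegral.integral_mono_on hab (hgi _ _) (hχi _ _) fun x _ => ?_
      have := hχ1 x
      simp only [hg]
      nlinarith
    have h2 := hmono χ hχ0 hχi a b ha hab hb
    have h3 : -(∫ x in a..b, c * (1 - χ x)) ≤ ∫ x in a..b, g x := by
      rw [← intervalIntegral.integral_neg]
      refine intervalIntegral.integral_mono_on hab
        (((h1i _ _).sub (hχi _ _)).const_mul c).neg (hgi _ _) fun x _ => ?_
      have := hχ0 x
      simp only [hg]
      linarith
    have h4 := hmono (fun x => c * (1 - χ x))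
      (fun x => mul_nonneg hc0 (sub_nonneg.2 (hχ1 x)))
      (fun a b => ((h1i a b).sub (hχi a b)).const_mul c) a b ha hab hb
    have h5 : ∫ x in (0 : ℝ)..P, c * (1 - χ x) = L := by
      have : ∫ x in (0 : ℝ)..P, g x = (∫ x in (0 : ℝ)..P, χ x) - ∫ x in (0 : ℝ)..P, c * (1 - χ x) :=
        intervalIntegral.integral_sub (hχi _ _) (((h1i _ _).sub (hχi _ _)).const_mul c)
      linarith
    rw [abs_le]
    constructor <;> linarith

theorem injOn_of_chord {p : ℝ → ℂ} {P a d : ℝ} (ha : 0 < a) (hd : 0 < d)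
    (hchord : ∀ x y, 0 ≤ x → x ≤ y → y < P →
      a * min (min (y - x) (P - (y - x))) d ≤ ‖p y - p x‖) : InjOn p (Ico 0 P) := by
  have key : ∀ x ∈ Ico 0 P, ∀ y ∈ Ico 0 P, x < y → p x ≠ p y := by
    intro x hx y hy hxy he
    have := hchord x y hx.1 hxy.le hy.2
    rw [he, sub_self, norm_zero] at this
    have h1 : 0 < min (min (y - x) (P - (y - x))) d :=
      lt_min (lt_min (by linarith) (by linarith [hx.1, hy.2])) hd
    nlinarith
  intro x hx y hy he
  rcases lt_trichotomy x y with h | h | h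
  · exact absurd he (key x hx y hy h)
  · exact h
  · exact absurd he.symm (key y hy x hx h)

/-- Finiteness of the length is what permits dividing the calibration inequality by the exterior
length. -/
theorem IsPiecewiseSmooth.hausdorff_ne_top {F : Set ℂ} (h : IsPiecewiseSmooth 1 F) :
    μH[1] F ≠ ⊤ := by
  obtain ⟨m, γ, hγ⟩ := h.exists_arcSystem
  rw [hγ.eq_iUnion]
  refine ne_top_of_le_ne_top ?_ (measure_iUnion_fintype_le _ _)
  refine (ENNReal.sum_lt_top.2 fun i _ => ?_).ne
  obtain ⟨C, hC⟩ := (hγ.arc i).exists_lipschitzOnWith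
  refine (hC.hausdorffMeasure_image_le zero_le_one).trans_lt ?_
  rw [ENNReal.rpow_one, hausdorffMeasure_real]
  simp

/-- A calibration of the part `E` of a boundary curve whose chords are not too short. -/
theorem exists_calibration {p : ℝ → ℂ} {P a d : ℝ} (hP : 0 < P) (ha : 0 < a) (hd : 0 < d)
    (hdP : d ≤ P / 2)
    (hchord : ∀ x y, 0 ≤ x → x ≤ y → y < P →
      a * min (min (y - x) (P - (y - x))) d ≤ ‖p y - p x‖)
    {E : Set ℝ} (hE : MeasurableSet E) (hEI : E ⊆ Ioo 0 P) (hEd : volume.real E ≤ d) :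
    ∃ ψ : ℂ → ℝ, LipschitzWith 1 ψ ∧ ∃ N : Set ℝ, volume N = 0 ∧
      ∀ s ∈ E, s ∉ N → HasDerivAt (fun x => ψ (p x)) a s := by
  obtain ⟨g, hg1, hgi, hgb⟩ := exists_density hP hE hEI (hEd.trans hdP)
  set Ψ : ℝ → ℝ := fun x => a * ∫ t in (0 : ℝ)..x, g t with hΨ
  have hinc : ∀ x ∈ Ico 0 P, ∀ y ∈ Ico 0 P, x ≤ y → |Ψ y - Ψ x| ≤ ‖p y - p x‖ := by
    intro x hx y hy hxy
    have h1 := intervalIntegral.integral_add_adjacent_intervals (hgi 0 x) (hgi x y)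
    have h2 : Ψ y - Ψ x = a * ∫ t in x..y, g t := by
      simp only [hΨ]; rw [← h1]; ring
    rw [h2, abs_mul, abs_of_pos ha]
    refine le_trans ?_ (hchord x y hx.1 hxy hy.2)
    gcongr
    exact (hgb x y hx.1 hxy hy.2.le).trans (min_le_min_left _ hEd)
  have hinc' : ∀ x ∈ Ico 0 P, ∀ y ∈ Ico 0 P, |Ψ y - Ψ x| ≤ ‖p y - p x‖ := by
    intro x hx y hy
    rcases le_total x y with h | h
    · exact hinc x hx y hy h
    · rw [abs_sub_comm, norm_sub_rev]
      exact hinc y hy x hx h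
  have hinj := injOn_of_chord ha hd hchord
  have hLip : LipschitzOnWith 1 (fun z => Ψ (Function.invFunOn p (Ico 0 P) z)) (p '' Ico 0 P) := by
    refine LipschitzOnWith.of_dist_le_mul ?_
    rintro _ ⟨x, hx, rfl⟩ _ ⟨y, hy, rfl⟩
    rw [hinj.leftInvOn_invFunOn hx, hinj.leftInvOn_invFunOn hy, Real.dist_eq, dist_eq_norm,
      NNReal.coe_one, one_mul]
    exact hinc' y hy x hx
  -- The primitive is transported to the boundary by the inverse of `p` and then extended to the
  -- plane. By Lebesgue differentiation its derivative along `p` is `a` at almost every point of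
  -- `E`.
  obtain ⟨ψ, hψ, hψe⟩ := hLip.extend_real
  have hae := (hgi 0 P).ae_hasDerivAt_integral
  refine ⟨ψ, hψ, _, hae, fun s hs hsN => ?_⟩
  have hsI := hEI hs
  simp only [mem_compl_iff, not_not] at hsN
  have h0 : (0 : ℝ) ∈ uIcc 0 P := left_mem_uIcc
  have hsU : s ∈ uIcc 0 P := by
    rw [uIcc_of_le hP.le]
    exact Ioo_subset_Icc_self hsI
  have hd1 := (hsN hsU 0 h0).const_mul a
  rw [hg1 s hs, mul_one] at hd1
  refine hd1.congr_of_eventuallyEq ?_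
  filter_upwards [isOpen_Ioo.mem_nhds hsI] with x hx
  have hxI : x ∈ Ico 0 P := Ioo_subset_Ico_self hx
  have : Ψ (Function.invFunOn p (Ico 0 P) (p x)) = ψ (p x) := hψe ⟨x, hxI, rfl⟩
  rw [hinj.leftInvOn_invFunOn hxI] at this
  exact this.symm

/-- Lower bound for the Escobar constants in terms of the chords of the boundary curve. -/
theorem le_escobarConstant {r : WithTop ℕ∞} (hr : 1 ≤ r) {k : ℕ} (hk : 2 ≤ k) {M B : Set ℂ}
    {p : ℝ → ℂ} {P σ lam : ℝ} (hp : IsBoundaryCurve M p P σ B) (hP : 0 < P) (hlam : 0 < lam)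
    (hchord : ∀ x y, 0 ≤ x → x ≤ y → y < P →
      lam * σ * min (min (y - x) (P - (y - x))) (P / k) ≤ ‖p y - p x‖) :
    ENNReal.ofReal lam ≤ escobarConstant r k M := by
  refine le_iInf₂ fun Ω hΩ => ?_
  obtain ⟨hadm, hdisj⟩ := hΩ
  have hk' : (2 : ℝ) ≤ k := by exact_mod_cast hk
  have hk0 : (0 : ℝ) < k := by linarith
  have hσ := hp.speed_pos
  have hadm1 : ∀ j, IsAdmissible 1 M (Ω j) := fun j => (hadm j).of_le hr
  set E : Fin k → Set ℝ := fun j => Ioo 0 P ∩ p ⁻¹' (frontier (Ω j) ∩ frontier M) with hE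
  have hEm : ∀ j, MeasurableSet (E j) := fun j => measurableSet_Ioo.inter
    (hp.measurable (isClosed_frontier.inter isClosed_frontier).measurableSet)
  have hinj := injOn_of_chord (mul_pos hlam hσ) (show 0 < P / k by positivity) hchord
  have hEd : Pairwise (Function.onFun (AEDisjoint volume) E) := by
    intro i j hij
    have hfin := finite_inter_exterior hp (hadm1 i) (hadm1 j) (hdisj hij)
    have h1 : (E i ∩ E j).Finite := by
      refine Set.Finite.of_finite_image (f := p) (hfin.subset ?_)
        (hinj.mono fun x hx => Ioo_subset_Ico_self hx.1.1)
      rintro _ ⟨x, hx, rfl⟩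
      exact ⟨hx.1.2, hx.2.2⟩
    exact h1.measure_zero _
  have hsum : ∑ j, volume.real (E j) ≤ P := by
    have h1 : ∑ j, volume (E j) = volume (⋃ j, E j) := by
      rw [measure_iUnion₀ hEd fun j => (hEm j).nullMeasurableSet, tsum_fintype]
    have h2 : volume (⋃ j, E j) ≤ ENNReal.ofReal P := by
      refine (measure_mono (iUnion_subset fun j => inter_subset_left)).trans ?_
      simp
    have h3 : ∀ j, volume (E j) ≠ ⊤ := fun j =>
      ne_top_of_le_ne_top (by simp) (measure_mono (inter_subset_left : E j ⊆ Ioo 0 P))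
    have h4 : ∑ j, volume.real (E j) = (∑ j, volume (E j)).toReal := by
      rw [ENNReal.toReal_sum fun j _ => h3 j]
      rfl
    rw [h4, h1]
    exact ENNReal.toReal_le_of_le_ofReal hP.le h2
  -- Pigeonhole: the sets `E j` are almost disjoint subsets of an interval of length `P`.
  obtain ⟨j, hj⟩ : ∃ j, volume.real (E j) ≤ P / k := by
    by_contra hcon
    push Not at hcon
    have hne : (Finset.univ : Finset (Fin k)).Nonempty := ⟨⟨0, by omega⟩, Finset.mem_univ _⟩
    have := Finset.sum_lt_sum_of_nonempty hne fun j _ => hcon j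
    rw [Finset.sum_const, Finset.card_univ, Fintype.card_fin, nsmul_eq_mul,
      mul_div_cancel₀ _ hk0.ne'] at this
    linarith
  refine le_trans ?_ (le_iSup _ j)
  obtain ⟨ψ, hψ, N, hN, hder⟩ := exists_calibration hP (mul_pos hlam hσ)
    (show 0 < P / k by positivity) (by gcongr) hchord (hEm j) inter_subset_left hj
  -- The parameter `0` joins the exceptional set because `E j` lies in the open interval.
  have hmain := mul_exteriorLength_le hlam.le hp (hadm1 j) hψ (N := N ∪ {0})
    (measure_union_null hN (by simp)) (fun s hs hsN hs1 hs2 => ?_)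
  · unfold ratio
    split_ifs with h0
    · exact le_top
    · rw [ENNReal.le_div_iff_mul_le (Or.inl h0)]
      · exact hmain
      · left
        exact ne_top_of_le_ne_top (hadm1 j).boundary.hausdorff_ne_top
          (measure_mono inter_subset_left)
  · simp only [mem_union, mem_singleton_iff, not_or] at hsN
    exact hder s ⟨⟨lt_of_le_of_ne hs.1 (Ne.symm hsN.2), hs.2⟩, hs1, hs2⟩ hsN.1

/-! ### The unit disk -/

/-- By concavity the sine lies above its chord on `[0, θ]`, and it is increasing from `θ` to `π /
2`; the other half follows by symmetry about `π / 2`. -/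
theorem sin_mul_min_le {θ x : ℝ} (hθ : 0 < θ) (hθ' : θ ≤ Real.pi / 2) (hx : 0 ≤ x)
    (hx' : x ≤ Real.pi) :
    Real.sin θ * min (min x (Real.pi - x)) θ ≤ θ * Real.sin x := by
  have hs : 0 < Real.sin θ := Real.sin_pos_of_pos_of_lt_pi hθ (by linarith)
  have key : ∀ y, 0 ≤ y → y ≤ Real.pi / 2 → Real.sin θ * min y θ ≤ θ * Real.sin y := by
    intro y hy hy'
    rcases le_total y θ with h | h
    · rw [min_eq_left h]
      have hc := strictConcaveOn_sin_Icc.concaveOn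
      have h1 := hc.2 (show (0 : ℝ) ∈ Icc 0 Real.pi from ⟨le_rfl, Real.pi_pos.le⟩)
        (show θ ∈ Icc 0 Real.pi from ⟨hθ.le, by linarith⟩)
        (show 0 ≤ 1 - y / θ by rw [sub_nonneg, div_le_one hθ]; exact h)
        (show 0 ≤ y / θ by positivity) (by ring)
      simp only [smul_eq_mul, mul_zero, Real.sin_zero, zero_add] at h1
      rw [div_mul_cancel₀ _ hθ.ne', div_mul_eq_mul_div, div_le_iff₀ hθ] at h1
      linarith
    · rw [min_eq_right h, mul_comm]
      gcongr
      exact Real.sin_le_sin_of_le_of_le_pi_div_two (by linarith [Real.pi_pos]) hy' h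
  rcases le_total x (Real.pi / 2) with h | h
  · rw [min_eq_left (by linarith : x ≤ Real.pi - x)]
    exact key x hx h
  · rw [min_eq_right (by linarith : Real.pi - x ≤ x)]
    have := key (Real.pi - x) (by linarith) (by linarith)
    rwa [Real.sin_pi_sub] at this

/-- The point of the unit circle at angle `t`. -/
def cis (t : ℝ) : ℂ := Complex.exp (t * Complex.I)

theorem cis_re (t : ℝ) : (cis t).re = Real.cos t := Complex.exp_ofReal_mul_I_re t

theorem cis_im (t : ℝ) : (cis t).im = Real.sin t := Complex.exp_ofReal_mul_I_im t

theorem norm_cis (t : ℝ) : ‖cis t‖ = 1 := Complex.norm_exp_ofReal_mul_I t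

theorem cis_ne_zero (t : ℝ) : cis t ≠ 0 := Complex.exp_ne_zero _

theorem cis_add (a b : ℝ) : cis (a + b) = cis a * cis b := by
  simp only [cis]; rw [← Complex.exp_add]; congr 1; push_cast; ring

theorem cis_periodic : Function.Periodic cis (2 * Real.pi) := by
  intro t
  apply Complex.ext <;> simp [cis_re, cis_im]

theorem exists_cis (z : ℂ) : ∃ φ ∈ Ico 0 (2 * Real.pi), z = ‖z‖ * cis φ := by
  obtain ⟨φ, hφ, he⟩ := cis_periodic.exists_mem_Ico₀ Real.two_pi_pos (Complex.arg z)
  refine ⟨φ, hφ, ?_⟩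
  rw [← he]
  exact (Complex.norm_mul_exp_arg_mul_I z).symm

theorem hasDerivAt_cis (t : ℝ) : HasDerivAt cis (cis t * Complex.I) t := by
  have h1 : HasDerivAt (fun θ : ℝ => (θ : ℂ) * Complex.I) (1 * Complex.I) t :=
    (Complex.ofRealCLM.hasDerivAt (x := t)).mul_const Complex.I
  rw [one_mul] at h1
  exact h1.cexp

theorem continuous_cis : Continuous cis :=
  continuous_iff_continuousAt.2 fun t => (hasDerivAt_cis t).continuousAt

theorem lipschitz_cis : LipschitzWith 1 cis := by
  refine lipschitzWith_of_nnnorm_deriv_le (fun t => (hasDerivAt_cis t).differentiableAt) fun t => ?_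
  rw [(hasDerivAt_cis t).deriv, ← NNReal.coe_le_coe, coe_nnnorm, norm_mul, norm_cis]
  simp

theorem norm_cis_sub (x y : ℝ) : ‖cis y - cis x‖ = |2 * Real.sin ((y - x) / 2)| := by
  have e : cis y - cis x = cis x * (Complex.exp (Complex.I * (y - x : ℝ)) - 1) := by
    have : cis y = cis x * cis (y - x) := by rw [← cis_add]; ring_nf
    rw [this]
    simp only [cis]
    rw [mul_comm Complex.I]
    ring
  rw [e, norm_mul, norm_cis, one_mul, Complex.norm_exp_I_mul_ofReal_sub_one, Real.norm_eq_abs]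

theorem isBoundaryCurve_unitDisk :
    IsBoundaryCurve unitDisk cis (2 * Real.pi) 1 ∅ := by
  refine ⟨Metric.isOpen_ball, one_pos, continuous_cis.measurable, ?_, ?_, finite_empty, ?_⟩
  · intro z hz
    rw [unitDisk, frontier_ball _ one_ne_zero, mem_sphere_zero_iff_norm] at hz
    obtain ⟨φ, hφ, he⟩ := exists_cis z
    exact ⟨φ, hφ, by rw [he, hz]; simp⟩
  · intro N hN
    have := lipschitz_cis.hausdorffMeasure_image_le zero_le_one N
    rw [hausdorffMeasure_real, hN] at this
    simpa using this
  · intro s _ _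
    refine ⟨cis s * Complex.I, by simp [norm_cis], hasDerivAt_cis s, fun z hz => ?_⟩
    rw [unitDisk, mem_ball_zero_iff] at hz
    have e : (z - cis s) / (cis s * Complex.I) = (1 - z / cis s) * Complex.I := by
      have := cis_ne_zero s
      field_simp
      rw [Complex.I_sq]
      ring
    rw [e, Complex.mul_I_im, Complex.sub_re, Complex.one_re, sub_pos]
    refine (Complex.re_le_norm _).trans_lt ?_
    rw [norm_div, norm_cis, div_one]
    exact hz

theorem le_escobarConstant_unitDisk {r : WithTop ℕ∞} (hr : 1 ≤ r) {k : ℕ} (hk : 1 ≤ k) :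
    ENNReal.ofReal (Real.sin (Real.pi / k) * (k / Real.pi)) ≤ escobarConstant r k unitDisk := by
  -- For `k = 1` the bound is zero, since `sin π = 0`; the calibration needs `k ≥ 2`.
  rcases hk.eq_or_lt with rfl | hk2
  · simp
  have hk' : (2 : ℝ) ≤ k := by exact_mod_cast hk2
  have hk0 : (0 : ℝ) < k := by linarith
  have hπ := Real.pi_pos
  have hθ : 0 < Real.pi / k := by positivity
  have hθ' : Real.pi / k ≤ Real.pi / 2 := by gcongr
  have hs : 0 < Real.sin (Real.pi / k) := Real.sin_pos_of_pos_of_lt_pi hθ (by linarith)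
  refine le_escobarConstant hr hk2 isBoundaryCurve_unitDisk Real.two_pi_pos (by positivity)
    fun x y hx hxy hy => ?_
  rw [norm_cis_sub]
  refine le_trans ?_ (le_abs_self _)
  have h1 := sin_mul_min_le hθ hθ' (x := (y - x) / 2) (by linarith) (by linarith)
  have e : min (min (y - x) (2 * Real.pi - (y - x))) (2 * Real.pi / k) =
      2 * min (min ((y - x) / 2) (Real.pi - (y - x) / 2)) (Real.pi / k) := by
    rw [mul_min_of_nonneg _ _ (by norm_num), mul_min_of_nonneg _ _ (by norm_num)]
    congr 1
    · congr 1 <;> ring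
    · ring
  rw [e]
  have e2 : Real.sin (Real.pi / k) * (k / Real.pi) * 1 *
      (2 * min (min ((y - x) / 2) (Real.pi - (y - x) / 2)) (Real.pi / k)) =
      2 * (k / Real.pi) * (Real.sin (Real.pi / k) *
        min (min ((y - x) / 2) (Real.pi - (y - x) / 2)) (Real.pi / k)) := by ring
  rw [e2]
  calc _ ≤ 2 * (k / Real.pi) * (Real.pi / k * Real.sin ((y - x) / 2)) := by gcongr
    _ = _ := by field_simp

/-- The Escobar constants increase with the number of sets. -/
theorem escobarConstant_mono {r : WithTop ℕ∞} {M : Set ℂ} {j k : ℕ} (hjk : j ≤ k) :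
    escobarConstant r j M ≤ escobarConstant r k M := by
  refine le_iInf₂ fun Ω hΩ => ?_
  refine (iInf₂_le (fun i : Fin j => Ω (Fin.castLE hjk i)) ?_).trans ?_
  · exact ⟨fun i => hΩ.1 _, fun a b hab => hΩ.2 fun h => hab (Fin.castLE_injective hjk h)⟩
  · exact iSup_le fun i => le_iSup (fun i => ratio M (Ω i)) _

/-! ### The regular polygon as an intersection of half planes -/

/-- The coordinate of `z` in the direction of angle `β`. -/
def proj (β : ℝ) (z : ℂ) : ℝ := z.re * Real.cos β + z.im * Real.sin β

theorem proj_add (β : ℝ) (z w : ℂ) : proj β (z + w) = proj β z + proj β w := by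
  simp [proj]; ring

theorem proj_sub (β : ℝ) (z w : ℂ) : proj β (z - w) = proj β z - proj β w := by
  simp [proj]; ring

theorem proj_ofReal_mul (β a : ℝ) (z : ℂ) : proj β (a * z) = a * proj β z := by
  simp [proj]; ring

theorem proj_cis (β t : ℝ) : proj β (cis t) = Real.cos (t - β) := by
  rw [proj, cis_re, cis_im, Real.cos_sub]

theorem proj_eq_re (β : ℝ) (z : ℂ) : proj β z = (z / cis β).re := by
  rw [Complex.div_re, Complex.normSq_eq_norm_sq, norm_cis, cis_re, cis_im, proj]
  simp

theorem proj_le_norm (β : ℝ) (z : ℂ) : proj β z ≤ ‖z‖ := by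
  rw [proj_eq_re]
  refine (Complex.re_le_norm _).trans ?_
  rw [norm_div, norm_cis, div_one]

theorem continuous_proj (β : ℝ) : Continuous (proj β) := by
  unfold proj
  fun_prop

/-- The `j`-th vertex of the regular `n`-gon in the unit circle. -/
def vtx (n j : ℕ) : ℂ := cis (2 * j * (Real.pi / n))

/-- The angle of the outer normal of the `j`-th side of the regular `n`-gon. -/
def sideAngle (n j : ℕ) : ℝ := (2 * j + 1) * (Real.pi / n)

/-- The regular `n`-gon in the unit circle as an intersection of half planes. -/
def stdPolygon (n : ℕ) : Set ℂ :=
  {z | ∀ j < n, proj (sideAngle n j) z < Real.cos (Real.pi / n)}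

variable {n : ℕ}

theorem angle_pos (hn : 3 ≤ n) : 0 < Real.pi / n := by
  have : (0 : ℝ) < n := by exact_mod_cast (by omega : 0 < n)
  positivity

theorem angle_le (hn : 3 ≤ n) : Real.pi / n ≤ Real.pi / 3 := by
  have : (3 : ℝ) ≤ n := by exact_mod_cast hn
  gcongr

theorem cos_angle_pos (hn : 3 ≤ n) : 0 < Real.cos (Real.pi / n) := by
  have h1 := angle_pos hn
  have h2 := angle_le hn
  have := Real.pi_pos
  exact Real.cos_pos_of_mem_Ioo ⟨by linarith, by linarith⟩

theorem sin_angle_pos (hn : 3 ≤ n) : 0 < Real.sin (Real.pi / n) := by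
  have h1 := angle_pos hn
  have h2 := angle_le hn
  have := Real.pi_pos
  exact Real.sin_pos_of_pos_of_lt_pi h1 (by linarith)

theorem mul_angle (hn : 3 ≤ n) : n * (Real.pi / n) = Real.pi := by
  have : (n : ℝ) ≠ 0 := by exact_mod_cast (by omega : n ≠ 0)
  field_simp

theorem vtx_add_self (hn : 3 ≤ n) (j : ℕ) : vtx n (j + n) = vtx n j := by
  have : 2 * ((j + n : ℕ) : ℝ) * (Real.pi / n) = 2 * j * (Real.pi / n) + 2 * Real.pi := by
    push_cast; linear_combination 2 * mul_angle hn
  rw [vtx, this, cis_periodic]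
  rfl

theorem vtx_mod (hn : 3 ≤ n) (j : ℕ) : vtx n (j % n) = vtx n j := by
  have hper : Function.Periodic (vtx n) n := fun j => vtx_add_self hn j
  exact hper.map_mod_nat j

theorem proj_side_vtx (n i j : ℕ) :
    proj (sideAngle n j) (vtx n i) = Real.cos ((2 * ((i : ℝ) - j) - 1) * (Real.pi / n)) := by
  rw [vtx, proj_cis, sideAngle]
  congr 1
  ring

theorem proj_side_vtx_self (n j : ℕ) :
    proj (sideAngle n j) (vtx n j) = Real.cos (Real.pi / n) := by
  rw [proj_side_vtx, ← Real.cos_neg]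
  congr 1
  ring

theorem proj_side_vtx_succ (n j : ℕ) :
    proj (sideAngle n j) (vtx n (j + 1)) = Real.cos (Real.pi / n) := by
  rw [proj_side_vtx]
  congr 1
  push_cast
  ring

theorem proj_side_vtx_le (hn : 3 ≤ n) {i j : ℕ} (hi : i < n) (hj : j < n) :
    proj (sideAngle n j) (vtx n i) ≤ Real.cos (Real.pi / n) := by
  have hx := angle_pos hn
  have hnx := mul_angle hn
  set x := Real.pi / n with hxdef
  rw [proj_side_vtx, ← hxdef, ← sub_nonneg, Real.cos_sub_cos]
  have e1 : (x + (2 * ((i : ℝ) - j) - 1) * x) / 2 = ((i : ℝ) - j) * x := by ring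
  have e2 : (x - (2 * ((i : ℝ) - j) - 1) * x) / 2 = -(((i : ℝ) - j - 1) * x) := by ring
  rw [e1, e2, Real.sin_neg]
  have hi' : (i : ℝ) + 1 ≤ n := by exact_mod_cast hi
  have hj' : (j : ℝ) + 1 ≤ n := by exact_mod_cast hj
  have hi0 : (0 : ℝ) ≤ i := Nat.cast_nonneg i
  have hj0 : (0 : ℝ) ≤ j := Nat.cast_nonneg j
  -- The difference of cosines is twice this product; the integers `i - j` and `i - j - 1` are never
  -- of opposite sign, hence neither are the two sines.
  have : 0 ≤ Real.sin (((i : ℝ) - j) * x) * Real.sin (((i : ℝ) - j - 1) * x) := by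
    rcases lt_or_ge j i with h | h
    · have h' : (j : ℝ) + 1 ≤ i := by exact_mod_cast h
      exact mul_nonneg (Real.sin_nonneg_of_nonneg_of_le_pi (by nlinarith) (by nlinarith))
        (Real.sin_nonneg_of_nonneg_of_le_pi (by nlinarith) (by nlinarith))
    · have h' : (i : ℝ) ≤ j := by exact_mod_cast h
      exact mul_nonneg_of_nonpos_of_nonpos
        (Real.sin_nonpos_of_nonpos_of_neg_pi_le (by nlinarith) (by nlinarith))
        (Real.sin_nonpos_of_nonpos_of_neg_pi_le (by nlinarith) (by nlinarith))
  linarith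

theorem proj_side_vtx_le' (hn : 3 ≤ n) (i : ℕ) {j : ℕ} (hj : j < n) :
    proj (sideAngle n j) (vtx n i) ≤ Real.cos (Real.pi / n) := by
  rw [← vtx_mod hn]
  exact proj_side_vtx_le hn (Nat.mod_lt _ (by omega)) hj

/-- The sine law for resolving a direction into two given ones; it supplies the coefficients in
`exists_sector`. -/
theorem sin_mul_cis (a b u : ℝ) :
    (Real.sin a : ℂ) * cis (b + u) = Real.sin (a - u) * cis b + Real.sin u * cis (b + a) := by
  apply Complex.ext
  · simp only [Complex.re_ofReal_mul, Complex.add_re, cis_re]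
    rw [Real.cos_add, Real.cos_add, Real.sin_sub]
    ring
  · simp only [Complex.im_ofReal_mul, Complex.add_im, cis_im]
    rw [Real.sin_add, Real.sin_add, Real.sin_sub]
    ring

/-- Each point lies in the sector spanned by two adjacent vertices. -/
theorem exists_sector (hn : 3 ≤ n) (z : ℂ) :
    ∃ j < n, ∃ s t : ℝ, 0 ≤ s ∧ 0 ≤ t ∧ z = s * vtx n j + t * vtx n (j + 1) := by
  have hx := angle_pos hn
  have hx3 := angle_le hn
  have hnx := mul_angle hn
  have hπ := Real.pi_pos
  obtain ⟨φ, hφ, hz⟩ := exists_cis z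
  set x := Real.pi / n with hxdef
  set j := ⌊φ / (2 * x)⌋₊ with hj
  have hφ0 : 0 ≤ φ / (2 * x) := div_nonneg hφ.1 (by linarith)
  have h1 : (j : ℝ) ≤ φ / (2 * x) := Nat.floor_le hφ0
  have h2 : φ / (2 * x) < j + 1 := Nat.lt_floor_add_one _
  rw [le_div_iff₀ (by linarith)] at h1
  rw [div_lt_iff₀ (by linarith)] at h2
  have hjn : j < n := by
    have : (j : ℝ) < n := by
      have := hφ.2
      nlinarith
    exact_mod_cast this
  set u := φ - 2 * j * x with hu
  have hS : 0 < Real.sin (2 * x) := Real.sin_pos_of_pos_of_lt_pi (by linarith) (by linarith)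
  refine ⟨j, hjn, ‖z‖ * Real.sin (2 * x - u) / Real.sin (2 * x),
    ‖z‖ * Real.sin u / Real.sin (2 * x), ?_, ?_, ?_⟩
  · have : 0 ≤ Real.sin (2 * x - u) :=
      Real.sin_nonneg_of_nonneg_of_le_pi (by linarith) (by linarith)
    positivity
  · have : 0 ≤ Real.sin u := Real.sin_nonneg_of_nonneg_of_le_pi (by linarith) (by linarith)
    positivity
  · have key : (Real.sin (2 * x) : ℂ) * cis φ =
        Real.sin (2 * x - u) * vtx n j + Real.sin u * vtx n (j + 1) := by
      have e1 : φ = 2 * j * x + u := by rw [hu]; ring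
      have e2 : vtx n (j + 1) = cis (2 * j * x + 2 * x) := by
        rw [vtx, ← hxdef]; congr 1; push_cast; ring
      have e3 : vtx n j = cis (2 * j * x) := rfl
      rw [e2, e3, ← sin_mul_cis, ← e1]
    have hS' : (Real.sin (2 * x) : ℂ) ≠ 0 := by exact_mod_cast hS.ne'
    apply mul_left_cancel₀ hS'
    simp only [Complex.ofReal_div, Complex.ofReal_mul]
    calc (Real.sin (2 * x) : ℂ) * z = ‖z‖ * (Real.sin (2 * x) * cis φ) := by
          conv_lhs => rw [hz]
          ring
      _ = _ := by rw [key]; field_simp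

theorem isOpen_stdPolygon (n : ℕ) : IsOpen (stdPolygon n) := by
  have : stdPolygon n = ⋂ j ∈ Finset.range n,
      {z | proj (sideAngle n j) z < Real.cos (Real.pi / n)} := by
    ext z; simp [stdPolygon]
  rw [this]
  exact isOpen_biInter_finset fun j _ => isOpen_lt (continuous_proj _) continuous_const

theorem mem_stdPolygon_of_sector (hn : 3 ≤ n) {i : ℕ} {s t : ℝ} (hs : 0 ≤ s) (ht : 0 ≤ t)
    (hst : s + t < 1) : (s * vtx n i + t * vtx n (i + 1) : ℂ) ∈ stdPolygon n := by
  intro j hj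
  rw [proj_add, proj_ofReal_mul, proj_ofReal_mul]
  have h1 := proj_side_vtx_le' hn i hj
  have h2 := proj_side_vtx_le' hn (i + 1) hj
  have h3 := cos_angle_pos hn
  nlinarith

theorem proj_side_sector (i : ℕ) (s t : ℝ) :
    proj (sideAngle n i) (s * vtx n i + t * vtx n (i + 1)) = (s + t) * Real.cos (Real.pi / n) := by
  rw [proj_add, proj_ofReal_mul, proj_ofReal_mul, proj_side_vtx_self, proj_side_vtx_succ]
  ring

theorem closure_stdPolygon_subset {z : ℂ} (hz : z ∈ closure (stdPolygon n)) :
    ∀ j < n, proj (sideAngle n j) z ≤ Real.cos (Real.pi / n) := by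
  intro j hj
  have hc : IsClosed {z | proj (sideAngle n j) z ≤ Real.cos (Real.pi / n)} :=
    isClosed_le (continuous_proj _) continuous_const
  exact closure_minimal (fun w hw => (hw j hj).le) hc hz

theorem vtx_eq_exp (n : ℕ) (j : ℕ) :
    Complex.exp (2 * Real.pi * Complex.I * j / n) = vtx n j := by
  rw [vtx, cis]
  congr 1
  push_cast
  ring

/-- An interior point of the hull can be moved a little along an outer normal, so its inequalities
are strict. Conversely, a point of a sector satisfying the inequality of that sector's side is a
convex combination of two vertices and the centre. -/
theorem regularPolygon_std (hn : 3 ≤ n) : regularPolygon n 0 1 = stdPolygon n := by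
  have hset : (Set.range fun j : Fin n =>
      (0 : ℂ) + 1 * Complex.exp (2 * Real.pi * Complex.I * (j : ℕ) / n)) =
      Set.range fun j : Fin n => vtx n j := by
    congr 1
    ext j
    rw [zero_add, one_mul, vtx_eq_exp]
  rw [regularPolygon, hset]
  set V := Set.range fun j : Fin n => vtx n j with hV
  have hmem : ∀ j, vtx n j ∈ convexHull ℝ V := fun j => by
    rw [← vtx_mod hn]
    exact subset_convexHull ℝ V ⟨⟨j % n, Nat.mod_lt _ (by omega)⟩, rfl⟩
  apply Subset.antisymm
  · intro z hz j hj
    have h1 : convexHull ℝ V ⊆ {z | proj (sideAngle n j) z ≤ Real.cos (Real.pi / n)} := by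
      refine convexHull_min ?_ ?_
      · rintro _ ⟨i, rfl⟩
        exact proj_side_vtx_le hn i.2 hj
      · refine convex_halfSpace_le ⟨fun z w => proj_add _ z w, fun a z => ?_⟩ _
        rw [Complex.real_smul, proj_ofReal_mul, smul_eq_mul]
    have h2 := interior_mono h1 hz
    by_contra hcon
    have heq : proj (sideAngle n j) z = Real.cos (Real.pi / n) :=
      le_antisymm (h1 (interior_subset hz)) (not_lt.1 hcon)
    have h3 : ∀ᶠ e : ℝ in 𝓝[>] 0, proj (sideAngle n j) (z + e * cis (sideAngle n j)) ≤
        Real.cos (Real.pi / n) := by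
      have hcont : Tendsto (fun e : ℝ => z + (e : ℂ) * cis (sideAngle n j)) (𝓝[>] 0) (𝓝 z) := by
        refine Tendsto.mono_left ?_ nhdsWithin_le_nhds
        exact Continuous.tendsto' (by fun_prop) _ _ (by simp)
      exact (hcont.eventually (mem_interior_iff_mem_nhds.1 h2))
    obtain ⟨e, he, he0⟩ := (h3.and (eventually_mem_nhdsWithin (a := (0 : ℝ)) (s := Ioi 0))).exists
    rw [proj_add, proj_ofReal_mul, proj_cis, sub_self, Real.cos_zero, heq] at he
    have he0' : 0 < e := he0
    linarith
  · refine interior_maximal ?_ (isOpen_stdPolygon n)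
    intro z hz
    obtain ⟨j, hj, s, t, hs, ht, rfl⟩ := exists_sector hn z
    have h1 := hz j hj
    rw [proj_side_sector] at h1
    have h2 : s + t < 1 := by
      have := cos_angle_pos hn
      by_contra hcon
      nlinarith
    -- The centre is the mean of the vertices, because the `n`-th roots of unity sum up to zero.
    have h0 : (0 : ℂ) ∈ convexHull ℝ V := by
      have hsum : ∑ j ∈ Finset.range n, vtx n j = 0 := by
        have hp := Complex.isPrimitiveRoot_exp n (by omega)
        have h := hp.geom_sum_eq_zero (by omega)
        rw [← h]
        refine Finset.sum_congr rfl fun j _ => ?_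
        rw [← vtx_eq_exp, ← Complex.exp_nat_mul]
        congr 1
        ring
      have hc := (convex_convexHull ℝ V).sum_mem (t := Finset.range n) (w := fun _ => (1 / n : ℝ))
        (z := fun j => vtx n j) (fun _ _ => by positivity) ?_ fun j _ => hmem j
      · rwa [← Finset.smul_sum, hsum, smul_zero] at hc
      · rw [Finset.sum_const, Finset.card_range, nsmul_eq_mul]
        have : (n : ℝ) ≠ 0 := by exact_mod_cast (by omega : n ≠ 0)
        field_simp
    have hc := (convex_convexHull ℝ V).sum_mem (t := Finset.univ)
      (w := ![s, t, 1 - s - t]) (z := ![vtx n j, vtx n (j + 1), 0]) ?_ ?_ ?_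
    · simpa [Fin.sum_univ_three] using hc
    · intro i _
      fin_cases i
      · exact hs
      · exact ht
      · show 0 ≤ 1 - s - t
        linarith
    · simp [Fin.sum_univ_three]
    · intro i _
      fin_cases i
      · exact hmem j
      · exact hmem (j + 1)
      · exact h0

theorem exists_of_mem_frontier_stdPolygon (hn : 3 ≤ n) {z : ℂ} (hz : z ∈ frontier (stdPolygon n)) :
    ∃ j < n, ∃ t ∈ Icc (0 : ℝ) 1, z = vtx n j + t * (vtx n (j + 1) - vtx n j) := by
  obtain ⟨j, hj, s, t, hs, ht, rfl⟩ := exists_sector hn z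
  rw [(isOpen_stdPolygon n).frontier_eq] at hz
  have h1 := closure_stdPolygon_subset hz.1 j hj
  rw [proj_side_sector] at h1
  have hc := cos_angle_pos hn
  have h2 : s + t ≤ 1 := by
    by_contra hcon
    nlinarith
  have h3 : s + t = 1 := by
    by_contra hcon
    exact hz.2 (mem_stdPolygon_of_sector hn hs ht (lt_of_le_of_ne h2 hcon))
  refine ⟨j, hj, t, ⟨ht, by linarith⟩, ?_⟩
  have : s = 1 - t := by linarith
  rw [this]
  push_cast
  ring

/-! ### The boundary curve of the polygon and its chords -/

/-- The line through the `j`-th side of the regular polygon, with unit parameter length of the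
sides. -/
def sideLine (n j : ℕ) (x : ℝ) : ℂ := vtx n j + (x - j : ℝ) * (vtx n (j + 1) - vtx n j)

/-- The boundary curve of the regular polygon. -/
def polyCurve (n : ℕ) (x : ℝ) : ℂ := sideLine n ⌊x⌋₊ x

theorem vtx_succ_sub (n j : ℕ) : vtx n (j + 1) - vtx n j =
    (2 * Real.sin (Real.pi / n) : ℝ) * (Complex.I * cis (sideAngle n j)) := by
  have e1 : vtx n (j + 1) = cis (sideAngle n j + Real.pi / n) := by
    rw [vtx, sideAngle]; congr 1; push_cast; ring
  have e2 : vtx n j = cis (sideAngle n j - Real.pi / n) := by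
    rw [vtx, sideAngle]; congr 1; ring
  rw [e1, e2]
  apply Complex.ext
  · rw [Complex.re_ofReal_mul, Complex.sub_re, cis_re, cis_re, Complex.I_mul_re, cis_im,
      Real.cos_add, Real.cos_sub]
    ring
  · rw [Complex.im_ofReal_mul, Complex.sub_im, cis_im, cis_im, Complex.I_mul_im, cis_re,
      Real.sin_add, Real.sin_sub]
    ring

theorem norm_vtx_succ_sub (hn : 3 ≤ n) (j : ℕ) :
    ‖vtx n (j + 1) - vtx n j‖ = 2 * Real.sin (Real.pi / n) := by
  have := sin_angle_pos hn
  rw [vtx_succ_sub, norm_mul, norm_mul, norm_cis, Complex.norm_I, Complex.norm_real,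
    Real.norm_eq_abs, abs_of_pos (by positivity)]
  ring

theorem hasDerivAt_sideLine (n j : ℕ) (x : ℝ) :
    HasDerivAt (sideLine n j) (vtx n (j + 1) - vtx n j) x := by
  have h1 : HasDerivAt (fun y : ℝ => ((y - j : ℝ) : ℂ)) ((1 : ℝ) : ℂ) x :=
    ((hasDerivAt_id x).sub_const (j : ℝ)).ofReal_comp
  have := (h1.mul_const (vtx n (j + 1) - vtx n j)).const_add (vtx n j)
  rw [Complex.ofReal_one, one_mul] at this
  exact this

theorem sideLine_self (n j : ℕ) : sideLine n j j = vtx n j := by simp [sideLine]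

theorem proj_sideLine (n j : ℕ) (x : ℝ) :
    proj (sideAngle n j) (sideLine n j x) = Real.cos (Real.pi / n) := by
  rw [sideLine, proj_add, proj_ofReal_mul, proj_sub, proj_side_vtx_self, proj_side_vtx_succ]
  ring

theorem isBoundaryCurve_stdPolygon (hn : 3 ≤ n) :
    IsBoundaryCurve (stdPolygon n) (polyCurve n) n (2 * Real.sin (Real.pi / n))
      (range fun j : Fin n => vtx n j) := by
  have hsin := sin_angle_pos hn
  refine ⟨isOpen_stdPolygon n, by positivity, ?_, ?_, ?_, finite_range _, ?_⟩
  · have h1 : Measurable fun x : ℝ => ⌊x⌋₊ := Nat.measurable_floor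
    have h2 : ∀ f : ℕ → ℂ, Measurable fun x : ℝ => f ⌊x⌋₊ := fun f =>
      (measurable_of_countable f).comp h1
    have h3 : Measurable fun x : ℝ => ((x - ⌊x⌋₊ : ℝ) : ℂ) :=
      Complex.measurable_ofReal.comp (measurable_id.sub
        ((measurable_of_countable fun j : ℕ => (j : ℝ)).comp h1))
    exact (h2 (vtx n)).add (h3.mul (h2 fun j => vtx n (j + 1) - vtx n j))
  · intro z hz
    obtain ⟨j, hj, t, ht, rfl⟩ := exists_of_mem_frontier_stdPolygon hn hz
    have hvtx : ∀ i < n, vtx n i ∈ polyCurve n '' Ico 0 (n : ℝ) := by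
      intro i hi
      refine ⟨i, ⟨by positivity, by exact_mod_cast hi⟩, ?_⟩
      rw [polyCurve, Nat.floor_natCast, sideLine_self]
    rcases ht.2.lt_or_eq with h1 | rfl
    · have hfl : ⌊(j : ℝ) + t⌋₊ = j := by
        rw [Nat.floor_eq_iff (by linarith [ht.1, Nat.cast_nonneg (α := ℝ) j])]
        constructor <;> linarith [ht.1]
      refine ⟨j + t, ⟨by linarith [ht.1, Nat.cast_nonneg (α := ℝ) j], ?_⟩, ?_⟩
      · have : (j : ℝ) + 1 ≤ n := by exact_mod_cast hj
        linarith
      · rw [polyCurve, hfl, sideLine, add_sub_cancel_left]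
    · have e : vtx n j + ((1 : ℝ) : ℂ) * (vtx n (j + 1) - vtx n j) = vtx n ((j + 1) % n) := by
        rw [vtx_mod hn]; push_cast; ring
      rw [e]
      exact hvtx _ (Nat.mod_lt _ (by omega))
  · intro N hN
    have hsub : polyCurve n '' N ⊆ ⋃ j : ℕ, sideLine n j '' N := by
      rintro _ ⟨x, hx, rfl⟩
      exact mem_iUnion.2 ⟨⌊x⌋₊, x, hx, rfl⟩
    refine measure_mono_null hsub (measure_iUnion_null fun j => ?_)
    have hLip : LipschitzWith ‖vtx n (j + 1) - vtx n j‖₊ (sideLine n j) :=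
      lipschitzWith_of_nnnorm_deriv_le (fun x => (hasDerivAt_sideLine n j x).differentiableAt)
        fun x => by rw [(hasDerivAt_sideLine n j x).deriv]
    have := hLip.hausdorffMeasure_image_le zero_le_one N
    rw [hausdorffMeasure_real, hN, mul_zero] at this
    exact le_antisymm this zero_le
  · intro s hs hsB
    set j := ⌊s⌋₊ with hj
    have hjs : (j : ℝ) ≤ s := Nat.floor_le hs.1
    have hsj : s < j + 1 := Nat.lt_floor_add_one s
    have hjn : j < n := by
      have : (j : ℝ) < n := hjs.trans_lt hs.2
      exact_mod_cast this
    have hne : (j : ℝ) ≠ s := by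
      intro he
      refine hsB ⟨⟨j, hjn⟩, ?_⟩
      rw [polyCurve, ← hj, ← he, sideLine_self]
    have hlt : (j : ℝ) < s := lt_of_le_of_ne hjs hne
    refine ⟨vtx n (j + 1) - vtx n j, norm_vtx_succ_sub hn j, ?_, fun z hz => ?_⟩
    · refine (hasDerivAt_sideLine n j s).congr_of_eventuallyEq ?_
      filter_upwards [isOpen_Ioo.mem_nhds (show s ∈ Ioo (j : ℝ) (j + 1) from ⟨hlt, hsj⟩)] with x hx
      have : ⌊x⌋₊ = j := by
        rw [Nat.floor_eq_iff (by linarith [hx.1, Nat.cast_nonneg (α := ℝ) j])]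
        exact ⟨hx.1.le, hx.2⟩
      rw [polyCurve, this]
    · have e : (z - polyCurve n s) / (vtx n (j + 1) - vtx n j) =
          ((-(2 * Real.sin (Real.pi / n))⁻¹ : ℝ) : ℂ) *
            (((z - polyCurve n s) / cis (sideAngle n j)) * Complex.I) := by
        rw [vtx_succ_sub]
        have h1 := cis_ne_zero (sideAngle n j)
        have h2 : ((2 * Real.sin (Real.pi / n) : ℝ) : ℂ) ≠ 0 := by
          exact_mod_cast (by positivity : 2 * Real.sin (Real.pi / n) ≠ 0)
        rw [Complex.ofReal_neg, Complex.ofReal_inv]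
        field_simp
        rw [Complex.I_sq]
        ring
      rw [e, Complex.im_ofReal_mul, Complex.mul_I_im, ← proj_eq_re, proj_sub, polyCurve, ← hj,
        proj_sideLine]
      have h3 := hz j hjn
      have h4 : 0 < (2 * Real.sin (Real.pi / n))⁻¹ := by positivity
      nlinarith

/-- The function `min d (n - d) ℓ` is affine between integers. -/
theorem min_le_interpolation {n l a : ℕ} (hl : 2 * l ≤ n) (ha : a + 1 ≤ n) (e : ℝ) :
    min (min (a + e) (n - (a + e))) (l : ℝ) ≤
      (1 - e) * min (min (a : ℝ) (n - a)) l + e * min (min ((a + 1 : ℕ) : ℝ) (n - (a + 1 : ℕ))) l := by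
  have hl' : 2 * (l : ℝ) ≤ n := by exact_mod_cast hl
  have ha' : (a : ℝ) + 1 ≤ n := by exact_mod_cast ha
  push_cast
  -- Because `2 * l ≤ n`, the only kinks are at the integers `l` and `n - l`; the possible kink at
  -- `n / 2` is hidden by the plateau unless all three points coincide.
  rcases Nat.lt_or_ge a l with h1 | h1
  · have h1' : (a : ℝ) + 1 ≤ l := by exact_mod_cast h1
    rw [min_eq_left (show (a : ℝ) ≤ n - a by linarith), min_eq_left (show (a : ℝ) ≤ l by linarith),
      min_eq_left (show (a : ℝ) + 1 ≤ n - (a + 1) by linarith), min_eq_left h1']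
    calc _ ≤ (a : ℝ) + e := (min_le_left _ _).trans (min_le_left _ _)
      _ = _ := by ring
  · have h1' : (l : ℝ) ≤ a := by exact_mod_cast h1
    rcases Nat.lt_or_ge a (n - l) with h2 | h2
    · have h2' : (a : ℝ) + 1 + l ≤ n := by
        have : a + 1 + l ≤ n := by omega
        exact_mod_cast this
      have e1 : min (min (a : ℝ) (n - a)) l = l :=
        min_eq_right (le_min (by linarith) (by linarith))
      have e2 : min (min ((a : ℝ) + 1) (n - (a + 1))) l = l :=
        min_eq_right (le_min (by linarith) (by linarith))
      rw [e1, e2]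
      calc _ ≤ (l : ℝ) := min_le_right _ _
        _ = _ := by ring
    · have h2' : (n : ℝ) ≤ a + l := by
        have : n ≤ a + l := by omega
        exact_mod_cast this
      rw [min_eq_right (show (n : ℝ) - a ≤ a by linarith),
        min_eq_left (show (n : ℝ) - a ≤ l by linarith),
        min_eq_right (show (n : ℝ) - (a + 1) ≤ a + 1 by linarith),
        min_eq_left (show (n : ℝ) - (a + 1) ≤ l by linarith)]
      calc _ ≤ (n : ℝ) - (a + e) := (min_le_left _ _).trans (min_le_right _ _)
        _ = _ := by ring

/-- The right-hand side is the distance between the midpoints of two sides `a` steps apart, which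
lie on a circle of radius `cos (π / n)`; for `a = l` the two outer factors on the left give exactly
this distance divided by `l`. -/
theorem mul_min_le_chord (hn : 3 ≤ n) {l : ℕ} (hl : 0 < l) (hln : 2 * l ≤ n) {a : ℕ} (ha : a ≤ n) :
    2 * Real.sin (l * (Real.pi / n)) * Real.cos (Real.pi / n) / l * min (min (a : ℝ) (n - a)) l ≤
      2 * Real.sin (a * (Real.pi / n)) * Real.cos (Real.pi / n) := by
  have hx := angle_pos hn
  have hnx := mul_angle hn
  have hc := cos_angle_pos hn
  set x := Real.pi / n with hxdef
  have hl' : (0 : ℝ) < l := by exact_mod_cast hl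
  have hln' : 2 * (l : ℝ) ≤ n := by exact_mod_cast hln
  have ha' : (a : ℝ) ≤ n := by exact_mod_cast ha
  have h1 := sin_mul_min_le (θ := l * x) (x := a * x) (by positivity) (by nlinarith)
    (by positivity) (by nlinarith)
  have e : min (min ((a : ℝ) * x) (Real.pi - a * x)) (l * x) =
      x * min (min (a : ℝ) (n - a)) l := by
    rw [mul_min_of_nonneg _ _ hx.le, mul_min_of_nonneg _ _ hx.le, ← hnx]
    congr 1
    · congr 1 <;> ring
    · ring
  rw [e] at h1
  have h2 : Real.sin (l * x) * min (min (a : ℝ) (n - a)) l ≤ l * Real.sin (a * x) := by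
    by_contra hcon
    push Not at hcon
    nlinarith
  rw [div_mul_eq_mul_div, div_le_iff₀ hl']
  nlinarith

/-- The chord is bounded below by its projection orthogonal to the bisector of the normals of the
two sides. With `y - x = m + e` this projection depends only on `m` and `e` and is affine in `e`: at
`e = 0` it is a distance between midpoints, at `e = ±1` one between vertices. Only `y - x < n` is
required, so the interval may pass the parameter `n`. -/
theorem chord_stdPolygon (hn : 3 ≤ n) {l : ℕ} (hl : 0 < l) (hln : 2 * l ≤ n) {x y : ℝ} (hx0 : 0 ≤ x)
    (hxy : x ≤ y) (hyn : y - x < n) :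
    2 * Real.sin (l * (Real.pi / n)) * Real.cos (Real.pi / n) / l *
        min (min (y - x) (n - (y - x))) l ≤ ‖polyCurve n y - polyCurve n x‖ := by
  have hα := angle_pos hn
  have hnα := mul_angle hn
  have hc := cos_angle_pos hn
  have hc1 := Real.cos_le_one (Real.pi / n)
  set α := Real.pi / n with hαdef
  set i := ⌊x⌋₊ with hi
  set j := ⌊y⌋₊ with hj
  have hij : i ≤ j := Nat.floor_le_floor hxy
  have hix : (i : ℝ) ≤ x := Nat.floor_le hx0
  have hxi : x < i + 1 := Nat.lt_floor_add_one x
  have hjy : (j : ℝ) ≤ y := Nat.floor_le (hx0.trans hxy)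
  have hyj : y < j + 1 := Nat.lt_floor_add_one y
  obtain ⟨m, hjm⟩ : ∃ m, j = i + m := ⟨j - i, by omega⟩
  have hjc : (j : ℝ) = i + m := by rw [hjm]; push_cast; ring
  rw [hjc] at hjy hyj
  set e := (y - (i + m)) - (x - i) with he
  have hd : y - x = m + e := by rw [he]; ring
  have hmn : m ≤ n := by
    have : (m : ℝ) < n + 1 := by linarith
    exact_mod_cast Nat.lt_succ_iff.1 (by exact_mod_cast this)
  have hm0 : (0 : ℝ) ≤ m := Nat.cast_nonneg m
  refine le_trans ?_ (proj_le_norm ((2 * i + m + 1) * α + Real.pi / 2) _)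
  have hproj : ∀ q : ℕ, proj ((2 * i + m + 1) * α + Real.pi / 2) (vtx n q) =
      Real.sin ((2 * (q : ℝ) - 2 * i - m - 1) * α) := by
    intro q
    rw [vtx, proj_cis, ← hαdef, ← Real.cos_sub_pi_div_two]
    congr 1
    ring
  have hval : proj ((2 * i + m + 1) * α + Real.pi / 2) (polyCurve n y - polyCurve n x) =
      (1 - e) * Real.sin ((m - 1) * α) + (1 + e) * Real.sin ((m + 1) * α) := by
    rw [polyCurve, polyCurve, ← hj, ← hi, sideLine, sideLine, proj_sub, proj_add, proj_add,
      proj_ofReal_mul, proj_ofReal_mul, proj_sub, proj_sub, hproj, hproj, hproj, hproj]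
    push_cast
    rw [hjc]
    have e1 : (2 * ((i : ℝ) + m) - 2 * i - m - 1) * α = (m - 1) * α := by ring
    have e2 : (2 * ((i : ℝ) + m + 1) - 2 * i - m - 1) * α = (m + 1) * α := by ring
    have e3 : (2 * (i : ℝ) - 2 * i - m - 1) * α = -((m + 1) * α) := by ring
    have e4 : (2 * ((i : ℝ) + 1) - 2 * i - m - 1) * α = -((m - 1) * α) := by ring
    rw [e1, e2, e3, e4, Real.sin_neg, Real.sin_neg, he]
    ring
  rw [hval, hd]
  have hsum : Real.sin ((m - 1) * α) + Real.sin ((m + 1) * α) =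
      2 * Real.sin (m * α) * Real.cos α := by
    rw [sub_mul, add_mul, one_mul, Real.sin_sub, Real.sin_add]; ring
  set C := 2 * Real.sin (l * α) * Real.cos α / l with hC
  have hl' : (0 : ℝ) < l := by exact_mod_cast hl
  have hln' : 2 * (l : ℝ) ≤ n := by exact_mod_cast hln
  have hC0 : 0 ≤ C := by
    have : 0 ≤ Real.sin (l * α) :=
      Real.sin_nonneg_of_nonneg_of_le_pi (by positivity) (by nlinarith)
    positivity
  -- A chord between vertices exceeds the corresponding one between midpoints, by the factor `1 /
  -- cos α`.
  have hvert : ∀ a : ℕ, a ≤ n → C * min (min (a : ℝ) (n - a)) l ≤ 2 * Real.sin (a * α) := by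
    intro a ha
    have ha' : (a : ℝ) ≤ n := by exact_mod_cast ha
    have h1 := mul_min_le_chord hn hl hln ha
    have h2 : 0 ≤ Real.sin (a * α) :=
      Real.sin_nonneg_of_nonneg_of_le_pi (by positivity) (by nlinarith)
    refine h1.trans ?_
    rw [← hαdef]
    nlinarith
  have hm := mul_min_le_chord hn hl hln hmn
  rw [← hαdef, ← hC] at hm
  -- For `e ≥ 0` interpolate between `m` and `m + 1`, for `e < 0` between `m - 1` and `m`.
  rcases le_or_gt 0 e with h0 | h0
  · have he1 : e ≤ 1 := by rw [he]; linarith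
    have hmn' : m + 1 ≤ n := by
      have : (m : ℝ) < n := by linarith
      exact_mod_cast this
    have h1 := min_le_interpolation hln hmn' e
    have h2 := hvert (m + 1) (by omega)
    have h3 := mul_le_mul_of_nonneg_left h1 hC0
    have h4 := mul_le_mul_of_nonneg_left hm (show 0 ≤ 1 - e by linarith)
    have h5 := mul_le_mul_of_nonneg_left h2 h0
    push_cast at h3 h5
    rw [← hsum] at h4
    linarith
  · have he1 : -1 ≤ e := by rw [he]; linarith
    have hm1 : 1 ≤ m := by
      by_contra hcon
      have : m = 0 := by omega
      rw [this] at hd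
      simp at hd
      linarith
    obtain ⟨a, rfl⟩ : ∃ a, m = a + 1 := ⟨m - 1, by omega⟩
    have h1 := min_le_interpolation hln (show a + 1 ≤ n by omega) (1 + e)
    have h2 := hvert a (by omega)
    have h3 := mul_le_mul_of_nonneg_left h1 hC0
    have h4 := mul_le_mul_of_nonneg_left hm (show 0 ≤ 1 + e by linarith)
    have h5 := mul_le_mul_of_nonneg_left h2 (show 0 ≤ -e by linarith)
    rw [← hsum] at h4
    have e6 : (a : ℝ) + (1 + e) = (a + 1 : ℕ) + e := by push_cast; ring
    have e7 : (((a + 1 : ℕ) : ℝ) - 1) * α = a * α := by push_cast; ring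
    rw [e6] at h3
    rw [e7] at h4 ⊢
    linarith

theorem le_escobarConstant_stdPolygon {r : WithTop ℕ∞} (hr : 1 ≤ r) (hn : 3 ≤ n) {k l : ℕ}
    (hkl : n = l * k) :
    ENNReal.ofReal (Real.sin (Real.pi / k) * Real.cot (Real.pi / n) * k / n) ≤
      escobarConstant r k (stdPolygon n) := by
  have hk0 : k ≠ 0 := by rintro rfl; omega
  have hl0 : 0 < l := by
    rcases Nat.eq_zero_or_pos l with rfl | h
    · omega
    · exact h
  rcases Nat.lt_or_ge k 2 with hk1 | hk
  · have : k = 1 := by omega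
    subst this
    simp
  have hk' : (2 : ℝ) ≤ k := by exact_mod_cast hk
  have hl' : (0 : ℝ) < l := by exact_mod_cast hl0
  have hn' : (n : ℝ) = l * k := by exact_mod_cast hkl
  have hsin := sin_angle_pos hn
  have hcos := cos_angle_pos hn
  have hπ := Real.pi_pos
  have hθ : Real.pi / k = l * (Real.pi / n) := by
    rw [hn']; field_simp
  have hs : 0 < Real.sin (Real.pi / k) := by
    refine Real.sin_pos_of_pos_of_lt_pi (by positivity) ?_
    rw [div_lt_iff₀ (by linarith)]
    nlinarith
  have hcot : 0 < Real.cot (Real.pi / n) := by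
    rw [Real.cot_eq_cos_div_sin]; positivity
  have hnpos : (0 : ℝ) < n := by rw [hn']; positivity
  refine le_escobarConstant hr hk (isBoundaryCurve_stdPolygon hn) hnpos (by positivity)
    fun x y hx hxy hy => ?_
  have h1 := chord_stdPolygon hn hl0 (by rw [hkl]; nlinarith) hx hxy (by linarith)
  have e1 : (n : ℝ) / k = l := by rw [hn']; field_simp
  rw [e1]
  refine le_trans (le_of_eq ?_) h1
  rw [← hθ]
  congr 1
  rw [Real.cot_eq_cos_div_sin]
  have e2 : (k : ℝ) / n = 1 / l := by rw [hn']; field_simp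
  rw [mul_div_assoc, e2]
  field_simp

/-! ### Invariance under similarities -/

/-- The similarity `z ↦ c + w z` of the plane. -/
def similarity (c w : ℂ) (hw : w ≠ 0) : ℂ ≃ₜ ℂ :=
  (Homeomorph.mulLeft₀ w hw).trans (Homeomorph.addLeft c)

theorem similarity_apply (c w : ℂ) (hw : w ≠ 0) (z : ℂ) : similarity c w hw z = c + w * z := rfl

open scoped Pointwise in
theorem hausdorff_similarity (c w : ℂ) (hw : w ≠ 0) (S : Set ℂ) :
    μH[1] (similarity c w hw '' S) = ‖w‖ₑ * μH[1] S := by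
  have e : similarity c w hw '' S = IsometryEquiv.addLeft c '' (w • S) := by
    rw [← image_smul, image_image]
    rfl
  rw [e, IsometryEquiv.hausdorffMeasure_image, Measure.hausdorffMeasure_smul₀ zero_le_one hw,
    NNReal.rpow_one]
  rfl

theorem IsRegularArc.image_similarity {r : WithTop ℕ∞} {γ : ℝ → ℂ} (h : IsRegularArc r γ) (hr : 1 ≤ r)
    (c w : ℂ) (hw : w ≠ 0) : IsRegularArc r fun t => similarity c w hw (γ t) := by
  simp only [similarity_apply]
  refine ⟨contDiffOn_const.add (contDiffOn_const.mul h.contDiffOn), fun t ht => ?_, ?_⟩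
  · have h1 : HasDerivWithinAt γ (vel γ t) (Icc 0 1) t := (h.of_le hr).hasDerivWithinAt ht
    have h2 := (h1.const_mul w).const_add c
    rw [h2.derivWithin ((uniqueDiffOn_Icc one_pos) t ht)]
    exact mul_ne_zero hw (h.deriv_ne_zero t ht)
  · intro s hs t ht hst
    exact h.injOn hs ht (mul_left_cancel₀ hw (add_left_cancel hst))

theorem IsAdmissible.image_similarity {r : WithTop ℕ∞} {M Ω : Set ℂ} (h : IsAdmissible r M Ω)
    (hr : 1 ≤ r) (c w : ℂ) (hw : w ≠ 0) :
    IsAdmissible r (similarity c w hw '' M) (similarity c w hw '' Ω) := by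
  refine ⟨h.nonempty.image _, (similarity c w hw).isOpenMap _ h.isOpen, image_mono h.subset, ?_⟩
  obtain ⟨m, γ, h1, h2, h3⟩ := h.boundary
  refine ⟨m, fun i t => similarity c w hw (γ i t), fun i => (h1 i).image_similarity hr c w hw,
    fun i j hij => ?_, ?_⟩
  · have := (disjoint_image_iff (similarity c w hw).injective).2 (h2 i j hij)
    rwa [image_image, image_image] at this
  · rw [← Homeomorph.image_frontier, h3, image_iUnion]
    simp only [image_image]

theorem ratio_similarity (M Ω : Set ℂ) (c w : ℂ) (hw : w ≠ 0) :
    ratio (similarity c w hw '' M) (similarity c w hw '' Ω) = ratio M Ω := by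
  have hinj := (similarity c w hw).injective
  have h0 : ‖w‖ₑ ≠ 0 := by simpa using hw
  have h1 : interiorLength (similarity c w hw '' M) (similarity c w hw '' Ω) =
      ‖w‖ₑ * interiorLength M Ω := by
    rw [interiorLength, ← Homeomorph.image_frontier, ← image_inter hinj, hausdorff_similarity]
    rfl
  have h2 : exteriorLength (similarity c w hw '' M) (similarity c w hw '' Ω) =
      ‖w‖ₑ * exteriorLength M Ω := by
    rw [exteriorLength, ← Homeomorph.image_frontier, ← Homeomorph.image_frontier,
      ← image_inter hinj, hausdorff_similarity]
    rfl
  unfold ratio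
  rw [h1, h2]
  simp only [mul_eq_zero, h0, false_or]
  rw [ENNReal.mul_div_mul_left _ _ h0 (by simp)]

/-- One inequality suffices: the inverse map is again a similarity and yields the other. -/
theorem escobarConstant_similarity_le {r : WithTop ℕ∞} (hr : 1 ≤ r) (k : ℕ) (M : Set ℂ) (c w : ℂ)
    (hw : w ≠ 0) : escobarConstant r k (similarity c w hw '' M) ≤ escobarConstant r k M := by
  refine le_iInf₂ fun Ω hΩ => ?_
  have hdisj : Pairwise fun i j => Disjoint (similarity c w hw '' Ω i) (similarity c w hw '' Ω j) :=
    fun i j hij => (disjoint_image_iff (similarity c w hw).injective).2 (hΩ.2 hij)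
  refine (iInf₂_le (fun i => similarity c w hw '' Ω i)
    ⟨fun i => (hΩ.1 i).image_similarity hr c w hw, hdisj⟩).trans ?_
  simp only [ratio_similarity]
  exact le_rfl

theorem escobarConstant_similarity {r : WithTop ℕ∞} (hr : 1 ≤ r) (k : ℕ) (M : Set ℂ) (c w : ℂ)
    (hw : w ≠ 0) : escobarConstant r k (similarity c w hw '' M) = escobarConstant r k M := by
  refine le_antisymm (escobarConstant_similarity_le hr k M c w hw) ?_
  have h := escobarConstant_similarity_le hr k (similarity c w hw '' M) (-(w⁻¹ * c)) w⁻¹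
    (inv_ne_zero hw)
  have e : similarity (-(w⁻¹ * c)) w⁻¹ (inv_ne_zero hw) '' (similarity c w hw '' M) = M := by
    rw [image_image]
    have : (fun z => similarity (-(w⁻¹ * c)) w⁻¹ (inv_ne_zero hw) (similarity c w hw z)) = id := by
      ext z
      simp only [similarity_apply, id]
      field_simp
      ring
    rw [this, image_id]
  rwa [e] at h

theorem regularPolygon_eq_similarity (n : ℕ) (c w : ℂ) (hw : w ≠ 0) :
    regularPolygon n c w = similarity c w hw '' regularPolygon n 0 1 := by
  rw [regularPolygon, regularPolygon, Homeomorph.image_interior]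
  congr 1
  set f : ℂ →ᵃ[ℝ] ℂ := (LinearMap.mulLeft ℝ w).toAffineMap + AffineMap.const ℝ ℂ c with hf
  have hfe : ∀ z, similarity c w hw z = f z := by
    intro z
    simp [hf, similarity_apply, add_comm]
  have e : similarity c w hw = (f : ℂ → ℂ) := funext hfe
  rw [e, AffineMap.image_convexHull]
  congr 1
  rw [← range_comp]
  congr 1
  ext j
  simp only [Function.comp, ← hfe, similarity_apply, zero_add, one_mul]

/-! ### Convex polygons have piecewise smooth boundary -/

theorem isPiecewiseSmooth_of_finite {r : WithTop ℕ∞} {S : Set ℂ} {κ : Type*} [Finite κ]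
    {γ : κ → ℝ → ℂ} (h1 : ∀ i, IsRegularArc r (γ i))
    (h2 : ∀ i j, i ≠ j → Disjoint (γ i '' Ioo 0 1) (γ j '' Icc 0 1))
    (h3 : S = ⋃ i, γ i '' Icc 0 1) : IsPiecewiseSmooth r S := by
  obtain ⟨m, ⟨e⟩⟩ := Finite.exists_equiv_fin κ
  refine ⟨m, fun i => γ (e.symm i), fun i => h1 _, fun i j hij => h2 _ _ fun h =>
    hij (e.symm.injective h), ?_⟩
  rw [h3]
  exact (e.symm.surjective.iUnion_comp fun i => γ i '' Icc 0 1).symm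

/-- The frontier of an open convex set has no isolated points. -/
theorem exists_mem_frontier_ne {S : Set ℂ} (hS : IsOpen S) (hc : Convex ℝ S) {q : ℂ}
    (hq : q ∈ frontier S) {ε : ℝ} (hε : 0 < ε) : ∃ z ∈ frontier S, z ≠ q ∧ ‖z - q‖ < ε := by
  by_contra hcon
  push Not at hcon
  set R : Set ℂ := (fun x : ℝ × ℝ => q + x.1 * cis x.2) '' (Ioo 0 ε ×ˢ univ) with hR
  have hRpre : IsPreconnected R := by
    refine (isPreconnected_Ioo.prod isPreconnected_univ).image _ (Continuous.continuousOn ?_)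
    have := continuous_cis
    fun_prop
  have hRd : ∀ z ∈ R, z ∉ frontier S := by
    rintro z ⟨⟨ρ, θ⟩, ⟨hρ, -⟩, rfl⟩ hz
    have hρ0 : 0 < ρ := hρ.1
    have hn : ‖q + (ρ : ℂ) * cis θ - q‖ = ρ := by
      simp [norm_cis, abs_of_pos hρ0]
    have := hcon _ hz (fun he => ?_)
    · rw [hn] at this
      exact absurd hρ.2 (not_lt.2 this)
    · have he' : q + (ρ : ℂ) * cis θ = q := he
      rw [he', sub_self, norm_zero] at hn
      linarith
  have hRmem : ∀ z, z ≠ q → ‖z - q‖ < ε → z ∈ R := by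
    intro z hz hzε
    obtain ⟨φ, -, hφ⟩ := exists_cis (z - q)
    refine ⟨(‖z - q‖, φ), ⟨⟨norm_pos_iff.2 (sub_ne_zero.2 hz), hzε⟩, mem_univ _⟩, ?_⟩
    simp only
    rw [← hφ]
    ring
  rw [hS.frontier_eq] at hq
  -- If `q` were isolated in the frontier, a punctured disk around it would lie inside `S`, putting
  -- `q` in `S` as a midpoint, or outside `S`, keeping `q` from the closure.
  rcases subset_or_disjoint_of_preconnected hRpre hS hRd with h | h
  · have h1 : q + (ε / 2 : ℝ) ∈ S := h (hRmem _ (by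
      simp [hε.ne']) (by
      rw [add_sub_cancel_left, Complex.norm_real, Real.norm_eq_abs, abs_of_pos (by linarith)]
      linarith))
    have h2 : q - (ε / 2 : ℝ) ∈ S := h (hRmem _ (by
      simp [hε.ne']) (by
      rw [sub_sub_cancel_left, norm_neg, Complex.norm_real, Real.norm_eq_abs,
        abs_of_pos (by linarith)]
      linarith))
    have h3 := hc h1 h2 (show (0 : ℝ) ≤ 1 / 2 by norm_num) (show (0 : ℝ) ≤ 1 / 2 by norm_num)
      (by norm_num)
    refine hq.2 ?_
    convert h3 using 1
    simp only [Complex.real_smul]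
    push_cast
    ring
  · obtain ⟨z, hz, hzq⟩ := Metric.mem_closure_iff.1 hq.1 ε hε
    rw [dist_comm, dist_eq_norm] at hzq
    exact h z (hRmem z (fun he => hq.2 (he ▸ hz)) hzq) hz

/-- The point with coordinates `c`, `t` in the orthonormal frame of angle `β`. -/
def linePoint (β c t : ℝ) : ℂ := c * cis β + t * (Complex.I * cis β)

theorem proj_I_mul_cis (β β' : ℝ) : proj β' (Complex.I * cis β) = -Real.sin (β - β') := by
  rw [proj, Complex.I_mul_re, Complex.I_mul_im, cis_re, cis_im, Real.sin_sub]
  ring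

theorem proj_linePoint (β β' c t : ℝ) :
    proj β' (linePoint β c t) = c * Real.cos (β - β') - t * Real.sin (β - β') := by
  rw [linePoint, proj_add, proj_ofReal_mul, proj_ofReal_mul, proj_cis, proj_I_mul_cis]
  ring

theorem exists_linePoint (β : ℝ) (z : ℂ) : ∃ t, z = linePoint β (proj β z) t := by
  refine ⟨z.im * Real.cos β - z.re * Real.sin β, ?_⟩
  have h := Real.sin_sq_add_cos_sq β
  apply Complex.ext
  · simp only [linePoint, proj, Complex.add_re, Complex.re_ofReal_mul, Complex.I_mul_re, cis_re,
      cis_im]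
    linear_combination (-z.re) * h
  · simp only [linePoint, proj, Complex.add_im, Complex.im_ofReal_mul, Complex.I_mul_im, cis_re,
      cis_im]
    linear_combination (-z.im) * h

theorem linePoint_injective (β c : ℝ) : Function.Injective (linePoint β c) := by
  intro s t h
  have h1 : ((s - t : ℝ) : ℂ) * (Complex.I * cis β) = 0 := by
    push_cast
    simp only [linePoint] at h
    linear_combination h
  have h2 := (mul_eq_zero.1 h1).resolve_right (mul_ne_zero Complex.I_ne_zero (cis_ne_zero β))
  have : s - t = 0 := by exact_mod_cast h2
  linarith

theorem continuous_linePoint (β c : ℝ) : Continuous (linePoint β c) := by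
  unfold linePoint
  fun_prop

theorem isRegularArc_linePoint (r : WithTop ℕ∞) (β c : ℝ) {a b : ℝ} (hab : a < b) :
    IsRegularArc r fun t => linePoint β c (a + t * (b - a)) := by
  refine ⟨?_, fun t ht => ?_, ?_⟩
  · unfold linePoint
    refine ContDiff.contDiffOn (contDiff_const.add (ContDiff.mul ?_ contDiff_const))
    exact Complex.ofRealCLM.contDiff.comp
      (contDiff_const.add (contDiff_id.mul contDiff_const))
  · have h1 : HasDerivAt (fun t : ℝ => ((a + t * (b - a) : ℝ) : ℂ)) ((b - a : ℝ) : ℂ) t := by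
      have := (((hasDerivAt_id t).mul_const (b - a)).const_add a).ofReal_comp
      simpa using this
    have h2 := (h1.mul_const (Complex.I * cis β)).const_add (c * cis β)
    have h3 := h2.hasDerivWithinAt.derivWithin ((uniqueDiffOn_Icc (one_pos (α := ℝ))) t ht)
    have h4 : derivWithin (fun t => linePoint β c (a + t * (b - a))) (Icc 0 1) t =
      ((b - a : ℝ) : ℂ) * (Complex.I * cis β) := h3
    rw [h4]
    refine mul_ne_zero ?_ (mul_ne_zero Complex.I_ne_zero (cis_ne_zero β))
    exact_mod_cast (sub_pos.2 hab).ne'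
  · intro s _ t _ h
    have h1 := linePoint_injective β c h
    have h2 : s * (b - a) = t * (b - a) := by linarith
    exact mul_right_cancel₀ (sub_pos.2 hab).ne' h2

theorem convex_proj_lt (β c : ℝ) : Convex ℝ {z | proj β z < c} :=
  convex_halfSpace_lt ⟨fun z w => proj_add _ z w, fun a z => by
    rw [Complex.real_smul, proj_ofReal_mul, smul_eq_mul]⟩ _

theorem convex_proj_eq (β c : ℝ) : Convex ℝ {z | proj β z = c} :=
  convex_hyperplane ⟨fun z w => proj_add _ z w, fun a z => by
    rw [Complex.real_smul, proj_ofReal_mul, smul_eq_mul]⟩ _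

/-- A bounded open convex polygon, given by finitely many half planes, has a piecewise smooth
boundary. -/
theorem isPiecewiseSmooth_frontier_polygon (r : WithTop ℕ∞) {ι : Type*} [Finite ι] {β c : ι → ℝ}
    {S : Set ℂ} (hS : S = {z | ∀ i, proj (β i) z < c i}) (hbdd : Bornology.IsBounded S) :
    IsPiecewiseSmooth r (frontier S) := by
  have hopen : IsOpen S := by
    have : S = ⋂ i, {z | proj (β i) z < c i} := by rw [hS]; ext z; simp
    rw [this]
    exact isOpen_iInter_of_finite fun i => isOpen_lt (continuous_proj _) continuous_const
  have hconv : Convex ℝ S := by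
    have : S = ⋂ i, {z | proj (β i) z < c i} := by rw [hS]; ext z; simp
    rw [this]
    exact convex_iInter fun i => convex_proj_lt _ _
  have hcl : ∀ z ∈ closure S, ∀ i, proj (β i) z ≤ c i := by
    intro z hz i
    have hc : IsClosed {z | proj (β i) z ≤ c i} := isClosed_le (continuous_proj _) continuous_const
    refine closure_minimal (fun w hw => ?_) hc hz
    rw [hS] at hw
    exact (hw i).le
  have hcomp : IsCompact (closure S) := hbdd.isCompact_closure
  set F : ι → Set ℂ := fun i => closure S ∩ {z | proj (β i) z = c i} with hF
  have hFc : ∀ i, IsCompact (F i) := fun i =>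
    hcomp.inter_right (isClosed_eq (continuous_proj _) continuous_const)
  have hFconv : ∀ i, Convex ℝ (F i) := fun i => hconv.closure.inter (convex_proj_eq _ _)
  have hfr : frontier S = ⋃ i, F i := by
    rw [hopen.frontier_eq]
    ext z
    constructor
    · rintro ⟨h1, h2⟩
      by_contra hcon
      refine h2 ?_
      rw [hS]
      intro i
      refine lt_of_le_of_ne (hcl z h1 i) fun he => hcon (mem_iUnion.2 ⟨i, h1, he⟩)
    · intro hz
      obtain ⟨i, h1, h2⟩ := mem_iUnion.1 hz
      refine ⟨h1, fun h3 => ?_⟩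
      rw [hS] at h3
      have h2' : proj (β i) z = c i := h2
      exact absurd (h3 i) (by rw [h2']; exact lt_irrefl _)
  -- Faces that are empty or single points can be dropped: a point lying only on such faces would be
  -- isolated in the frontier.
  have hcover : frontier S ⊆ ⋃ i : {i // (F i).Nontrivial}, F i := by
    intro q hq
    by_contra hcon
    have hU : IsClosed (⋃ i : {i // (F i).Nontrivial}, F i) :=
      isClosed_iUnion_of_finite fun i => (hFc i).isClosed
    have hD : (⋃ i : {i // ¬(F i).Nontrivial}, F i).Finite :=
      finite_iUnion fun i => (not_nontrivial_iff.1 i.2).finite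
    have hD' : IsClosed ((⋃ i : {i // ¬(F i).Nontrivial}, F i) \ {q}) :=
      (hD.subset sdiff_subset).isClosed
    obtain ⟨ε, hε, hball⟩ := Metric.isOpen_iff.1 (hU.union hD').isOpen_compl q (by
      rintro (h | h)
      · exact hcon h
      · exact h.2 rfl)
    obtain ⟨z, hz, hzq, hzε⟩ := exists_mem_frontier_ne hopen hconv hq hε
    have hzn := hball (show z ∈ Metric.ball q ε by simpa [dist_eq_norm] using hzε)
    rw [hfr] at hz
    obtain ⟨i, hi⟩ := mem_iUnion.1 hz
    by_cases hnt : (F i).Nontrivial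
    · exact hzn (Or.inl (mem_iUnion.2 ⟨⟨i, hnt⟩, hi⟩))
    · exact hzn (Or.inr ⟨mem_iUnion.2 ⟨⟨i, hnt⟩, hi⟩, hzq⟩)
  have hparam : ∀ i, (F i).Nontrivial → ∃ a b : ℝ, a < b ∧
      ∀ t, linePoint (β i) (c i) t ∈ F i ↔ t ∈ Icc a b := by
    intro i hnt
    set A : Set ℝ := linePoint (β i) (c i) ⁻¹' F i with hA
    have himg : linePoint (β i) (c i) '' A = F i := by
      rw [image_preimage_eq_iff]
      intro z hz
      obtain ⟨t, ht⟩ := exists_linePoint (β i) z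
      have : proj (β i) z = c i := hz.2
      rw [this] at ht
      exact ⟨t, ht.symm⟩
    have hAnt : A.Nontrivial := by
      rw [← himg] at hnt
      exact nontrivial_of_image _ _ hnt
    have hAconv : Convex ℝ A := by
      intro s hs t ht x y hx hy hxy
      have h1 := hFconv i hs ht hx hy hxy
      have e : linePoint (β i) (c i) (x • s + y • t) =
          x • linePoint (β i) (c i) s + y • linePoint (β i) (c i) t := by
        simp only [linePoint, smul_eq_mul, Complex.real_smul]
        have hxy' : (x : ℂ) + y = 1 := by exact_mod_cast hxy
        push_cast
        linear_combination (-(c i * cis (β i) : ℂ)) * hxy'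
      show linePoint (β i) (c i) (x • s + y • t) ∈ F i
      rw [e]
      exact h1
    have hAclosed : IsClosed A := (hFc i).isClosed.preimage (continuous_linePoint _ _)
    have hAbdd : Bornology.IsBounded A := by
      obtain ⟨R, hR⟩ := (hFc i).isBounded.exists_norm_le
      refine (Metric.isBounded_iff_subset_closedBall 0).2 ⟨R, fun t ht => ?_⟩
      have h1 := hR _ ht
      rw [mem_closedBall_zero_iff, Real.norm_eq_abs]
      have h2 := proj_le_norm (β i + Real.pi / 2) (linePoint (β i) (c i) t)
      have h3 := proj_le_norm (β i - Real.pi / 2) (linePoint (β i) (c i) t)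
      rw [proj_linePoint, show β i - (β i + Real.pi / 2) = -(Real.pi / 2) by ring, Real.cos_neg,
        Real.sin_neg, Real.cos_pi_div_two, Real.sin_pi_div_two] at h2
      rw [proj_linePoint, show β i - (β i - Real.pi / 2) = Real.pi / 2 by ring,
        Real.cos_pi_div_two, Real.sin_pi_div_two] at h3
      rw [abs_le]
      constructor <;> linarith
    have hIcc := eq_Icc_of_connected_compact ⟨hAnt.nonempty, hAconv.isPreconnected⟩
      (Metric.isCompact_of_isClosed_isBounded hAclosed hAbdd)
    refine ⟨sInf A, sSup A, ?_, fun t => ?_⟩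
    · by_contra hle
      rw [hIcc] at hAnt
      obtain ⟨s, hs, t, ht, hst⟩ := hAnt
      exact hst (le_antisymm (by linarith [hs.2, ht.1]) (by linarith [hs.1, ht.2]))
    · rw [← hIcc]
      rfl
  -- The arcs are indexed by the faces as sets, since several half planes may define the same face.
  set κ := {G : Set ℂ // ∃ i, (F i).Nontrivial ∧ F i = G} with hκ
  have hfin : Finite κ := by
    have : {G : Set ℂ | ∃ i, (F i).Nontrivial ∧ F i = G} ⊆ range F := by
      rintro G ⟨i, -, rfl⟩
      exact ⟨i, rfl⟩
    exact ((finite_range F).subset this).to_subtype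
  choose idx hidx hidxe using fun G : κ => G.2
  choose a b hab hmem using fun G : κ => hparam (idx G) (hidx G)
  have hIoo : ∀ G : κ, ∀ t ∈ Icc (0 : ℝ) 1, a G + t * (b G - a G) ∈ Icc (a G) (b G) := by
    intro G t ht
    have := hab G
    constructor <;> nlinarith [ht.1, ht.2]
  have himage : ∀ G : κ,
      (fun t => linePoint (β (idx G)) (c (idx G)) (a G + t * (b G - a G))) '' Icc 0 1 = G := by
    intro G
    rw [← hidxe G]
    apply Subset.antisymm
    · rintro _ ⟨t, ht, rfl⟩
      exact (hmem G _).2 (hIoo G t ht)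
    · intro z hz
      obtain ⟨t, ht⟩ := exists_linePoint (β (idx G)) z
      have h1 : proj (β (idx G)) z = c (idx G) := hz.2
      rw [h1] at ht
      have h2 : t ∈ Icc (a G) (b G) := (hmem G t).1 (ht ▸ hz)
      have h3 := sub_pos.2 (hab G)
      refine ⟨(t - a G) / (b G - a G), ⟨div_nonneg (by linarith [h2.1]) h3.le, ?_⟩, ?_⟩
      · rw [div_le_one h3]; linarith [h2.2]
      · simp only
        rw [div_mul_cancel₀ _ h3.ne', add_sub_cancel, ht]
  refine isPiecewiseSmooth_of_finite (κ := κ)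
    (γ := fun G t => linePoint (β (idx G)) (c (idx G)) (a G + t * (b G - a G)))
    (fun G => isRegularArc_linePoint r _ _ (hab G)) (fun G H hGH => ?_) ?_
  · rw [himage H, ← hidxe H, Set.disjoint_left]
    rintro _ ⟨s, hs, rfl⟩ hz
    set i := idx G with hi
    set j := idx H with hj
    set u := a G + s * (b G - a G) with hu
    have hlt := hab G
    have hua : a G < u := by rw [hu]; nlinarith [hs.1]
    have hub : u < b G := by rw [hu]; nlinarith [hs.2]
    have hz2 : proj (β j) (linePoint (β i) (c i) u) = c j := hz.2
    rw [proj_linePoint] at hz2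
    have hend : ∀ t ∈ Icc (a G) (b G), c i * Real.cos (β i - β j) - t * Real.sin (β i - β j) ≤ c j := by
      intro t ht
      rw [← proj_linePoint]
      exact hcl _ ((hmem G t).2 ht).1 j
    have h1 := hend (a G) ⟨le_rfl, hlt.le⟩
    have h2 := hend (b G) ⟨hlt.le, le_rfl⟩
    -- An affine function bounded by `c j` on the face attains this bound at an inner point, so its
    -- slope is zero and the two lines coincide.
    have hsin : Real.sin (β i - β j) = 0 := by
      apply le_antisymm
      · by_contra hcon
        push Not at hcon
        nlinarith
      · by_contra hcon
        push Not at hcon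
        nlinarith
    have hcos : Real.cos (β i - β j) ^ 2 = 1 := by
      have := Real.sin_sq_add_cos_sq (β i - β j)
      rw [hsin] at this
      linarith
    have hcos0 : Real.cos (β i - β j) ≠ 0 := by
      intro h0
      rw [h0] at hcos
      norm_num at hcos
    rw [hsin, mul_zero, sub_zero] at hz2
    have hline : ∀ w, proj (β j) w = proj (β i) w * Real.cos (β i - β j) := by
      intro w
      obtain ⟨t, ht⟩ := exists_linePoint (β i) w
      conv_lhs => rw [ht]
      rw [proj_linePoint, hsin, mul_zero, sub_zero]
    refine hGH (Subtype.ext ?_)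
    rw [← hidxe G, ← hidxe H]
    ext w
    have : proj (β i) w = c i ↔ proj (β j) w = c j := by
      rw [hline, ← hz2]
      exact ⟨fun h => by rw [h], fun h => mul_right_cancel₀ hcos0 h⟩
    exact and_congr_right fun _ => this
  · apply Subset.antisymm
    · intro z hz
      obtain ⟨⟨i, hi⟩, hzi⟩ := mem_iUnion.1 (hcover hz)
      refine mem_iUnion.2 ⟨⟨F i, i, hi, rfl⟩, ?_⟩
      rw [himage]
      exact hzi
    · refine iUnion_subset fun G => ?_
      rw [himage, hfr, ← hidxe G]
      exact subset_iUnion F _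

/-! ### Convex pieces of the polygon and their boundary lengths -/

theorem proj_sideAngle_add_self (hn : 3 ≤ n) (j : ℕ) (z : ℂ) :
    proj (sideAngle n (j + n)) z = proj (sideAngle n j) z := by
  have : sideAngle n (j + n) = sideAngle n j + 2 * Real.pi := by
    rw [sideAngle, sideAngle]; push_cast; linear_combination 2 * mul_angle hn
  rw [this, proj, proj, Real.cos_add_two_pi, Real.sin_add_two_pi]

theorem proj_sideAngle_mod (hn : 3 ≤ n) (j : ℕ) (z : ℂ) :
    proj (sideAngle n (j % n)) z = proj (sideAngle n j) z := by
  have hper : Function.Periodic (fun j => proj (sideAngle n j) z) n := fun j =>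
    proj_sideAngle_add_self hn j z
  exact hper.map_mod_nat j

theorem proj_sideAngle_lt (hn : 3 ≤ n) {z : ℂ} (hz : z ∈ stdPolygon n) (j : ℕ) :
    proj (sideAngle n j) z < Real.cos (Real.pi / n) := by
  rw [← proj_sideAngle_mod hn]
  exact hz _ (Nat.mod_lt _ (by omega))

theorem isBounded_stdPolygon (hn : 3 ≤ n) : Bornology.IsBounded (stdPolygon n) := by
  refine (Metric.isBounded_iff_subset_closedBall 0).2 ⟨1, fun z hz => ?_⟩
  rw [mem_closedBall_zero_iff]
  obtain ⟨j, hj, s, t, hs, ht, rfl⟩ := exists_sector hn z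
  have h1 := hz j hj
  rw [proj_side_sector] at h1
  have h2 : s + t < 1 := by
    have := cos_angle_pos hn
    by_contra hcon
    nlinarith
  refine (norm_add_le _ _).trans ?_
  rw [norm_mul, norm_mul, vtx, vtx, norm_cis, norm_cis, Complex.norm_real, Complex.norm_real,
    Real.norm_eq_abs, Real.norm_eq_abs, abs_of_nonneg hs, abs_of_nonneg ht]
  linarith

theorem hausdorff_line_image (p q : ℂ) (A : Set ℝ) :
    μH[1] ((fun t : ℝ => p + t * q) '' A) = ‖q‖ₑ * volume A := by
  have e : (fun t : ℝ => p + t * q) '' A =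
      IsometryEquiv.addLeft p '' ((fun t : ℝ => t • q) '' A) := by
    rw [image_image]
    simp only [Complex.real_smul]
    rfl
  rw [e, IsometryEquiv.hausdorffMeasure_image, hausdorffMeasure_smul_right_image,
    hausdorffMeasure_real]
  rfl

theorem polyCurve_mem_frontier (hn : 3 ≤ n) {x : ℝ} (hx : 0 ≤ x) :
    polyCurve n x ∈ frontier (stdPolygon n) := by
  have h1 := Nat.floor_le hx
  have h2 := Nat.lt_floor_add_one x
  set i := ⌊x⌋₊ with hi
  have hc := cos_angle_pos hn
  have hle : ∀ j < n, proj (sideAngle n j) (polyCurve n x) ≤ Real.cos (Real.pi / n) := by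
    intro j hj
    rw [polyCurve, ← hi, sideLine, proj_add, proj_ofReal_mul, proj_sub]
    have h3 := proj_side_vtx_le' hn i hj
    have h4 := proj_side_vtx_le' hn (i + 1) hj
    nlinarith
  rw [(isOpen_stdPolygon n).frontier_eq]
  refine ⟨?_, fun hmem => ?_⟩
  · have hlim : Tendsto (fun e : ℝ => ((1 - e : ℝ) : ℂ) * polyCurve n x) (𝓝[>] 0)
        (𝓝 (polyCurve n x)) := by
      refine Tendsto.mono_left ?_ nhdsWithin_le_nhds
      exact Continuous.tendsto' (by fun_prop) _ _ (by simp)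
    refine mem_closure_of_tendsto hlim ?_
    filter_upwards [Ioo_mem_nhdsGT (show (0 : ℝ) < 1 by norm_num)] with e he j hj
    rw [proj_ofReal_mul]
    have := hle j hj
    nlinarith [he.1, he.2]
  · have := proj_sideAngle_lt hn hmem i
    rw [polyCurve, ← hi, proj_sideLine] at this
    exact lt_irrefl _ this

theorem injOn_polyCurve (hn : 3 ≤ n) {a : ℝ} (ha : 0 ≤ a) :
    InjOn (polyCurve n) (Ico a (a + n)) := by
  have key : ∀ x ∈ Ico a (a + n), ∀ y ∈ Ico a (a + n), x < y → polyCurve n x ≠ polyCurve n y := by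
    intro x hx y hy hxy he
    have h := chord_stdPolygon hn one_pos (by omega) (ha.trans hx.1) hxy.le
      (by linarith [hx.1, hy.2])
    rw [he, sub_self, norm_zero] at h
    have hs := sin_angle_pos hn
    have hc := cos_angle_pos hn
    have : 0 < min (min (y - x) (n - (y - x))) ((1 : ℕ) : ℝ) := by
      refine lt_min (lt_min (by linarith) (by linarith [hx.1, hy.2])) (by norm_num)
    rw [Nat.cast_one, one_mul, div_one] at h
    rw [Nat.cast_one] at this
    exact absurd h (not_le.2 (by positivity))
  intro x hx y hy he
  rcases lt_trichotomy x y with h | h | h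
  · exact absurd he (key x hx y hy h)
  · exact h
  · exact absurd he.symm (key y hy x hx h)

/-- The curve is injective on one period and affine on each unit interval, where lengths are
multiplied by the side length. The period may start anywhere, as required by caps that pass the
vertex `vtx n 0`. -/
theorem le_hausdorff_polyCurve (hn : 3 ≤ n) {a : ℝ} (ha : 0 ≤ a) {A : Set ℝ} (hA : MeasurableSet A)
    (hAsub : A ⊆ Ico a (a + n)) :
    ENNReal.ofReal (2 * Real.sin (Real.pi / n)) * volume A ≤ μH[1] (polyCurve n '' A) := by
  set B : ℕ → Set ℝ := fun i => A ∩ Ico (i : ℝ) (i + 1) with hB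
  have hBm : ∀ i, MeasurableSet (B i) := fun i => hA.inter measurableSet_Ico
  have hAB : A = ⋃ i, B i := by
    refine Subset.antisymm (fun x hx => ?_) (iUnion_subset fun i => inter_subset_left)
    exact mem_iUnion.2 ⟨⌊x⌋₊, hx, Nat.floor_le (ha.trans (hAsub hx).1), Nat.lt_floor_add_one x⟩
  have hBd : Pairwise (Function.onFun Disjoint B) := by
    intro i j hij
    rw [Function.onFun, Set.disjoint_left]
    rintro x ⟨-, hx⟩ ⟨-, hx'⟩
    have h1 : (i : ℝ) < j + 1 := hx.1.trans_lt hx'.2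
    have h2 : (j : ℝ) < i + 1 := hx'.1.trans_lt hx.2
    have h1' : i < j + 1 := by exact_mod_cast h1
    have h2' : j < i + 1 := by exact_mod_cast h2
    omega
  have himg : ∀ i, polyCurve n '' B i =
      (fun t : ℝ => (vtx n i - i * (vtx n (i + 1) - vtx n i)) + t * (vtx n (i + 1) - vtx n i)) ''
        B i := by
    intro i
    refine image_congr fun x hx => ?_
    have hfl : ⌊x⌋₊ = i := by
      rw [Nat.floor_eq_iff ((Nat.cast_nonneg i).trans hx.2.1)]
      exact hx.2
    rw [polyCurve, hfl, sideLine]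
    push_cast
    ring
  have hinj : InjOn (polyCurve n) A := (injOn_polyCurve hn ha).mono hAsub
  have hmeas : ∀ i, MeasurableSet (polyCurve n '' B i) := by
    intro i
    rw [himg i]
    refine (hBm i).image_of_continuousOn_injOn (by fun_prop) ?_
    intro x _ y _ hxy
    have h0 : vtx n (i + 1) - vtx n i ≠ 0 := by
      rw [← norm_pos_iff, norm_vtx_succ_sub hn]
      have := sin_angle_pos hn
      positivity
    have := mul_right_cancel₀ h0 (add_left_cancel hxy)
    exact_mod_cast this
  have hd : Pairwise (Function.onFun Disjoint fun i => polyCurve n '' B i) := by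
    intro i j hij
    rw [Function.onFun, Set.disjoint_left]
    rintro _ ⟨x, hx, rfl⟩ ⟨y, hy, hxy⟩
    exact Set.disjoint_left.1 (hBd hij) hx (hinj hy.1 hx.1 hxy ▸ hy)
  rw [hAB, image_iUnion, measure_iUnion hBd hBm, measure_iUnion hd hmeas, ← ENNReal.tsum_mul_left]
  refine ENNReal.tsum_le_tsum fun i => le_of_eq ?_
  rw [himg i, hausdorff_line_image, ← ofReal_norm, norm_vtx_succ_sub hn]

theorem isOpen_forall_proj_lt {κ : Type*} [Finite κ] (β c : κ → ℝ) :
    IsOpen {z | ∀ i, proj (β i) z < c i} := by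
  have : {z | ∀ i, proj (β i) z < c i} = ⋂ i, {z | proj (β i) z < c i} := by ext z; simp
  rw [this]
  exact isOpen_iInter_of_finite fun i => isOpen_lt (continuous_proj _) continuous_const

/-- Near a point of the open set `H`, the sets `M` and `M ∩ H` coincide. This gives the exterior
boundary of a piece from below without computing its whole frontier. -/
theorem frontier_inter_subset {M H : Set ℂ} (hM : IsOpen M) (hH : IsOpen H) :
    frontier M ∩ H ⊆ frontier (M ∩ H) ∩ frontier M := by
  rintro z ⟨hz, hzH⟩
  refine ⟨?_, hz⟩
  rw [hM.frontier_eq] at hz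
  rw [(hM.inter hH).frontier_eq]
  refine ⟨?_, fun h => hz.2 h.1⟩
  rw [inter_comm]
  exact hH.inter_closure ⟨hzH, hz.1⟩

theorem isAdmissible_stdPolygon_inter (r : WithTop ℕ∞) (hn : 3 ≤ n) {κ : Type*} [Finite κ]
    {β c : κ → ℝ} {x : ℝ} (hx : 0 ≤ x) (hxH : ∀ i, proj (β i) (polyCurve n x) < c i) :
    IsAdmissible r (stdPolygon n) (stdPolygon n ∩ {z | ∀ i, proj (β i) z < c i}) := by
  have hH := isOpen_forall_proj_lt β c
  refine ⟨?_, (isOpen_stdPolygon n).inter hH, inter_subset_left, ?_⟩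
  · have := frontier_inter_subset (isOpen_stdPolygon n) hH ⟨polyCurve_mem_frontier hn hx, hxH⟩
    exact closure_nonempty_iff.1 ⟨_, frontier_subset_closure this.1⟩
  · refine isPiecewiseSmooth_frontier_polygon r (ι := Fin n ⊕ κ)
      (β := Sum.elim (fun j => sideAngle n j) β)
      (c := Sum.elim (fun _ => Real.cos (Real.pi / n)) c) ?_
      ((isBounded_stdPolygon hn).subset inter_subset_left)
    ext z
    refine ⟨fun h i => ?_, fun h => ⟨fun j hj => h (Sum.inl ⟨j, hj⟩), fun i => h (Sum.inr i)⟩⟩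
    rcases i with j | i
    · exact h.1 j j.2
    · exact h.2 i

theorem le_exteriorLength_stdPolygon_inter (hn : 3 ≤ n) {κ : Type*} [Finite κ] {β c : κ → ℝ}
    {a : ℝ} (ha : 0 ≤ a) {A : Set ℝ} (hA : MeasurableSet A) (hAsub : A ⊆ Ico a (a + n))
    (hAH : ∀ x ∈ A, ∀ i, proj (β i) (polyCurve n x) < c i) :
    ENNReal.ofReal (2 * Real.sin (Real.pi / n)) * volume A ≤
      exteriorLength (stdPolygon n) (stdPolygon n ∩ {z | ∀ i, proj (β i) z < c i}) := by
  refine (le_hausdorff_polyCurve hn ha hA hAsub).trans (measure_mono ?_)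
  rintro _ ⟨x, hx, rfl⟩
  exact frontier_inter_subset (isOpen_stdPolygon n) (isOpen_forall_proj_lt β c)
    ⟨polyCurve_mem_frontier hn (ha.trans (hAsub hx).1), hAH x hx⟩

theorem hausdorff_inter_line_le {M : Set ℂ} {β c u v : ℝ}
    (h : ∀ t, linePoint β c t ∈ M → t ∈ Icc u v) :
    μH[1] (M ∩ {z | proj β z = c}) ≤ ENNReal.ofReal (v - u) := by
  have hsub : M ∩ {z | proj β z = c} ⊆
      (fun t : ℝ => (c * cis β : ℂ) + t * (Complex.I * cis β)) '' Icc u v := by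
    rintro z ⟨hz, hzc⟩
    obtain ⟨t, ht⟩ := exists_linePoint β z
    have hzc' : proj β z = c := hzc
    rw [hzc'] at ht
    exact ⟨t, h t (ht ▸ hz), ht.symm⟩
  refine (measure_mono hsub).trans ?_
  rw [hausdorff_line_image, Real.volume_Icc, ← ofReal_norm, norm_mul, norm_cis,
    Complex.norm_I, mul_one, ENNReal.ofReal_one, one_mul]

theorem interiorLength_inter_le {M : Set ℂ} (hM : IsOpen M) {κ : Type*} [Fintype κ] {β c : κ → ℝ} :
    interiorLength M (M ∩ {z | ∀ i, proj (β i) z < c i}) ≤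
      ∑ i, μH[1] (M ∩ {z | proj (β i) z = c i}) := by
  have hsub : frontier (M ∩ {z | ∀ i, proj (β i) z < c i}) ∩ M ⊆
      ⋃ i, M ∩ {z | proj (β i) z = c i} := by
    rintro z ⟨hz, hzM⟩
    by_contra hcon
    have hle : ∀ i, proj (β i) z ≤ c i := by
      intro i
      have hc : IsClosed {z | proj (β i) z ≤ c i} :=
        isClosed_le (continuous_proj _) continuous_const
      exact closure_minimal (fun w hw => (hw.2 i).le) hc (frontier_subset_closure hz)
    have hlt : z ∈ {z | ∀ i, proj (β i) z < c i} := fun i =>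
      lt_of_le_of_ne (hle i) fun he => hcon (mem_iUnion.2 ⟨i, hzM, he⟩)
    rw [(hM.inter (isOpen_forall_proj_lt β c)).frontier_eq] at hz
    exact hz.2 ⟨hzM, hlt⟩
  refine (measure_mono hsub).trans ((measure_iUnion_le _).trans_eq ?_)
  exact tsum_fintype _

theorem ratio_le_ofReal {M Ω : Set ℂ} {a b : ℝ} (hb : 0 < b)
    (hinteg : interiorLength M Ω ≤ ENNReal.ofReal a) (hext : ENNReal.ofReal b ≤ exteriorLength M Ω) :
    ratio M Ω ≤ ENNReal.ofReal (a / b) := by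
  have h0 : exteriorLength M Ω ≠ 0 := fun h => by
    rw [h] at hext
    exact absurd hext (not_le.2 (ENNReal.ofReal_pos.2 hb))
  rw [ratio, if_neg h0, ENNReal.ofReal_div_of_pos hb]
  exact ENNReal.div_le_div hinteg hext

/-! ### Trapezoids at a vertex -/

theorem polyCurve_of_mem_Ico (n : ℕ) {v : ℕ} {x : ℝ} (hx : x ∈ Ico (v : ℝ) (v + 1)) :
    polyCurve n x = vtx n v + (x - v : ℝ) * (vtx n (v + 1) - vtx n v) := by
  have hfl : ⌊x⌋₊ = v := by
    rw [Nat.floor_eq_iff ((Nat.cast_nonneg v).trans hx.1)]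
    exact hx
  rw [polyCurve, hfl, sideLine]

theorem proj_add_pi (β : ℝ) (z : ℂ) : proj (β + Real.pi) z = -proj β z := by
  rw [proj, proj, Real.cos_add_pi, Real.sin_add_pi]
  ring

/-- The line is orthogonal to the bisector at the vertex of angle `α` and, for `0 ≤ s ≤ 1`, meets
the two adjacent sides at the fraction `s` of their length; these two sides bound the width. -/
theorem mem_Icc_of_linePoint_mem (hn : 3 ≤ n) {α s t : ℝ} {i j : ℕ}
    (hi : sideAngle n i = α + Real.pi / n) (hj : sideAngle n j = α - Real.pi / n)
    (h : linePoint α (1 - s * (2 * Real.sin (Real.pi / n) ^ 2)) t ∈ stdPolygon n) :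
    t ∈ Icc (-(s * (2 * Real.sin (Real.pi / n) * Real.cos (Real.pi / n))))
      (s * (2 * Real.sin (Real.pi / n) * Real.cos (Real.pi / n))) := by
  have hs := sin_angle_pos hn
  have h1 := proj_sideAngle_lt hn h i
  have h2 := proj_sideAngle_lt hn h j
  rw [hi, proj_linePoint, show α - (α + Real.pi / n) = -(Real.pi / n) by ring, Real.cos_neg,
    Real.sin_neg] at h1
  rw [hj, proj_linePoint, show α - (α - Real.pi / n) = Real.pi / n by ring] at h2
  set S := Real.sin (Real.pi / n)
  set C := Real.cos (Real.pi / n)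
  constructor
  · by_contra hcon
    push Not at hcon
    nlinarith
  · by_contra hcon
    push Not at hcon
    nlinarith

theorem linePoint_add_pi (α c t : ℝ) : linePoint (α + Real.pi) (-c) t = linePoint α c (-t) := by
  have : cis (α + Real.pi) = -cis α := by
    apply Complex.ext <;> simp [cis_re, cis_im, Real.cos_add_pi, Real.sin_add_pi]
  rw [linePoint, linePoint, this]
  push_cast
  ring

/-- The part of the corner at the vertex `vtx n 1` between two lines orthogonal to the bisector. -/
def trapezoid (n : ℕ) (a b : ℝ) : Set ℂ :=
  stdPolygon n ∩ {z | ∀ i : Fin 2, proj (![2 * (Real.pi / n), 2 * (Real.pi / n) + Real.pi] i) z <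
    ![1 - a * (2 * Real.sin (Real.pi / n) ^ 2), -(1 - b * (2 * Real.sin (Real.pi / n) ^ 2))] i}

theorem polyCurve_mem_trapezoid (hn : 3 ≤ n) {a b : ℝ} (ha : 0 < a) (hb : b ≤ 1) {x : ℝ}
    (hx : x ∈ Ioo (1 - b) (1 - a) ∪ Ioo (1 + a) (1 + b)) (i : Fin 2) :
    proj (![2 * (Real.pi / n), 2 * (Real.pi / n) + Real.pi] i) (polyCurve n x) <
    ![1 - a * (2 * Real.sin (Real.pi / n) ^ 2), -(1 - b * (2 * Real.sin (Real.pi / n) ^ 2))] i := by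
  have hs := sin_angle_pos hn
  have hv : ∀ q : ℕ, proj (2 * (Real.pi / n)) (vtx n q) =
      Real.cos (2 * ((q : ℝ) - 1) * (Real.pi / n)) := by
    intro q
    rw [vtx, proj_cis]
    congr 1
    ring
  have hcos : Real.cos (2 * (Real.pi / n)) = 1 - 2 * Real.sin (Real.pi / n) ^ 2 := by
    rw [Real.cos_two_mul, Real.cos_sq']
    ring
  have h0 : proj (2 * (Real.pi / n)) (vtx n 0) = 1 - 2 * Real.sin (Real.pi / n) ^ 2 := by
    rw [hv, ← hcos, ← Real.cos_neg]
    congr 1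
    push_cast
    ring
  have h1 : proj (2 * (Real.pi / n)) (vtx n 1) = 1 := by
    rw [hv]
    simp
  have h2 : proj (2 * (Real.pi / n)) (vtx n 2) = 1 - 2 * Real.sin (Real.pi / n) ^ 2 := by
    rw [hv, ← hcos]
    congr 1
    push_cast
    ring
  -- The coordinate along the bisector falls linearly with the parameter distance `u` to the vertex.
  -- Working at `vtx n 1` rather than `vtx n 0` keeps all parameters nonnegative.
  obtain ⟨u, hu, hval⟩ : ∃ u ∈ Ioo a b, proj (2 * (Real.pi / n)) (polyCurve n x) =
      1 - u * (2 * Real.sin (Real.pi / n) ^ 2) := by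
    rcases hx with hx | hx
    · refine ⟨1 - x, ⟨by linarith [hx.2], by linarith [hx.1]⟩, ?_⟩
      rw [polyCurve_of_mem_Ico n (v := 0) ⟨by push_cast; linarith [hx.1],
        by push_cast; linarith [hx.2]⟩, proj_add, proj_ofReal_mul, proj_sub, zero_add, h0, h1]
      push_cast
      ring
    · refine ⟨x - 1, ⟨by linarith [hx.1], by linarith [hx.2]⟩, ?_⟩
      rw [polyCurve_of_mem_Ico n (v := 1) ⟨by push_cast; linarith [hx.1],
        by push_cast; linarith [hx.2]⟩, proj_add, proj_ofReal_mul, proj_sub, one_add_one_eq_two,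
        h1, h2]
      push_cast
      ring
  have hS : 0 < 2 * Real.sin (Real.pi / n) ^ 2 := by positivity
  fin_cases i
  · simp only [Fin.zero_eta, Matrix.cons_val_zero]
    rw [hval]
    nlinarith [hu.1]
  · simp only [Fin.mk_one, Matrix.cons_val_one, Matrix.cons_val_fin_one]
    rw [proj_add_pi, hval]
    nlinarith [hu.2]

theorem isAdmissible_trapezoid (r : WithTop ℕ∞) (hn : 3 ≤ n) {a b : ℝ} (ha : 0 < a) (hab : a < b)
    (hb : b ≤ 1) : IsAdmissible r (stdPolygon n) (trapezoid n a b) :=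
  isAdmissible_stdPolygon_inter r hn (x := 1 + (a + b) / 2) (by linarith)
    (polyCurve_mem_trapezoid hn ha hb (Or.inr ⟨by linarith, by linarith⟩))

theorem ratio_trapezoid_le (hn : 3 ≤ n) {a b : ℝ} (ha : 0 < a) (hab : a < b) (hb : b ≤ 1) :
    ratio (stdPolygon n) (trapezoid n a b) ≤
      ENNReal.ofReal (Real.cos (Real.pi / n) * ((a + b) / (b - a))) := by
  have hs := sin_angle_pos hn
  have hc := cos_angle_pos hn
  have hn' : (3 : ℝ) ≤ n := by exact_mod_cast hn
  set S := Real.sin (Real.pi / n) with hS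
  set C := Real.cos (Real.pi / n) with hC
  -- Numerator: the two parallel cuts. Denominator: two segments of parameter length `b - a` on
  -- sides of length `2 * S`.
  have e : C * ((a + b) / (b - a)) =
      (2 * (a * (2 * S * C)) + 2 * (b * (2 * S * C))) / (2 * S * (2 * (b - a))) := by
    have : b - a ≠ 0 := (sub_pos.2 hab).ne'
    field_simp
  rw [e]
  have hb0 : 0 < b := ha.trans hab
  have hba := sub_pos.2 hab
  have e1 : sideAngle n 1 = 2 * (Real.pi / n) + Real.pi / n := by rw [sideAngle]; push_cast; ring
  have e0 : sideAngle n 0 = 2 * (Real.pi / n) - Real.pi / n := by rw [sideAngle]; push_cast; ring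
  refine ratio_le_ofReal (by positivity) ?_ ?_
  · refine (interiorLength_inter_le (isOpen_stdPolygon n)).trans ?_
    rw [Fin.sum_univ_two, ENNReal.ofReal_add (by positivity) (by positivity)]
    simp only [Matrix.cons_val_zero, Matrix.cons_val_one, Matrix.cons_val_fin_one]
    refine add_le_add ?_ ?_
    · refine (hausdorff_inter_line_le fun t ht => mem_Icc_of_linePoint_mem hn e1 e0 ht).trans_eq ?_
      congr 1
      ring
    · refine (hausdorff_inter_line_le (u := -(b * (2 * S * C))) (v := b * (2 * S * C))
        fun t ht => ?_).trans_eq ?_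
      · rw [linePoint_add_pi] at ht
        have := mem_Icc_of_linePoint_mem hn e1 e0 ht
        exact ⟨by linarith [this.2], by linarith [this.1]⟩
      · congr 1
        ring
  · have hvol : volume (Ioo (1 - b) (1 - a) ∪ Ioo (1 + a) (1 + b)) =
        ENNReal.ofReal (2 * (b - a)) := by
      rw [measure_union _ measurableSet_Ioo, Real.volume_Ioo, Real.volume_Ioo,
        ← ENNReal.ofReal_add (by linarith) (by linarith)]
      · congr 1
        ring
      · rw [Set.disjoint_left]
        intro x hx hx'
        linarith [hx.2, hx'.1]
    rw [ENNReal.ofReal_mul (by positivity), ← hvol]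
    refine le_exteriorLength_stdPolygon_inter hn le_rfl (measurableSet_Ioo.union measurableSet_Ioo)
      ?_ fun x hx => polyCurve_mem_trapezoid hn ha hb hx
    rintro x (hx | hx)
    · exact ⟨by linarith [hx.1], by linarith [hx.2]⟩
    · exact ⟨by linarith [hx.1], by linarith [hx.2]⟩

theorem disjoint_trapezoid {a b a' b' : ℝ} (h : b' ≤ a) :
    Disjoint (trapezoid n a b) (trapezoid n a' b') := by
  rw [Set.disjoint_left]
  intro z hz hz'
  have h1 := hz.2 0
  have h2 := hz'.2 1
  simp only [Matrix.cons_val_zero, Matrix.cons_val_one, Matrix.cons_val_fin_one] at h1 h2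
  rw [proj_add_pi] at h2
  have : b' * (2 * Real.sin (Real.pi / n) ^ 2) ≤ a * (2 * Real.sin (Real.pi / n) ^ 2) := by gcongr
  linarith

/-- Trapezoids between the distances `ε ^ (j + 1)` and `ε ^ j` are similar to each other, so all `k`
of them have the same bound, which tends to `cos (π / n)` as `ε` tends to `0`. -/
theorem escobarConstant_stdPolygon_le_cos {r : WithTop ℕ∞} (hn : 3 ≤ n) (k : ℕ) :
    escobarConstant r k (stdPolygon n) ≤ ENNReal.ofReal (Real.cos (Real.pi / n)) := by
  have key : ∀ ε ∈ Ioo (0 : ℝ) 1, escobarConstant r k (stdPolygon n) ≤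
      ENNReal.ofReal (Real.cos (Real.pi / n) * ((ε + 1) / (1 - ε))) := by
    intro ε hε
    have hpos : ∀ j : ℕ, 0 < ε ^ j := fun j => pow_pos hε.1 j
    have hlt : ∀ j : ℕ, ε ^ (j + 1) < ε ^ j := fun j =>
      pow_lt_pow_right_of_lt_one₀ hε.1 hε.2 (Nat.lt_succ_self j)
    have hle : ∀ j : ℕ, ε ^ j ≤ 1 := fun j => pow_le_one₀ hε.1.le hε.2.le
    have hdisj : Pairwise fun i j : Fin k =>
        Disjoint (trapezoid n (ε ^ (i.1 + 1)) (ε ^ i.1))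
          (trapezoid n (ε ^ (j.1 + 1)) (ε ^ j.1)) := by
      intro i j hij
      rcases lt_or_gt_of_ne hij with h | h
      · exact disjoint_trapezoid (pow_le_pow_of_le_one hε.1.le hε.2.le h)
      · exact (disjoint_trapezoid (pow_le_pow_of_le_one hε.1.le hε.2.le h)).symm
    refine (iInf₂_le (fun j : Fin k => trapezoid n (ε ^ (j.1 + 1)) (ε ^ j.1))
      ⟨fun j => isAdmissible_trapezoid r hn (hpos _) (hlt _) (hle _), hdisj⟩).trans ?_
    refine iSup_le fun j => (ratio_trapezoid_le hn (hpos _) (hlt _) (hle _)).trans_eq ?_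
    have h1 : 1 - ε ≠ 0 := by linarith [hε.2]
    have h2 := (hpos j.1).ne'
    rw [pow_succ, show ε ^ j.1 * ε + ε ^ j.1 = ε ^ j.1 * (ε + 1) by ring,
      show ε ^ j.1 - ε ^ j.1 * ε = ε ^ j.1 * (1 - ε) by ring, mul_div_mul_left _ _ h2]
  have hlim : Tendsto (fun ε : ℝ => ENNReal.ofReal (Real.cos (Real.pi / n) * ((ε + 1) / (1 - ε))))
      (𝓝[>] 0) (𝓝 (ENNReal.ofReal (Real.cos (Real.pi / n)))) := by
    refine (ENNReal.continuous_ofReal.tendsto _).comp (Tendsto.mono_left ?_ nhdsWithin_le_nhds)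
    have hc : ContinuousAt (fun ε : ℝ => Real.cos (Real.pi / n) * ((ε + 1) / (1 - ε))) 0 :=
      continuousAt_const.mul ((continuousAt_id.add continuousAt_const).div
        (continuousAt_const.sub continuousAt_id) (by norm_num))
    have := hc.tendsto
    simpa using this
  refine ge_of_tendsto hlim ?_
  filter_upwards [Ioo_mem_nhdsGT (show (0 : ℝ) < 1 by norm_num)] with ε hε
  exact key ε hε

/-! ### Caps cut off through midpoints of sides -/

/-- The right-hand side is the height, along the axis of the cap, of a boundary point less than half
a side away from the vertex of angle `φ`. Vertices of the cap lie strictly above the cut, and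
midpoints of their sides lie above or on it. -/
theorem cos_mul_cos_lt {φ θ x s : ℝ} (hφ : |φ| ≤ θ - x) (hx : 0 < x)
    (hcos : 0 ≤ Real.cos x) (hθ : θ < Real.pi) (hs : 0 ≤ s) (hs' : s < 1 / 2) :
    Real.cos x * Real.cos θ < Real.cos φ + s * (Real.cos (φ + 2 * x) - Real.cos φ) := by
  have hφ' := abs_le.1 hφ
  have hθx : x ≤ θ := by linarith [abs_nonneg φ]
  have hsx : 0 < Real.sin x := Real.sin_pos_of_pos_of_lt_pi hx (by linarith)
  have hsθ : 0 < Real.sin θ := Real.sin_pos_of_pos_of_lt_pi (by linarith) hθ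
  have h1 : Real.cos (θ - x) ≤ Real.cos φ := by
    rw [← Real.cos_abs φ]
    exact Real.cos_le_cos_of_nonneg_of_le_pi (abs_nonneg _) (by linarith) hφ
  rw [Real.cos_sub] at h1
  have h2 : Real.cos θ ≤ Real.cos (φ + x) := by
    rw [← Real.cos_abs (φ + x)]
    refine Real.cos_le_cos_of_nonneg_of_le_pi (abs_nonneg _) hθ.le (abs_le.2 ⟨?_, ?_⟩) <;> linarith
  have h3 : Real.cos (φ + 2 * x) = 2 * (Real.cos x * Real.cos (φ + x)) - Real.cos φ := by
    have e1 : φ + 2 * x = φ + x + x := by ring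
    have e2 : φ = φ + x - x := by ring
    rw [e1, Real.cos_add (φ + x) x]
    conv_rhs => rw [e2, Real.cos_sub (φ + x) x, ← e2]
    ring
  have hcx : 0 < Real.sin θ * Real.sin x := mul_pos hsθ hsx
  have h4 : (1 - 2 * s) * (Real.cos x * Real.cos θ) < (1 - 2 * s) * Real.cos φ :=
    mul_lt_mul_of_pos_left (by linarith) (by linarith)
  have h5 : 2 * s * (Real.cos x * Real.cos θ) ≤ 2 * s * (Real.cos x * Real.cos (φ + x)) :=
    mul_le_mul_of_nonneg_left (mul_le_mul_of_nonneg_left h2 hcos) (by linarith)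
  rw [h3]
  linarith

/-- Two open sectors of half-angle `θ = π / k` whose axes differ by `2 * θ * d`, with `1 ≤ d < k`,
are disjoint. Sectors are expressed by signs of sines, so that no branch of the angle has to be
chosen in the hypotheses. -/
theorem not_sin_pos_of_rotated {θ ψ : ℝ} {k d : ℕ} (hk : 2 ≤ k) (hθ : k * θ = Real.pi)
    (hd : 1 ≤ d) (hdk : d + 1 ≤ k) (h1 : 0 < Real.sin (θ - ψ)) (h2 : 0 < Real.sin (θ + ψ))
    (h3 : 0 < Real.sin (θ - ψ + 2 * θ * d)) : ¬0 < Real.sin (θ + ψ - 2 * θ * d) := by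
  intro h4
  have hπ := Real.pi_pos
  have hk' : (2 : ℝ) ≤ k := by exact_mod_cast hk
  have hd' : (1 : ℝ) ≤ d := by exact_mod_cast hd
  have hdk' : (d : ℝ) + 1 ≤ k := by exact_mod_cast hdk
  have hθ0 : 0 < θ := by
    by_contra hcon
    nlinarith
  have hθ2 : θ ≤ Real.pi / 2 := by nlinarith
  have hθd : θ * d + θ ≤ Real.pi := by nlinarith
  have hθd1 : θ ≤ θ * d := by nlinarith
  obtain ⟨ψ', hψ', he⟩ := cis_periodic.exists_mem_Ioc Real.two_pi_pos ψ (-Real.pi)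
  have hcos : Real.cos ψ = Real.cos ψ' := by rw [← cis_re, he, cis_re]
  have hsin : Real.sin ψ = Real.sin ψ' := by rw [← cis_im, he, cis_im]
  have hsub : ∀ c, Real.sin (c - ψ) = Real.sin (c - ψ') := fun c => by
    rw [Real.sin_sub, Real.sin_sub, hcos, hsin]
  have hadd : ∀ c, Real.sin (c + ψ) = Real.sin (c + ψ') := fun c => by
    rw [Real.sin_add, Real.sin_add, hcos, hsin]
  rw [hsub] at h1
  rw [hadd] at h2
  rw [show θ - ψ + 2 * θ * d = θ + 2 * θ * d - ψ by ring, hsub] at h3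
  rw [show θ + ψ - 2 * θ * d = θ - 2 * θ * d + ψ by ring, hadd] at h4
  have hsθ : 0 < Real.sin θ := Real.sin_pos_of_pos_of_lt_pi hθ0 (by linarith)
  have hcψ : 0 < Real.cos ψ' := by
    rw [Real.sin_sub] at h1
    rw [Real.sin_add] at h2
    by_contra hcon
    nlinarith
  have hψ1 : ψ' < Real.pi / 2 := by
    by_contra hcon
    have := Real.cos_nonpos_of_pi_div_two_le_of_le (not_lt.1 hcon) (by linarith [hψ'.2])
    linarith
  have hψ2 : -(Real.pi / 2) < ψ' := by
    by_contra hcon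
    have := Real.cos_nonpos_of_pi_div_two_le_of_le (x := -ψ') (by linarith) (by linarith [hψ'.1])
    rw [Real.cos_neg] at this
    linarith
  have hψ3 : ψ' < θ := by
    by_contra hcon
    have := Real.sin_nonpos_of_nonpos_of_neg_pi_le (x := θ - ψ') (by linarith) (by linarith)
    linarith
  have hψ4 : -θ < ψ' := by
    by_contra hcon
    have := Real.sin_nonpos_of_nonpos_of_neg_pi_le (x := θ + ψ') (by linarith) (by linarith)
    linarith
  have h5 : θ + 2 * θ * d - ψ' < Real.pi := by
    by_contra hcon
    have := Real.sin_nonneg_of_nonneg_of_le_pi (x := θ + 2 * θ * d - ψ' - Real.pi) (by linarith)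
      (by linarith)
    rw [Real.sin_sub_pi] at this
    linarith
  have := Real.sin_nonpos_of_nonpos_of_neg_pi_le (x := θ - 2 * θ * d + ψ') (by linarith)
    (by linarith)
  linarith

/-- The angle of the symmetry axis of the cap containing the vertices `m, …, m + l - 1`. -/
def capAngle (n m l : ℕ) : ℝ := (2 * m + l - 1) * (Real.pi / n)

/-- The part of the regular polygon around the vertices `m, …, m + l - 1`, cut off by the line
through the midpoints of two sides. -/
def cap (n m l : ℕ) : Set ℂ :=
  stdPolygon n ∩ {z | ∀ _ : Fin 1, proj (capAngle n m l + Real.pi) z <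
    -(Real.cos (Real.pi / n) * Real.cos (l * (Real.pi / n)))}

theorem capAngle_add (n m l : ℕ) (hl : 0 < l) :
    sideAngle n (m + l - 1) = capAngle n m l + l * (Real.pi / n) := by
  obtain ⟨l, rfl⟩ : ∃ q, l = q + 1 := ⟨l - 1, by omega⟩
  rw [show m + (l + 1) - 1 = m + l by omega, sideAngle, capAngle]
  push_cast
  ring

theorem capAngle_sub (n m l : ℕ) (hm : 0 < m) :
    sideAngle n (m - 1) = capAngle n m l - l * (Real.pi / n) := by
  obtain ⟨m, rfl⟩ : ∃ q, m = q + 1 := ⟨m - 1, by omega⟩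
  rw [Nat.add_sub_cancel, sideAngle, capAngle]
  push_cast
  ring

theorem polyCurve_mem_cap (hn : 3 ≤ n) {m l : ℕ} (hm : 0 < m)
    (hln : l < n) {x : ℝ} (hx : x ∈ Ioo (m - 1 / 2 : ℝ) (m + l - 1 / 2))
    (hx' : ∀ v : ℕ, x ≠ v - 1 / 2) :
    proj (capAngle n m l + Real.pi) (polyCurve n x) <
      -(Real.cos (Real.pi / n) * Real.cos (l * (Real.pi / n))) := by
  rw [proj_add_pi, neg_lt_neg_iff]
  have hα := angle_pos hn
  have hnα := mul_angle hn
  have hm1 : (1 : ℝ) ≤ m := by exact_mod_cast hm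
  have hθ : l * (Real.pi / n) < Real.pi := by
    have : (l : ℝ) < n := by exact_mod_cast hln
    nlinarith
  -- The nearest vertex; midpoints of sides are excluded by `hx'`, which keeps the distance to it
  -- below `1 / 2`.
  set v := ⌊x + 1 / 2⌋₊ with hv
  have hv1 : (v : ℝ) ≤ x + 1 / 2 := Nat.floor_le (by linarith [hx.1])
  have hv2 : x + 1 / 2 < v + 1 := Nat.lt_floor_add_one _
  have hvm : m ≤ v := Nat.le_floor (by linarith [hx.1])
  have hvl : v + 1 ≤ m + l := by
    have : (v : ℝ) < m + l := by linarith [hx.2]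
    exact_mod_cast this
  have hvm' : (m : ℝ) ≤ v := by exact_mod_cast hvm
  have hvl' : (v : ℝ) + 1 ≤ m + l := by exact_mod_cast hvl
  have hvx : x ≠ v - 1 / 2 := hx' v
  have hproj : ∀ q : ℕ, proj (capAngle n m l) (vtx n q) =
      Real.cos ((2 * q - (2 * m + l - 1)) * (Real.pi / n)) := by
    intro q
    rw [vtx, proj_cis, capAngle]
    congr 1
    ring
  have habs : |(2 * v - (2 * m + l - 1)) * (Real.pi / n)| ≤
      l * (Real.pi / n) - Real.pi / n := by
    rw [abs_le]
    constructor <;> nlinarith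
  rcases le_or_gt (v : ℝ) x with h | h
  · rw [polyCurve_of_mem_Ico n ⟨h, by linarith⟩, proj_add, proj_ofReal_mul, proj_sub, hproj, hproj]
    refine (cos_mul_cos_lt habs hα (cos_angle_pos hn).le hθ (s := x - v) (by linarith) (by linarith)).trans_eq ?_
    congr 4
    push_cast
    ring
  · obtain ⟨q, hq⟩ : ∃ q, v = q + 1 := ⟨v - 1, by omega⟩
    have hq' : (v : ℝ) = q + 1 := by rw [hq]; push_cast; ring
    rw [polyCurve_of_mem_Ico n (v := q) ⟨by linarith, by linarith⟩, proj_add, proj_ofReal_mul,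
      proj_sub, ← hq, hproj, hproj]
    have hvx' : v - x < 1 / 2 := lt_of_le_of_ne (by linarith) fun he => hvx (by linarith)
    rw [← abs_neg] at habs
    refine (cos_mul_cos_lt habs hα (cos_angle_pos hn).le hθ (s := v - x) (by linarith) hvx').trans_eq ?_
    rw [Real.cos_neg, ← Real.cos_neg (-_ + _)]
    have e : -(-((2 * v - (2 * m + l - 1)) * (Real.pi / n)) + 2 * (Real.pi / n)) =
        (2 * q - (2 * m + l - 1)) * (Real.pi / n) := by
      rw [hq']
      ring
    rw [e, hq']
    ring

theorem isAdmissible_cap (r : WithTop ℕ∞) (hn : 3 ≤ n) {m l : ℕ} (hm : 0 < m) (hl : 0 < l)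
    (hln : l < n) : IsAdmissible r (stdPolygon n) (cap n m l) := by
  have hl' : (1 : ℝ) ≤ l := by exact_mod_cast hl
  have hm' : (1 : ℝ) ≤ m := by exact_mod_cast hm
  refine isAdmissible_stdPolygon_inter r hn (x := m) (by linarith)
    fun _ => polyCurve_mem_cap hn hm hln ⟨by linarith, by linarith⟩ fun v hv => ?_
  have h1 : (2 * m + 1 : ℝ) = 2 * v := by linarith
  have h2 : 2 * m + 1 = 2 * v := by exact_mod_cast h1
  omega

theorem ratio_cap_le (hn : 3 ≤ n) {m l : ℕ} (hm : 0 < m) (hl : 0 < l) (hln : l < n) :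
    ratio (stdPolygon n) (cap n m l) ≤ ENNReal.ofReal
      (2 * (Real.cos (Real.pi / n) * Real.sin (l * (Real.pi / n))) /
        (2 * Real.sin (Real.pi / n) * l)) := by
  have hs := sin_angle_pos hn
  have hα := angle_pos hn
  have hnα := mul_angle hn
  have hl' : (1 : ℝ) ≤ l := by exact_mod_cast hl
  have hm' : (1 : ℝ) ≤ m := by exact_mod_cast hm
  have hln' : (l : ℝ) < n := by exact_mod_cast hln
  have hsθ : 0 < Real.sin (l * (Real.pi / n)) :=
    Real.sin_pos_of_pos_of_lt_pi (by positivity) (by nlinarith)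
  refine ratio_le_ofReal (by positivity) ?_ ?_
  · refine (interiorLength_inter_le (isOpen_stdPolygon n)).trans ?_
    rw [Fin.sum_univ_one]
    refine (hausdorff_inter_line_le
      (u := -(Real.cos (Real.pi / n) * Real.sin (l * (Real.pi / n))))
      (v := Real.cos (Real.pi / n) * Real.sin (l * (Real.pi / n))) fun t ht => ?_).trans_eq ?_
    · rw [linePoint_add_pi] at ht
      have h1 := proj_sideAngle_lt hn ht (m + l - 1)
      have h2 := proj_sideAngle_lt hn ht (m - 1)
      rw [capAngle_add n m l hl, proj_linePoint, sub_add_cancel_left, Real.cos_neg,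
        Real.sin_neg] at h1
      rw [capAngle_sub n m l hm, proj_linePoint, sub_sub_cancel] at h2
      have h3 := Real.sin_sq_add_cos_sq (l * (Real.pi / n))
      set S := Real.sin (l * (Real.pi / n))
      set C := Real.cos (l * (Real.pi / n))
      set c := Real.cos (Real.pi / n)
      have h4 : c * C * C = c - c * S * S := by linear_combination c * h3
      constructor
      · by_contra hcon
        push Not at hcon
        nlinarith
      · by_contra hcon
        push Not at hcon
        nlinarith
    · congr 1
      ring
  · set N : Set ℝ := range fun v : ℕ => (v : ℝ) - 1 / 2 with hN
    have hNc : N.Countable := countable_range _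
    -- Removing the countably many midpoints, where strictness may fail, does not change the length.
    have hvol : volume (Ioo (m - 1 / 2 : ℝ) (m + l - 1 / 2) \ N) = ENNReal.ofReal l := by
      rw [measure_sdiff_null (hNc.measure_zero _), Real.volume_Ioo]
      congr 1
      ring
    rw [ENNReal.ofReal_mul (by positivity), ← hvol]
    refine le_exteriorLength_stdPolygon_inter hn (a := m - 1 / 2) (by linarith)
      (measurableSet_Ioo.diff hNc.measurableSet) (fun x hx => ⟨hx.1.1.le, by linarith [hx.1.2]⟩)
      fun x hx _ => polyCurve_mem_cap hn hm hln hx.1 fun v hv => hx.2 ⟨v, hv.symm⟩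

/-- A cap lies in the sector at the centre of half-angle `l * (π / n)` about its axis. To see this,
combine the cutting inequality with the inequality of each of the two cut sides, weighted by `cos
θ`, which is nonnegative because `2 * l ≤ n`. -/
theorem sin_pos_of_mem_cap (hn : 3 ≤ n) {m l : ℕ} (hm : 0 < m) (hl : 0 < l) (hln : 2 * l ≤ n)
    {ρ φ : ℝ} (hρ : 0 ≤ ρ) (hz : (ρ * cis φ : ℂ) ∈ cap n m l) :
    0 < Real.sin (l * (Real.pi / n) - (φ - capAngle n m l)) ∧
      0 < Real.sin (l * (Real.pi / n) + (φ - capAngle n m l)) := by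
  have hα := angle_pos hn
  have hnα := mul_angle hn
  have hl' : (1 : ℝ) ≤ l := by exact_mod_cast hl
  have hln' : 2 * (l : ℝ) ≤ n := by exact_mod_cast hln
  have hθ : l * (Real.pi / n) ≤ Real.pi / 2 := by nlinarith
  have hθ0 : 0 < l * (Real.pi / n) := by positivity
  have hπ := Real.pi_pos
  have h0 := hz.2 0
  have h1 := proj_sideAngle_lt hn hz.1 (m + l - 1)
  have h2 := proj_sideAngle_lt hn hz.1 (m - 1)
  rw [proj_add_pi, neg_lt_neg_iff, proj_ofReal_mul, proj_cis] at h0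
  rw [capAngle_add n m l hl, proj_ofReal_mul, proj_cis, ← sub_sub] at h1
  rw [capAngle_sub n m l hm, proj_ofReal_mul, proj_cis, ← sub_add] at h2
  set θ := l * (Real.pi / n)
  set ψ := φ - capAngle n m l
  have hsθ : 0 < Real.sin θ := Real.sin_pos_of_pos_of_lt_pi hθ0 (by linarith)
  have hcθ : 0 ≤ Real.cos θ := Real.cos_nonneg_of_mem_Icc ⟨by linarith, by linarith⟩
  have h3 : 0 < ρ * Real.sin θ * Real.sin (θ - ψ) := by
    have e : Real.cos ψ = Real.cos (ψ - θ) * Real.cos θ + Real.sin θ * Real.sin (θ - ψ) := by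
      rw [show θ - ψ = -(ψ - θ) by ring, Real.sin_neg]
      conv_lhs => rw [show ψ = ψ - θ + θ by ring, Real.cos_add]
      ring
    rw [e] at h0
    nlinarith
  have h4 : 0 < ρ * Real.sin θ * Real.sin (θ + ψ) := by
    have e : Real.cos ψ = Real.cos (ψ + θ) * Real.cos θ + Real.sin θ * Real.sin (θ + ψ) := by
      conv_lhs => rw [show ψ = ψ + θ - θ by ring, Real.cos_sub]
      rw [add_comm θ ψ]
      ring
    rw [e] at h0
    nlinarith
  have hρs : 0 ≤ ρ * Real.sin θ := by positivity
  exact ⟨pos_of_mul_pos_right h3 hρs, pos_of_mul_pos_right h4 hρs⟩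

theorem disjoint_cap (hn : 3 ≤ n) {k l : ℕ} (hkl : n = l * k) (hk : 2 ≤ k) {i d : ℕ}
    (hd : 1 ≤ d) (hdk : d + 1 ≤ k) :
    Disjoint (cap n ((i + 1) * l) l) (cap n ((i + d + 1) * l) l) := by
  have hl : 0 < l := by
    rcases Nat.eq_zero_or_pos l with rfl | h
    · omega
    · exact h
  rw [Set.disjoint_left]
  intro z hz hz'
  obtain ⟨φ, -, he⟩ := exists_cis z
  rw [he] at hz hz'
  obtain ⟨h1, h2⟩ := sin_pos_of_mem_cap hn (by positivity) hl (by rw [hkl]; nlinarith)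
    (norm_nonneg z) hz
  obtain ⟨h3, h4⟩ := sin_pos_of_mem_cap hn (by positivity) hl (by rw [hkl]; nlinarith)
    (norm_nonneg z) hz'
  have hθ : k * (l * (Real.pi / n)) = Real.pi := by
    have h := mul_angle hn
    have hn' : (n : ℝ) = l * k := by exact_mod_cast hkl
    calc k * (l * (Real.pi / n)) = (l * k) * (Real.pi / n) := by ring
      _ = Real.pi := by rw [← hn', h]
  have e : capAngle n ((i + d + 1) * l) l =
      capAngle n ((i + 1) * l) l + 2 * (l * (Real.pi / n)) * d := by
    rw [capAngle, capAngle]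
    push_cast
    ring
  rw [e] at h3 h4
  refine not_sin_pos_of_rotated hk hθ hd hdk h1 h2 ?_ ?_
  · convert h3 using 2
    ring
  · convert h4 using 2
    ring

theorem escobarConstant_stdPolygon_le {r : WithTop ℕ∞} (hn : 3 ≤ n) {k l : ℕ} (hkl : n = l * k) :
    escobarConstant r k (stdPolygon n) ≤
      ENNReal.ofReal (Real.sin (Real.pi / k) * Real.cot (Real.pi / n) * k / n) := by
  have hk0 : k ≠ 0 := by rintro rfl; omega
  have hl : 0 < l := by
    rcases Nat.eq_zero_or_pos l with rfl | h
    · omega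
    · exact h
  rcases Nat.lt_or_ge k 2 with hk1 | hk
  -- For `k = 1` the whole polygon has no interior boundary, in agreement with `sin π = 0`; it is
  -- written with an empty family of constraints.
  · have : k = 1 := by omega
    subst this
    have hs := sin_angle_pos hn
    have hn' : (3 : ℝ) ≤ n := by exact_mod_cast hn
    have hadm : ∀ _ : Fin 1, IsAdmissible r (stdPolygon n)
        (stdPolygon n ∩ {z | ∀ i : Fin 0, proj (![] i) z < ![] i}) := fun _ =>
      isAdmissible_stdPolygon_inter r hn (x := 0) le_rfl fun i => i.elim0
    have hdisj : Pairwise fun _ _ : Fin 1 => Disjoint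
        (stdPolygon n ∩ {z | ∀ i : Fin 0, proj (![] i) z < ![] i})
        (stdPolygon n ∩ {z | ∀ i : Fin 0, proj (![] i) z < ![] i}) := fun i j hij =>
      absurd (Subsingleton.elim i j) hij
    refine (iInf₂_le _ ⟨hadm, hdisj⟩).trans (iSup_le fun _ => ?_)
    refine (ratio_le_ofReal (a := 0) (b := 2 * Real.sin (Real.pi / n) * 1) (by positivity) ?_
      ?_).trans ?_
    · refine (interiorLength_inter_le (isOpen_stdPolygon n)).trans ?_
      simp
    · have hvol : volume (Ico (0 : ℝ) 1) = ENNReal.ofReal 1 := by simp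
      rw [ENNReal.ofReal_mul (by positivity), ← hvol]
      exact le_exteriorLength_stdPolygon_inter hn le_rfl measurableSet_Ico
        (fun x hx => ⟨hx.1, by linarith [hx.2]⟩) fun x _ i => i.elim0
    · simp
  · have hln : l < n := by rw [hkl]; nlinarith
    have hdisj : Pairwise fun i j : Fin k =>
        Disjoint (cap n ((i.1 + 1) * l) l) (cap n ((j.1 + 1) * l) l) := by
      have key : ∀ i j : Fin k, i < j →
          Disjoint (cap n ((i.1 + 1) * l) l) (cap n ((j.1 + 1) * l) l) := by
        intro i j hij
        have hij' : i.1 < j.1 := hij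
        have := disjoint_cap hn hkl hk (i := i.1) (d := j.1 - i.1) (by omega) (by omega)
        rwa [show i.1 + (j.1 - i.1) + 1 = j.1 + 1 by omega] at this
      intro i j hij
      rcases lt_or_gt_of_ne hij with h | h
      · exact key i j h
      · exact (key j i h).symm
    -- The caps start at the vertices `(j + 1) * l`; the shift by one makes the starting index
    -- positive, as the cap lemmas demand.
    refine (iInf₂_le (fun j : Fin k => cap n ((j.1 + 1) * l) l)
      ⟨fun j => isAdmissible_cap r hn (by positivity) hl hln, hdisj⟩).trans ?_
    refine iSup_le fun j => (ratio_cap_le hn (by positivity) hl hln).trans_eq ?_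
    have hs := (sin_angle_pos hn).ne'
    have hl' : (l : ℝ) ≠ 0 := by exact_mod_cast hl.ne'
    have hk' : (k : ℝ) ≠ 0 := by exact_mod_cast hk0
    have hn' : (n : ℝ) = l * k := by exact_mod_cast hkl
    have hn0 : (n : ℝ) ≠ 0 := by rw [hn']; exact mul_ne_zero hl' hk'
    have hθ : Real.pi / k = l * (Real.pi / n) := by rw [hn']; field_simp
    have hkn : (k : ℝ) / n = 1 / l := by rw [hn']; field_simp
    rw [hθ, Real.cot_eq_cos_div_sin, mul_div_assoc _ (k : ℝ), hkn]
    congr 1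
    field_simp

end Escobar

end

/-! ### The theorem on regular polygons -/

theorem theorem1p3 (r : WithTop ℕ∞) (hr : 1 ≤ r) (n : ℕ) (hn : 3 ≤ n) (c w : ℂ) (hw : w ≠ 0) :
    (∀ k : ℕ, n ≤ k →
      Escobar.escobarConstant r k (Escobar.regularPolygon n c w) =
          ENNReal.ofReal (Real.cos (Real.pi / n)) ∧
        ENNReal.ofReal (Real.cos (Real.pi / n)) ≤
          Escobar.escobarConstant r k Escobar.unitDisk) ∧
    (∀ k ℓ : ℕ, n = ℓ * k →
      Escobar.escobarConstant r k (Escobar.regularPolygon n c w) =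
          ENNReal.ofReal (Real.sin (Real.pi / k) * Real.cot (Real.pi / n) * k / n) ∧
        ENNReal.ofReal (Real.sin (Real.pi / k) * Real.cot (Real.pi / n) * k / n) ≤
          Escobar.escobarConstant r k Escobar.unitDisk) := by
  have hs := Escobar.sin_angle_pos hn
  have hc := Escobar.cos_angle_pos hn
  have hn0 : (0 : ℝ) < n := by exact_mod_cast (by omega : 0 < n)
  have hpoly : ∀ k, Escobar.escobarConstant r k (Escobar.regularPolygon n c w) =
      Escobar.escobarConstant r k (Escobar.stdPolygon n) := fun k => by
    rw [Escobar.regularPolygon_eq_similarity n c w hw, Escobar.escobarConstant_similarity hr,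
      Escobar.regularPolygon_std hn]
  have hdisk : ∀ k ℓ : ℕ, n = ℓ * k →
      ENNReal.ofReal (Real.sin (Real.pi / k) * Real.cot (Real.pi / n) * k / n) ≤
        Escobar.escobarConstant r k Escobar.unitDisk := by
    intro k ℓ hkl
    have hk : 1 ≤ k := by
      rcases Nat.eq_zero_or_pos k with rfl | h
      · omega
      · exact h
    have hk' : (1 : ℝ) ≤ k := by exact_mod_cast hk
    refine le_trans (ENNReal.ofReal_le_ofReal ?_) (Escobar.le_escobarConstant_unitDisk hr hk)
    have hsk : 0 ≤ Real.sin (Real.pi / k) :=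
      Real.sin_nonneg_of_nonneg_of_le_pi (by positivity) (div_le_self Real.pi_pos.le hk')
    -- This is `x ≤ tan x` at `x = π / n`; it makes the polygon's constant at most the lower bound
    -- for the disk.
    have hcot : Real.cot (Real.pi / n) / n ≤ 1 / Real.pi := by
      have htan := Real.le_tan (Escobar.angle_pos hn).le
        (lt_of_le_of_lt (Escobar.angle_le hn) (by linarith [Real.pi_pos]))
      rw [Real.tan_eq_sin_div_cos, div_le_div_iff₀ hn0 hc] at htan
      rw [Real.cot_eq_cos_div_sin, div_div, div_le_div_iff₀ (by positivity) Real.pi_pos]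
      linarith
    calc Real.sin (Real.pi / k) * Real.cot (Real.pi / n) * k / n =
          Real.sin (Real.pi / k) * k * (Real.cot (Real.pi / n) / n) := by ring
      _ ≤ Real.sin (Real.pi / k) * k * (1 / Real.pi) := by gcongr
      _ = _ := by ring
  -- For `k = n` and `ℓ = 1` the second formula reduces to the first; larger `k` are covered by
  -- monotonicity.
  have hself : Real.sin (Real.pi / n) * Real.cot (Real.pi / n) * n / n =
      Real.cos (Real.pi / n) := by
    rw [Real.cot_eq_cos_div_sin]
    field_simp
  refine ⟨fun k hk => ⟨?_, ?_⟩, fun k ℓ hkl => ⟨?_, hdisk k ℓ hkl⟩⟩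
  · rw [hpoly]
    refine le_antisymm (Escobar.escobarConstant_stdPolygon_le_cos hn k) ?_
    refine le_trans ?_ (Escobar.escobarConstant_mono hk)
    rw [← hself]
    exact Escobar.le_escobarConstant_stdPolygon hr hn (one_mul n).symm
  · refine le_trans ?_ (Escobar.escobarConstant_mono hk)
    rw [← hself]
    exact hdisk n 1 (one_mul n).symm
  · rw [hpoly]
    exact le_antisymm (Escobar.escobarConstant_stdPolygon_le hn hkl)
      (Escobar.le_escobarConstant_stdPolygon hr hn hkl)
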